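/- **Conventions.** Let $\Bbbk$ be a field, $\mathbb N=\{1,2,\dots\}$, $\mathbb N_0=\mathbb N\cup\{0\}$. Let $A=\bigoplus_{n\ge 0}A_n$ be a quadratic algebra: $A_0=\Bbbk$, $V=A_1$ is finite-dimensional, and $A=T(V)/(R)$ with $R\subseteq V^{\otimes 2}$. Modules are right modules, graded modules are $\mathbb Z$-graded, their morphisms are homogeneous of degree $0$, and $M(j)_i=M_{j+i}$. A graded module $M$ is quadratic if $V_M=M_0$ is finite-dimensional, and $V_M\otimes A\to M$ is surjective with kernel generated by a subspace $R_M\subseteq V_M\otimes V$. Let $A^!=T(V^*)/(R^\perp)$, let $M^{!_m}=(V_M^*\otimes A^!)/(R_M^\perp A^!)$, and let $A^!_{-n}$, $M^{!_m}_{-n}$ be the components of tensor degree $n$ in $V^*$. The Koszul complex of $M$ is $\mathrm K^{\rm mod}_n(M)=(M^{!_m}_{-n})^*\otimes A$ (with $(M^{!_m}_{-n})^*$ in internal degree $n$), with differential $\varphi\otimes a\mapsto\sum_i (f_i\cdot\varphi)\otimes v_ia$, where $(v_i)$, $(f_i)$ are dual bases of $V$, $V^*$ and $(f\cdot\varphi)(c)=\varphi(cf)$.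 **Resolving data.** A resolving datum on $A$ consists of pairwise non-isomorphic quadratic modules $M^0=\Bbbk,M^1,\dots,M^N$, a finitely supported map $h=(h_1,h_2):\{0,\dots,N\}^2\times\mathbb N^2\to\mathbb N_0^2$, and, for all $0\le i\le N$ and $k\in\mathbb N$, short exact sequences of graded modules $$0\to\bigoplus_{j,\ell}\big(M^j(-\ell)\big)^{h_1(i,j,k,\ell)}\to H_k(\mathrm K^{\rm mod}_\bullet(M^i))\to\bigoplus_{j,\ell}\big(M^j(-\ell)\big)^{h_2(i,j,k,\ell)}\to0$$ such that, if the sequence for $(i,k)$ splits, then $h_1(i,j,k,\ell)=0$ for all $j,\ell$. Its resolving quiver has vertices $M^0,\dots,M^N$ and, for all $i,j,k,\ell$, a set $\mathrm{Ar}'_{i,j,k,\ell}$ of $h_1(i,j,k,\ell)$ arrows and a disjoint set $\mathrm{Ar}''_{i,j,k,\ell}$ of $h_2(i,j,k,\ell)$ arrows from $M^i$ to $M^j$, all of bidegree $(k+1,\ell)$. The datum is connected if the underlying graph of this quiver is connected. For a path $\bar\alpha$ with target $t(\bar\alpha)$, the bidegree $(\mathrm{bideg}_1(\bar\alpha),\mathrm{bideg}_2(\bar\alpha))$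 is the sum of the bidegrees of its arrows, and $\mathrm{ddeg}=\mathrm{bideg}_2-\mathrm{bideg}_1$ for arrows and paths. For arrows with the same source and the same $\mathrm{bideg}_1$, each arrow of a set $\mathrm{Ar}''$ is smaller than each arrow of a set $\mathrm{Ar}'$, and there are no other relations. Let $\mathrm{Pa}_{M^i}$ be the set of paths with source $M^i$. For $\bar\alpha,\bar\beta\in\mathrm{Pa}_{M^i}$, set $\bar\alpha<\bar\beta$ if $\bar\alpha=\bar\gamma\bar\alpha'$ and $\bar\beta=\bar\gamma\bar\beta'$ for a common initial path $\bar\gamma$ (possibly of length zero) such that either $\bar\beta'$ has length $0$ and $\bar\alpha'$ has positive length, or both have positive length and their first arrows $a$, $b$ satisfy $\mathrm{bideg}_1(a)<\mathrm{bideg}_1(b)$, or $\mathrm{bideg}_1(a)=\mathrm{bideg}_1(b)$ and $a<b$. **Theorem.** Let $A$ be a quadratic algebra with a connected resolving datum $\{M^0=\Bbbk,\dots,M^N\}$. Then every $M^i$ has a projective resolution $(P^{M^i}_\bullet,d_\bullet)$ in the category of bounded below graded right $A$-modules such that, for all $n\in\mathbb N_0$, $$P^{M^i}_n=\bigoplus_{\bar\alpha\in\mathrm{Pa}_{M^i},\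 \mathrm{bideg}_1(\bar\alpha)\le n}\mathrm K^{\rm mod}_{n-\mathrm{bideg}_1(\bar\alpha)}\big(t(\bar\alpha)\big)\big(-\mathrm{bideg}_2(\bar\alpha)\big).$$ It can be chosen to be an iterated cone of the Koszul complexes indexed by the paths, in the following sense: for every $n$, the component of $d_{n+1}:P^{M^i}_{n+1}\to P^{M^i}_n$ from the summand of $\bar\alpha$ to the summand of $\bar\alpha$ (when $\mathrm{bideg}_1(\bar\alpha)\le n$) is the differential of the Koszul complex of $t(\bar\alpha)$, and the component from the summand of $\bar\alpha$ to that of $\bar\beta\ne\bar\alpha$ is zero unless $\bar\alpha<\bar\beta$. Moreover, if $$\mathrm{ddeg}(\bar\alpha)\ne\mathrm{ddeg}(\bar\beta)-1\quad\text{for all }\bar\alpha,\bar\beta\in\mathrm{Pa}_{M^i}\text{ with }\bar\alpha<\bar\beta,\qquad(*)$$ then this resolution of $M^i$ is minimal, that is, $d_{n+1}(P^{M^i}_{n+1})\subseteq P^{M^i}_n A_{>0}$ for all $n\ge 0$. If $\mathrm{ddeg}(a)$ is even for every arrow $a$ of the resolving quiver, then $(*)$ holds for every $i$. -/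

import Mathlib

open scoped TensorProduct DirectSum
open MulOpposite

universe u

noncomputable section

namespace Quad

section Graded

variable {k : Type u} [Field k]

/-- A family of subspaces with compatible projections is a direct sum decomposition. -/
theorem isInternal_of_proj {M : Type u} [AddCommGroup M] [Module k M]
    (deg : ℤ → Submodule k M) (p : ℤ → M →ₗ[k] M)
    (h1 : ∀ d x, x ∈ deg d → p d x = x)
    (h2 : ∀ d e x, d ≠ e → x ∈ deg e → p d x = 0)
    (h3 : ∀ x, x ∈ ⨆ d, deg d) : DirectSum.IsInternal deg := by
  rw [DirectSum.isInternal_submodule_iff_iSupIndep_and_iSup_eq_top]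
  refine ⟨fun d => ?_, eq_top_iff.2 fun x _ => h3 x⟩
  rw [Submodule.disjoint_def]
  intro x hx hx'
  have hle : (⨆ (e : ℤ) (_ : e ≠ d), deg e) ≤ LinearMap.ker (p d) :=
    iSup₂_le fun e he y hy => h2 d e y he.symm hy
  rw [← h1 d x hx]
  exact hle hx'

variable {A : Type u} [Ring A] [Algebra k A]

/-- Graded right modules over the `ℕ`-graded algebra `A = ⨁ 𝒜 n`. Right `A`-modules are modules
over the opposite algebra, `x · a = op a • x`; the grading is by `ℤ`. -/
structure GrMod (𝒜 : ℕ → Submodule k A) where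
  carrier : Type u
  [addCommGroup : AddCommGroup carrier]
  [moduleBase : Module k carrier]
  [module : Module Aᵐᵒᵖ carrier]
  [isScalarTower : IsScalarTower k Aᵐᵒᵖ carrier]
  deg : ℤ → Submodule k carrier
  isInternal : DirectSum.IsInternal deg
  smul_mem : ∀ (i : ℤ) (j : ℕ) (x : carrier) (a : A),
    x ∈ deg i → a ∈ 𝒜 j → op a • x ∈ deg (i + j)

variable {𝒜 : ℕ → Submodule k A}

instance : CoeSort (GrMod 𝒜) (Type u) := ⟨GrMod.carrier⟩

attribute [instance] GrMod.addCommGroup GrMod.moduleBase GrMod.module GrMod.isScalarTower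

/-- Morphisms of graded right modules: homogeneous `A`-linear maps of degree zero. -/
structure GrHom (X Y : GrMod 𝒜) where
  toLin : X →ₗ[Aᵐᵒᵖ] Y
  map_deg : ∀ (d : ℤ) (x : X), x ∈ X.deg d → toLin x ∈ Y.deg d

instance (X Y : GrMod 𝒜) : CoeFun (GrHom X Y) (fun _ => X → Y) := ⟨fun f => f.toLin⟩

/-- The zero morphism. -/
def GrHom.zero (X Y : GrMod 𝒜) : GrHom X Y := ⟨0, fun _ _ _ => by simp⟩

namespace GrMod

/-- `X` and `Y` are isomorphic as graded right modules. -/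
def IsIso (X Y : GrMod 𝒜) : Prop :=
  ∃ e : X ≃ₗ[Aᵐᵒᵖ] Y, ∀ (d : ℤ) (x : X), x ∈ X.deg d ↔ e x ∈ Y.deg d

def IsBoundedBelow (X : GrMod 𝒜) : Prop := ∃ b : ℤ, ∀ d < b, X.deg d = ⊥

/-- Projective objects of the category of bounded below graded right modules: bounded below graded
modules with the lifting property against surjective morphisms between bounded below graded
modules. -/
def IsProjective (P : GrMod 𝒜) : Prop :=
  P.IsBoundedBelow ∧
    ∀ X Y : GrMod 𝒜, X.IsBoundedBelow → Y.IsBoundedBelow →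
      ∀ (g : GrHom X Y) (f : GrHom P Y), Function.Surjective g →
        ∃ f' : GrHom P X, ∀ p : P, g (f' p) = f p

/-- The submodule `X · A_{>0}`. -/
def radical (X : GrMod 𝒜) : Submodule Aᵐᵒᵖ X :=
  Submodule.span Aᵐᵒᵖ {y | ∃ (x : X) (j : ℕ) (a : A), 0 < j ∧ a ∈ 𝒜 j ∧ y = op a • x}

/-- The decomposition of a graded module. -/
def equiv (X : GrMod 𝒜) : (⨁ d, X.deg d) ≃ₗ[k] X :=
  LinearEquiv.ofBijective (DirectSum.coeLinearMap X.deg) X.isInternal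

theorem equiv_apply (X : GrMod 𝒜) (y : ⨁ d, X.deg d) :
    X.equiv y = DirectSum.coeLinearMap X.deg y := rfl

/-- The projection of a graded module onto its component of degree `d`. -/
def proj (X : GrMod 𝒜) (d : ℤ) : X →ₗ[k] X :=
  (X.deg d).subtype ∘ₗ DirectSum.component k ℤ (fun i => X.deg i) d ∘ₗ X.equiv.symm.toLinearMap

theorem proj_mem (X : GrMod 𝒜) (d : ℤ) (x : X) : X.proj d x ∈ X.deg d := by
  simp [proj]

theorem symm_of_mem (X : GrMod 𝒜) (e : ℤ) (x : X) (hx : x ∈ X.deg e) :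
    X.equiv.symm x = DirectSum.lof k ℤ (fun i => X.deg i) e ⟨x, hx⟩ := by
  rw [LinearEquiv.symm_apply_eq, equiv_apply, DirectSum.coeLinearMap_lof]

theorem proj_of_mem (X : GrMod 𝒜) (d : ℤ) (x : X) (hx : x ∈ X.deg d) : X.proj d x = x := by
  simp [proj, symm_of_mem X d x hx, DirectSum.component.lof_self]

theorem proj_of_ne (X : GrMod 𝒜) (d e : ℤ) (x : X) (h : d ≠ e) (hx : x ∈ X.deg e) :
    X.proj d x = 0 := by
  simp [proj, symm_of_mem X e x hx, DirectSum.component.of, h.symm]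

theorem mem_iSup (X : GrMod 𝒜) (x : X) : x ∈ ⨆ d, X.deg d := by
  have := (DirectSum.isInternal_submodule_iff_iSupIndep_and_iSup_eq_top X.deg).1 X.isInternal
  rw [this.2]; trivial

theorem proj_map {X Y : GrMod 𝒜} (f : GrHom X Y) (d : ℤ) (x : X) :
    f (X.proj d x) = Y.proj d (f x) := by
  induction X.mem_iSup x using Submodule.iSup_induction' with
  | mem e x hx =>
    by_cases h : d = e
    · subst h
      rw [X.proj_of_mem d x hx, Y.proj_of_mem d _ (f.map_deg d x hx)]
    · rw [X.proj_of_ne d e x h hx, Y.proj_of_ne d e _ h (f.map_deg e x hx), map_zero]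
  | zero => simp
  | add x y _ _ hx hy => simp only [map_add, hx, hy]

theorem exists_sum_proj (X : GrMod 𝒜) (x : X) : ∃ s : Finset ℤ, x = ∑ d ∈ s, X.proj d x := by
  classical
  refine ⟨DFinsupp.support (X.equiv.symm x), ?_⟩
  conv_lhs => rw [← X.equiv.apply_symm_apply x, ← DirectSum.sum_support_of (X.equiv.symm x),
    map_sum]
  refine Finset.sum_congr rfl fun d _ => ?_
  exact DirectSum.coeLinearMap_lof X.deg d _

/-- The shift `X(j)`, with `X(j)_i = X_{j+i}`. -/
def shift (X : GrMod 𝒜) (j : ℤ) : GrMod 𝒜 where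
  carrier := X
  deg i := X.deg (j + i)
  isInternal := isInternal_of_proj _ (fun d => X.proj (j + d))
    (fun d x hx => X.proj_of_mem _ x hx)
    (fun d e x h hx => X.proj_of_ne _ _ x (by omega) hx)
    (fun x => by
      have := X.mem_iSup x
      rwa [← (Equiv.addLeft j).iSup_comp] at this)
  smul_mem i n x a hx ha := by
    rw [← add_assoc]
    exact X.smul_mem _ _ _ _ hx ha

/-- The direct sum of a family of graded modules. -/
def directSum {ι : Type} (X : ι → GrMod 𝒜) : GrMod 𝒜 where
  carrier := ⨁ i, X i
  deg d := ⨅ i, ((X i).deg d).comap (DirectSum.component k ι (fun i => X i) i)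
  isInternal := by
    classical
    refine isInternal_of_proj _ (fun d => DFinsupp.mapRange.linearMap fun i => (X i).proj d)
      (fun d x hx => ?_) (fun d e x h hx => ?_) (fun x => ?_)
    · refine DFinsupp.ext fun i => ?_
      rw [Submodule.mem_iInf] at hx
      exact (X i).proj_of_mem d _ (hx i)
    · refine DFinsupp.ext fun i => ?_
      rw [Submodule.mem_iInf] at hx
      exact (X i).proj_of_ne d e _ h (hx i)
    · induction x using DirectSum.induction_on with
      | zero => exact Submodule.zero_mem _
      | of i x =>
        induction (X i).mem_iSup x using Submodule.iSup_induction' with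
        | mem e x hx =>
          refine Submodule.mem_iSup_of_mem e ?_
          rw [Submodule.mem_iInf]
          intro j
          by_cases h : i = j
          · subst h
            rw [Submodule.mem_comap, ← DirectSum.lof_eq_of k, DirectSum.component.lof_self]
            exact hx
          · rw [Submodule.mem_comap, ← DirectSum.lof_eq_of k, DirectSum.component.of, dif_neg h]
            exact Submodule.zero_mem _
        | zero => rw [map_zero]; exact Submodule.zero_mem _
        | add x y _ _ hx hy => rw [map_add]; exact Submodule.add_mem _ hx hy
      | add x y hx hy => exact Submodule.add_mem _ hx hy
  smul_mem d n x a hx ha := by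
    rw [Submodule.mem_iInf] at hx ⊢
    exact fun i => (X i).smul_mem d n _ a (hx i) ha

/-- The inclusion of a summand of a direct sum. -/
def incl {ι : Type} (X : ι → GrMod 𝒜) (i : ι) : X i →ₗ[Aᵐᵒᵖ] directSum X :=
  letI := Classical.decEq ι
  DirectSum.lof Aᵐᵒᵖ ι (fun i => X i) i

/-- The projection of a direct sum to a summand. -/
def comp {ι : Type} (X : ι → GrMod 𝒜) (i : ι) : directSum X →ₗ[Aᵐᵒᵖ] X i :=
  DirectSum.component Aᵐᵒᵖ ι (fun i => X i) i

/-- The homology `Ker g / Im f` at `Y` of a complex `X → Y → Z`, with the induced grading. -/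
def homology {X Y Z : GrMod 𝒜} (f : GrHom X Y) (g : GrHom Y Z) : GrMod 𝒜 where
  carrier := LinearMap.ker g.toLin ⧸
    (LinearMap.range f.toLin).comap (LinearMap.ker g.toLin).subtype
  deg d := ((Y.deg d).comap ((LinearMap.ker g.toLin).subtype.restrictScalars k)).map
    (((LinearMap.range f.toLin).comap (LinearMap.ker g.toLin).subtype).mkQ.restrictScalars k)
  isInternal := by
    let K := LinearMap.ker g.toLin
    let B := (LinearMap.range f.toLin).comap K.subtype
    have hK : ∀ d, ∀ y ∈ K, Y.proj d y ∈ K := fun d y hy => by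
      rw [LinearMap.mem_ker] at hy ⊢
      rw [proj_map, hy, map_zero]
    let q : ℤ → K →ₗ[k] K := fun d => (Y.proj d).restrict (p := K.restrictScalars k)
      (q := K.restrictScalars k) (hK d)
    have hB : ∀ d, B.restrictScalars k ≤ (B.restrictScalars k).comap (q d) := by
      rintro d ⟨y, hy⟩ ⟨x, hx⟩
      exact ⟨X.proj d x, by rw [proj_map, hx]; rfl⟩
    refine isInternal_of_proj _
      (fun d => (B.restrictScalars k).mapQ (B.restrictScalars k) (q d) (hB d)) ?_ ?_ ?_
    · rintro d _ ⟨y, hy, rfl⟩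
      refine congrArg B.mkQ (Subtype.ext ?_)
      exact Y.proj_of_mem d _ hy
    · rintro d e _ h ⟨y, hy, rfl⟩
      refine (congrArg B.mkQ (Subtype.ext ?_)).trans (map_zero B.mkQ)
      exact Y.proj_of_ne d e _ h hy
    · intro x
      obtain ⟨y, rfl⟩ := B.mkQ_surjective x
      obtain ⟨s, hs⟩ := Y.exists_sum_proj y
      have : y = ∑ d ∈ s, q d y := Subtype.ext (by
        rw [AddSubmonoidClass.coe_finsetSum]
        exact hs)
      rw [this, map_sum]
      exact Submodule.sum_mem _ fun d _ => Submodule.mem_iSup_of_mem d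
        ⟨q d y, Y.proj_mem d _, rfl⟩
  smul_mem := by
    rintro d n _ a ⟨y, hy, rfl⟩ ha
    exact ⟨op a • y, Y.smul_mem d n _ a hy ha, rfl⟩

end GrMod

/-- `⋯ → P 2 → P 1 → P 0 → M → 0` is a projective resolution of `M` in the category of bounded
below graded right modules. -/
structure IsProjectiveResolution (P : ℕ → GrMod 𝒜) (d : ∀ n, GrHom (P (n + 1)) (P n))
    (M : GrMod 𝒜) (ε : GrHom (P 0) M) : Prop where
  projective : ∀ n, (P n).IsProjective
  surjective : Function.Surjective ε
  exact_zero : Function.Exact (d 0) ε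
  exact_succ : ∀ n, Function.Exact (d (n + 1)) (d n)

/-- A complex of graded right modules is minimal if `d (P (n + 1)) ⊆ P n · A_{>0}` for all `n`,
equivalently if all differentials of `P ⊗_A k` vanish. -/
def IsMinimal (P : ℕ → GrMod 𝒜) (d : ∀ n, GrHom (P (n + 1)) (P n)) : Prop :=
  ∀ (n : ℕ) (x : P (n + 1)), d n x ∈ (P n).radical

end Graded

section Quadratic

variable {k : Type u} [Field k] {A : Type u} [Ring A] [Algebra k A]

/-- The space of relations `R ⊆ V ⊗ V` of `A`, with `V = A_1`: the kernel of `V ⊗ V → A`. -/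
def relations (𝒜 : ℕ → Submodule k A) : Submodule k (𝒜 1 ⊗[k] 𝒜 1) :=
  LinearMap.ker (LinearMap.mul' k A ∘ₗ TensorProduct.map (𝒜 1).subtype (𝒜 1).subtype)

/-- The map from the tensor square of `V` to the tensor algebra. -/
def tensorSquare (k V : Type u) [Field k] [AddCommGroup V] [Module k V] :
    V ⊗[k] V →ₗ[k] TensorAlgebra k V :=
  LinearMap.mul' k _ ∘ₗ TensorProduct.map (TensorAlgebra.ι k) (TensorAlgebra.ι k)

/-- `A = ⨁ 𝒜 n` is a quadratic algebra: it is connected, `V = A_1` is finite dimensional, and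
`T(V) → A` is surjective with kernel generated by a space of quadratic relations (which is then
necessarily the kernel of `V ⊗ V → A`). -/
structure IsQuadraticAlgebra (𝒜 : ℕ → Submodule k A) [GradedAlgebra 𝒜] : Prop where
  nontrivial : Nontrivial A
  connected : 𝒜 0 = 1
  finite : FiniteDimensional k (𝒜 1)
  surjective : Function.Surjective (TensorAlgebra.lift k (𝒜 1).subtype)
  ker_eq : TwoSidedIdeal.ker (TensorAlgebra.lift k (𝒜 1).subtype) =
    TwoSidedIdeal.span (tensorSquare k (𝒜 1) '' (relations 𝒜 : Set (𝒜 1 ⊗[k] 𝒜 1)))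

/-- The orthogonal `R^⊥ ⊆ V^* ⊗ W^*` of `R ⊆ V ⊗ W`. -/
def orthogonal {V W : Type u} [AddCommGroup V] [Module k V] [AddCommGroup W] [Module k W]
    (R : Submodule k (V ⊗[k] W)) : Submodule k (Module.Dual k V ⊗[k] Module.Dual k W) :=
  R.dualAnnihilator.comap (TensorProduct.dualDistrib k V W)

/-- The quadratic dual algebra `A^! = T(V^*) / (R^⊥)`. -/
def DualAlg (𝒜 : ℕ → Submodule k A) : Type u :=
  (TwoSidedIdeal.span (tensorSquare k (Module.Dual k (𝒜 1)) ''
    (orthogonal (relations 𝒜) : Set _))).ringCon.Quotient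

instance (𝒜 : ℕ → Submodule k A) : Ring (DualAlg 𝒜) :=
  inferInstanceAs (Ring (RingCon.Quotient _))

instance (𝒜 : ℕ → Submodule k A) : Algebra k (DualAlg 𝒜) :=
  inferInstanceAs (Algebra k (RingCon.Quotient _))

/-- The quotient map `T(V^*) → A^!`. -/
def dualMk (𝒜 : ℕ → Submodule k A) : TensorAlgebra k (Module.Dual k (𝒜 1)) →ₐ[k] DualAlg 𝒜 :=
  RingCon.mkₐ k _

/-- The canonical map `V^* → A^!`. -/
def dualι (𝒜 : ℕ → Submodule k A) : Module.Dual k (𝒜 1) →ₗ[k] DualAlg 𝒜 :=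
  (dualMk 𝒜).toLinearMap ∘ₗ TensorAlgebra.ι k

/-- The component `A^!_{-n}`, spanned by the `n`-fold products of elements of `V^*`. -/
def dualDeg (𝒜 : ℕ → Submodule k A) (n : ℕ) : Submodule k (DualAlg 𝒜) :=
  LinearMap.range (dualι 𝒜) ^ n

variable {𝒜 : ℕ → Submodule k A}

/-- The space of generators `V_M = M_0`. -/
abbrev gens (M : GrMod 𝒜) : Submodule k M := M.deg 0

/-- The canonical map `V_M ⊗ A → M`. The free right module `V_M ⊗ A` is written as `A ⊗ V_M`,
where `A` acts by right multiplication on the factor `A`. -/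
def action (M : GrMod 𝒜) : A ⊗[k] gens M →ₗ[Aᵐᵒᵖ] M :=
  TensorProduct.AlgebraTensorModule.lift
    { toFun := fun a =>
        { toFun := fun m => op a • (m : M)
          map_add' := by intro x y; simp
          map_smul' := by intro c x; exact smul_comm (op a) c (x : M) }
      map_add' := by intro a b; ext m; simp [add_smul]
      map_smul' := by intro c a; ext m; simp [mul_smul] }

/-- The map `V_M ⊗ V → V_M ⊗ A`. -/
def genInclusion (M : GrMod 𝒜) : gens M ⊗[k] 𝒜 1 →ₗ[k] A ⊗[k] gens M :=
  TensorProduct.map (𝒜 1).subtype LinearMap.id ∘ₗ (TensorProduct.comm k _ _).toLinearMap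

/-- The space of relations `R_M ⊆ V_M ⊗ V` of `M`: the kernel of `V_M ⊗ V → M`. -/
def modRelations (M : GrMod 𝒜) : Submodule k (gens M ⊗[k] 𝒜 1) :=
  LinearMap.ker ((action M).restrictScalars k ∘ₗ genInclusion M)

/-- `M` is a quadratic module: `V_M = M_0` is finite dimensional and `V_M ⊗ A → M` is surjective
with kernel generated by a subspace of `V_M ⊗ V` (which is then necessarily the kernel of
`V_M ⊗ V → M`). In particular `M` vanishes in negative degrees. -/
structure IsQuadraticModule (M : GrMod 𝒜) : Prop where
  finite : FiniteDimensional k (gens M)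
  surjective : Function.Surjective (action M)
  ker_eq : LinearMap.ker (action M) =
    Submodule.span Aᵐᵒᵖ (genInclusion M '' (modRelations M : Set (gens M ⊗[k] 𝒜 1)))

/-- `M` is isomorphic to the trivial module `k = A / A_{>0}`: it is one-dimensional, concentrated
in degree zero (so that `A_{>0}` acts by zero). -/
def IsTrivialModule (M : GrMod 𝒜) : Prop :=
  Module.finrank k M = 1 ∧ M.deg 0 = ⊤

/-- The map from `V_M^* ⊗ V^*` to the free right `A^!`-module on `V_M^*`, which is written as
`A^! ⊗ V_M^*` with `A^!` acting by right multiplication on the factor `A^!`. -/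
def dualGenInclusion (M : GrMod 𝒜) :
    Module.Dual k (gens M) ⊗[k] Module.Dual k (𝒜 1) →ₗ[k]
      DualAlg 𝒜 ⊗[k] Module.Dual k (gens M) :=
  TensorProduct.map (dualι 𝒜) LinearMap.id ∘ₗ (TensorProduct.comm k _ _).toLinearMap

/-- The submodule generated by `R_M^⊥`. -/
def dualRelations (M : GrMod 𝒜) :
    Submodule (DualAlg 𝒜)ᵐᵒᵖ (DualAlg 𝒜 ⊗[k] Module.Dual k (gens M)) :=
  Submodule.span _ (dualGenInclusion M '' (orthogonal (modRelations M) : Set _))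

/-- The quadratic dual `M^!`, a right `A^!`-module. -/
def DualMod (M : GrMod 𝒜) : Type u :=
  (DualAlg 𝒜 ⊗[k] Module.Dual k (gens M)) ⧸ dualRelations M

instance (M : GrMod 𝒜) : AddCommGroup (DualMod M) :=
  inferInstanceAs (AddCommGroup (_ ⧸ dualRelations M))

instance (M : GrMod 𝒜) : Module (DualAlg 𝒜)ᵐᵒᵖ (DualMod M) :=
  inferInstanceAs (Module (DualAlg 𝒜)ᵐᵒᵖ (_ ⧸ dualRelations M))

instance (M : GrMod 𝒜) : Module k (DualMod M) :=
  inferInstanceAs (Module k (_ ⧸ dualRelations M))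

instance (M : GrMod 𝒜) : IsScalarTower k (DualAlg 𝒜)ᵐᵒᵖ (DualMod M) :=
  inferInstanceAs (IsScalarTower k (DualAlg 𝒜)ᵐᵒᵖ (_ ⧸ dualRelations M))

/-- The quotient map `V_M^* ⊗ A^! → M^!`. -/
def dualModMk (M : GrMod 𝒜) :
    DualAlg 𝒜 ⊗[k] Module.Dual k (gens M) →ₗ[(DualAlg 𝒜)ᵐᵒᵖ] DualMod M :=
  (dualRelations M).mkQ

/-- The component `M^!_{-n}`, the image of `V_M^* ⊗ A^!_{-n}`. -/
def dualModDeg (M : GrMod 𝒜) (n : ℕ) : Submodule k (DualMod M) :=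
  (LinearMap.range (TensorProduct.map (dualDeg 𝒜 n).subtype
    (LinearMap.id : Module.Dual k (gens M) →ₗ[k] _))).map
      ((dualModMk M).restrictScalars k)

theorem dualModDeg_smul (M : GrMod 𝒜) (n : ℕ) (f : Module.Dual k (𝒜 1)) (c : DualMod M)
    (hc : c ∈ dualModDeg M n) : op (dualι 𝒜 f) • c ∈ dualModDeg M (n + 1) := by
  obtain ⟨_, ⟨t, rfl⟩, rfl⟩ := hc
  refine ⟨op (dualι 𝒜 f) • TensorProduct.map (dualDeg 𝒜 n).subtype LinearMap.id t, ?_, rfl⟩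
  induction t using TensorProduct.induction_on with
  | zero => simp
  | add x y hx hy =>
    rw [map_add, smul_add]
    exact Submodule.add_mem _ hx hy
  | tmul b w =>
    refine ⟨⟨(b : DualAlg 𝒜) * dualι 𝒜 f, ?_⟩ ⊗ₜ w, ?_⟩
    · rw [dualDeg, pow_succ]
      exact Submodule.mul_mem_mul b.2 ⟨f, rfl⟩
    · simp [TensorProduct.smul_tmul']

/-- The right multiplication `c ↦ c · f` from `M^!_{-n}` to `M^!_{-n-1}`, for `f ∈ V^*`. -/
def rightMul (M : GrMod 𝒜) (n : ℕ) (f : Module.Dual k (𝒜 1)) :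
    dualModDeg M n →ₗ[k] dualModDeg M (n + 1) where
  toFun c := ⟨op (dualι 𝒜 f) • (c : DualMod M), dualModDeg_smul M n f c c.2⟩
  map_add' x y := Subtype.ext (by simp)
  map_smul' r x := Subtype.ext (smul_comm _ _ _)

/-- The left action `φ ↦ f · φ` of `f ∈ V^*` on the graded dual of `M^!`: `(f · φ) c = φ (c · f)`. -/
def leftAct (M : GrMod 𝒜) (n : ℕ) (f : Module.Dual k (𝒜 1)) :
    Module.Dual k (dualModDeg M (n + 1)) →ₗ[k] Module.Dual k (dualModDeg M n) :=
  (rightMul M n f).dualMap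

/-- Left multiplication by `v` on `A`, a morphism of right `A`-modules. -/
def leftMul (v : A) : A →ₗ[Aᵐᵒᵖ] A where
  toFun a := v * a
  map_add' := mul_add v
  map_smul' c a := by simp [mul_assoc]

/-- `A_d` for an integer `d`, zero if `d` is negative. -/
def intDeg (𝒜 : ℕ → Submodule k A) : ℤ → Submodule k A
  | Int.ofNat n => 𝒜 n
  | Int.negSucc _ => ⊥

section

variable [GradedAlgebra 𝒜]

/-- The projection of `A` onto `A_d`. -/
def intProj (𝒜 : ℕ → Submodule k A) [GradedAlgebra 𝒜] : ℤ → A →ₗ[k] A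
  | Int.ofNat n => GradedAlgebra.proj 𝒜 n
  | Int.negSucc _ => 0

theorem intProj_of_mem (d : ℤ) (x : A) (hx : x ∈ intDeg 𝒜 d) : intProj 𝒜 d x = x := by
  cases d with
  | ofNat n => exact DirectSum.decompose_of_mem_same 𝒜 hx
  | negSucc n =>
    have : x = 0 := hx
    simp [this]

theorem intProj_of_ne (d e : ℤ) (x : A) (h : d ≠ e) (hx : x ∈ intDeg 𝒜 e) :
    intProj 𝒜 d x = 0 := by
  cases e with
  | negSucc n =>
    have : x = 0 := hx
    simp [this]
  | ofNat m =>
    cases d with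
    | negSucc n => rfl
    | ofNat n => exact DirectSum.decompose_of_mem_ne 𝒜 hx (fun hm => h (by rw [hm]))

theorem mem_iSup_intDeg (x : A) : x ∈ ⨆ d, intDeg 𝒜 d := by
  induction x using DirectSum.Decomposition.inductionOn 𝒜 with
  | zero => exact Submodule.zero_mem _
  | @homogeneous i m => exact Submodule.mem_iSup_of_mem (Int.ofNat i) m.2
  | add x y hx hy => exact Submodule.add_mem _ hx hy

theorem intDeg_mul (d : ℤ) (j : ℕ) (x a : A) (hx : x ∈ intDeg 𝒜 d) (ha : a ∈ 𝒜 j) :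
    x * a ∈ intDeg 𝒜 (d + j) := by
  cases d with
  | ofNat n => exact SetLike.mul_mem_graded (A := 𝒜) (i := n) (j := j) hx ha
  | negSucc n =>
    have : x = 0 := hx
    simp [this]

theorem mul_intDeg (d : ℤ) (v a : A) (hv : v ∈ 𝒜 1) (ha : a ∈ intDeg 𝒜 d) :
    v * a ∈ intDeg 𝒜 (d + 1) := by
  cases d with
  | ofNat n =>
    have := SetLike.mul_mem_graded (A := 𝒜) (i := 1) (j := n) hv ha
    rwa [add_comm] at this
  | negSucc n =>
    have : a = 0 := ha
    simp [this]

/-- The subspace `W ⊗ A_{d-s}` of `W ⊗ A`. -/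
def freeDeg (𝒜 : ℕ → Submodule k A) (W : Type u) [AddCommGroup W] [Module k W] (s d : ℤ) :
    Submodule k (A ⊗[k] W) :=
  LinearMap.range (TensorProduct.map (intDeg 𝒜 (d - s)).subtype (LinearMap.id : W →ₗ[k] W))

/-- The free graded right module `W ⊗ A`, written as `A ⊗ W`, with the space of generators `W` in
degree `s`. -/
def free (𝒜 : ℕ → Submodule k A) [GradedAlgebra 𝒜] (W : Type u) [AddCommGroup W] [Module k W]
    (s : ℤ) : GrMod 𝒜 where
  carrier := A ⊗[k] W
  deg d := freeDeg 𝒜 W s d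
  isInternal := by
    refine isInternal_of_proj _
      (fun d => TensorProduct.map (intProj 𝒜 (d - s)) (LinearMap.id : W →ₗ[k] W)) ?_ ?_ ?_
    · rintro d _ ⟨t, rfl⟩
      rw [← LinearMap.comp_apply, ← TensorProduct.map_comp]
      congr 2
      ext x
      exact intProj_of_mem _ _ x.2
    · rintro d e _ h ⟨t, rfl⟩
      rw [← LinearMap.comp_apply, ← TensorProduct.map_comp]
      have : intProj 𝒜 (d - s) ∘ₗ (intDeg 𝒜 (e - s)).subtype = 0 := by
        ext x
        exact intProj_of_ne _ _ _ (by omega) x.2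
      rw [this, TensorProduct.map_zero_left, LinearMap.zero_apply]
    · intro t
      induction t using TensorProduct.induction_on with
      | zero => exact Submodule.zero_mem _
      | add x y hx hy => exact Submodule.add_mem _ hx hy
      | tmul a w =>
        induction mem_iSup_intDeg (𝒜 := 𝒜) a using Submodule.iSup_induction' with
        | mem e x hx =>
          refine Submodule.mem_iSup_of_mem (e + s) ⟨⟨x, ?_⟩ ⊗ₜ w, rfl⟩
          rwa [add_sub_cancel_right]
        | zero => rw [TensorProduct.zero_tmul]; exact Submodule.zero_mem _
        | add x y _ _ hx hy => rw [TensorProduct.add_tmul]; exact Submodule.add_mem _ hx hy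
  smul_mem := by
    rintro d n _ a ⟨t, rfl⟩ ha
    induction t using TensorProduct.induction_on with
    | zero => simp
    | add x y hx hy =>
      rw [map_add, smul_add]
      exact Submodule.add_mem _ hx hy
    | tmul b w =>
      refine ⟨⟨(b : A) * a, ?_⟩ ⊗ₜ w, ?_⟩
      · rw [add_sub_right_comm]
        exact intDeg_mul _ _ _ _ b.2 ha
      · simp [TensorProduct.smul_tmul']

/-- The term `K_n(M) = (M^!_{-n})^* ⊗ A` of the Koszul complex of `M`; the dual of `M^!_{-n}` sits
in internal degree `n`. -/
def koszul (M : GrMod 𝒜) (n : ℕ) : GrMod 𝒜 :=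
  free 𝒜 (Module.Dual k (dualModDeg M n)) n

variable [FiniteDimensional k (𝒜 1)]

/-- Left multiplication by `ι = ∑ fᵢ ⊗ vᵢ`, where `(vᵢ)` is a basis of `V` with dual basis `(fᵢ)`
(the result does not depend on the basis): `a ⊗ φ ↦ ∑ vᵢ a ⊗ fᵢ · φ`. -/
def koszulMap (M : GrMod 𝒜) (n : ℕ) :
    A ⊗[k] Module.Dual k (dualModDeg M (n + 1)) →ₗ[Aᵐᵒᵖ] A ⊗[k] Module.Dual k (dualModDeg M n) :=
  ∑ i, TensorProduct.AlgebraTensorModule.map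
    (leftMul (Module.finBasis k (𝒜 1) i : A)) (leftAct M n ((Module.finBasis k (𝒜 1)).coord i))

theorem koszulMap_mem (M : GrMod 𝒜) (n : ℕ) (d : ℤ)
    (x : A ⊗[k] Module.Dual k (dualModDeg M (n + 1)))
    (hx : x ∈ freeDeg 𝒜 (Module.Dual k (dualModDeg M (n + 1))) (n + 1 : ℕ) d) :
    koszulMap M n x ∈ freeDeg 𝒜 (Module.Dual k (dualModDeg M n)) n d := by
  obtain ⟨t, rfl⟩ := hx
  rw [koszulMap, LinearMap.sum_apply]
  refine Submodule.sum_mem _ fun i _ => ?_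
  induction t using TensorProduct.induction_on with
  | zero => simp
  | add x y hx hy =>
    rw [map_add, map_add]
    exact Submodule.add_mem _ hx hy
  | tmul b w =>
    refine ⟨⟨(Module.finBasis k (𝒜 1) i : A) * b, ?_⟩ ⊗ₜ
      leftAct M n ((Module.finBasis k (𝒜 1)).coord i) w, rfl⟩
    have := mul_intDeg _ _ _ (Module.finBasis k (𝒜 1) i).2 b.2
    have e : d - ((n + 1 : ℕ) : ℤ) + 1 = d - (n : ℤ) := by push_cast; ring
    rwa [e] at this

/-- The differential `K_{n+1}(M) → K_n(M)`: left multiplication by `ι`. -/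
def koszulSucc (M : GrMod 𝒜) (n : ℕ) : GrHom (koszul M (n + 1)) (koszul M n) where
  toLin := koszulMap M n
  map_deg := koszulMap_mem M n

/-- The differential of the Koszul complex as a map `K_m(M) → K_n(M)`; zero unless `m = n + 1`. -/
def koszulD (M : GrMod 𝒜) (m n : ℕ) : GrHom (koszul M m) (koszul M n) :=
  if h : m = n + 1 then by subst h; exact koszulSucc M n else GrHom.zero _ _

/-- The homology `H_n(K(M))` of the Koszul complex of `M`. -/
def koszulHomology (M : GrMod 𝒜) (n : ℕ) : GrMod 𝒜 :=
  GrMod.homology (koszulD M (n + 1) n) (koszulD M n (n - 1))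

end

end Quadratic

section Datum

variable {k : Type u} [Field k] {A : Type u} [Ring A] [Algebra k A]

/-- `⨁_{j, ℓ} (M j (-ℓ))^{c j ℓ}`. -/
def shiftedSum {𝒜 : ℕ → Submodule k A} {N : ℕ} (M : Fin (N + 1) → GrMod 𝒜)
    (c : Fin (N + 1) → ℕ+ → ℕ) : GrMod 𝒜 :=
  GrMod.directSum fun x : (Σ (j : Fin (N + 1)) (ℓ : ℕ+), Fin (c j ℓ)) =>
    (M x.1).shift (-((x.2.1 : ℕ) : ℤ))

end Datum

/-- A resolving datum `{M 0, …, M N}`, `h` on the algebra `A = ⨁ 𝒜 n`. -/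
structure ResolvingDatum {k : Type u} [Field k] {A : Type u} [Ring A] [Algebra k A]
    (𝒜 : ℕ → Submodule k A) [GradedAlgebra 𝒜] [FiniteDimensional k (𝒜 1)] where
  N : ℕ
  M : Fin (N + 1) → GrMod 𝒜
  quadratic : ∀ i, IsQuadraticModule (M i)
  not_iso : ∀ i j, i ≠ j → ¬ (M i).IsIso (M j)
  trivial : IsTrivialModule (M 0)
  /-- The map `(i, j, k, ℓ) ↦ h(i, j, k, ℓ)`, with `k` and `ℓ` positive. -/
  h : Fin (N + 1) → Fin (N + 1) → ℕ+ → ℕ+ → ℕ × ℕ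
  finite_support :
    {x : Fin (N + 1) × Fin (N + 1) × ℕ+ × ℕ+ | h x.1 x.2.1 x.2.2.1 x.2.2.2 ≠ (0, 0)}.Finite
  /-- The short exact sequences
  `0 → ⨁ (M j (-ℓ))^{π₁ h(i,j,k,ℓ)} → H_k(K(M i)) → ⨁ (M j (-ℓ))^{π₂ h(i,j,k,ℓ)} → 0`. -/
  f : ∀ (i : Fin (N + 1)) (m : ℕ+),
    GrHom (shiftedSum M fun j ℓ => (h i j m ℓ).1) (koszulHomology (M i) m)
  g : ∀ (i : Fin (N + 1)) (m : ℕ+),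
    GrHom (koszulHomology (M i) m) (shiftedSum M fun j ℓ => (h i j m ℓ).2)
  injective : ∀ i m, Function.Injective (f i m)
  exact : ∀ i m, Function.Exact (f i m) (g i m)
  surjective : ∀ i m, Function.Surjective (g i m)
  /-- If the sequence splits (as a sequence of graded modules), then `π₁ h(i,j,k,ℓ) = 0`. -/
  split : ∀ i m,
    (∃ s : GrHom (shiftedSum M fun j ℓ => (h i j m ℓ).2) (koszulHomology (M i) m),
      ∀ x, g i m (s x) = x) →
    ∀ j ℓ, (h i j m ℓ).1 = 0

namespace ResolvingDatum

variable {k : Type u} [Field k] {A : Type u} [Ring A] [Algebra k A]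
  {𝒜 : ℕ → Submodule k A} [GradedAlgebra 𝒜] [FiniteDimensional k (𝒜 1)]

/-- The arrows of the resolving quiver with source `M i`. The vertices are the indices `i` of the
modules `M i`. For each `j`, `m`, `ℓ` there are `π₁ h(i,j,m,ℓ) + π₂ h(i,j,m,ℓ)` arrows from `M i`
to `M j` of bidegree `(m + 1, ℓ)`: the first `π₁` ones form the set `Ar'`, the others `Ar''`. -/
structure Arrow (D : ResolvingDatum 𝒜) (i : Fin (D.N + 1)) : Type where
  tgt : Fin (D.N + 1)
  m : ℕ+
  ℓ : ℕ+
  idx : Fin (D.h i tgt m ℓ).1 ⊕ Fin (D.h i tgt m ℓ).2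

variable {D : ResolvingDatum 𝒜}

namespace Arrow

variable {i : Fin (D.N + 1)}

def bideg₁ (a : D.Arrow i) : ℕ := a.m + 1

def bideg₂ (a : D.Arrow i) : ℕ := a.ℓ

/-- The difference degree. -/
def ddeg (a : D.Arrow i) : ℤ := (a.bideg₂ : ℤ) - a.bideg₁

/-- The strict partial order on the arrows with source `M i` and a given first bidegree: the arrows
of `Ar''` are smaller than those of `Ar'`. -/
def Lt (a b : D.Arrow i) : Prop :=
  a.bideg₁ = b.bideg₁ ∧ a.idx.isRight = true ∧ b.idx.isLeft = true

end Arrow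

/-- The resolving datum is connected if the graph underlying the resolving quiver is connected. -/
def IsConnected (D : ResolvingDatum 𝒜) : Prop :=
  ∀ i j : Fin (D.N + 1),
    Relation.EqvGen (fun i j => ∃ a : D.Arrow i, a.tgt = j) i j

/-- The paths of the resolving quiver with source `M i`: the vertex `M i`, or an arrow with source
`M i` followed by a path starting at its target. -/
inductive Path (D : ResolvingDatum 𝒜) : Fin (D.N + 1) → Type where
  | vertex (i : Fin (D.N + 1)) : Path D i
  | cons {i : Fin (D.N + 1)} (a : D.Arrow i) (p : Path D a.tgt) : Path D i

namespace Path

/-- The target of a path. -/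
def tgt : {i : Fin (D.N + 1)} → D.Path i → Fin (D.N + 1)
  | i, vertex _ => i
  | _, cons _ p => p.tgt

def bideg₁ : {i : Fin (D.N + 1)} → D.Path i → ℕ
  | _, vertex _ => 0
  | _, cons a p => a.bideg₁ + p.bideg₁

def bideg₂ : {i : Fin (D.N + 1)} → D.Path i → ℕ
  | _, vertex _ => 0
  | _, cons a p => a.bideg₂ + p.bideg₂

/-- The difference degree. -/
def ddeg {i : Fin (D.N + 1)} (p : D.Path i) : ℤ := (p.bideg₂ : ℤ) - p.bideg₁

/-- The strict partial order on the paths with source `M i`. Two paths are compared after removing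
their common initial arrows. A vertex is larger than every path of positive length; two paths with
different first arrows `a`, `b` are compared through `bideg₁ a < bideg₁ b`, or `bideg₁ a = bideg₁ b`
and `a < b`. -/
inductive Lt : {i : Fin (D.N + 1)} → D.Path i → D.Path i → Prop where
  | vertex {i : Fin (D.N + 1)} (a : D.Arrow i) (p : D.Path a.tgt) : Lt (cons a p) (vertex i)
  | bideg {i : Fin (D.N + 1)} (a b : D.Arrow i) (p : D.Path a.tgt) (q : D.Path b.tgt) :
      a.bideg₁ < b.bideg₁ → Lt (cons a p) (cons b q)
  | arrow {i : Fin (D.N + 1)} (a b : D.Arrow i) (p : D.Path a.tgt) (q : D.Path b.tgt) :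
      a.Lt b → Lt (cons a p) (cons b q)
  | cons {i : Fin (D.N + 1)} (a : D.Arrow i) (p q : D.Path a.tgt) :
      Lt p q → Lt (cons a p) (cons a q)

end Path

/-- The summand `K_{n - bideg₁ α}(M (t α))(- bideg₂ α)` for a path `α`. -/
def summand (D : ResolvingDatum 𝒜) (i : Fin (D.N + 1)) (n : ℕ)
    (α : {α : D.Path i // α.bideg₁ ≤ n}) : GrMod 𝒜 :=
  (koszul (D.M α.1.tgt) (n - α.1.bideg₁)).shift (-(α.1.bideg₂ : ℤ))

/-- The direct sum of these over all paths `α` with source `M i` and `bideg₁ α ≤ n`. -/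
def term (D : ResolvingDatum 𝒜) (i : Fin (D.N + 1)) (n : ℕ) : GrMod 𝒜 :=
  GrMod.directSum (D.summand i n)

/-- The component, from the summand of `α` to the summand of `β`, of a map from the `m`-th to the
`n`-th direct sum. -/
def component (i : Fin (D.N + 1)) {m n : ℕ} (d : GrHom (D.term i m) (D.term i n))
    (α : {α : D.Path i // α.bideg₁ ≤ m}) (β : {β : D.Path i // β.bideg₁ ≤ n}) :
    D.summand i m α →ₗ[Aᵐᵒᵖ] D.summand i n β :=
  GrMod.comp (D.summand i n) β ∘ₗ d.toLin ∘ₗ GrMod.incl (D.summand i m) α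

/-- The differential `d` exhibits the complex of the `D.term i n` as an iterated cone of shifted
Koszul complexes, one for each path: on the summands of a path it is the differential of the Koszul
complex, and its component from `α` to `β ≠ α` vanishes unless `α < β`. -/
structure IsIteratedCone (D : ResolvingDatum 𝒜) (i : Fin (D.N + 1))
    (d : ∀ n, GrHom (D.term i (n + 1)) (D.term i n)) : Prop where
  diag : ∀ (n : ℕ) (α : D.Path i) (hα : α.bideg₁ ≤ n),
    component i (d n) ⟨α, hα.trans n.le_succ⟩ ⟨α, hα⟩ =
      (koszulD (D.M α.tgt) (n + 1 - α.bideg₁) (n - α.bideg₁)).toLin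
  triangular : ∀ (n : ℕ) (α : {α : D.Path i // α.bideg₁ ≤ n + 1})
    (β : {β : D.Path i // β.bideg₁ ≤ n}),
    α.1 ≠ β.1 → ¬ Path.Lt α.1 β.1 → component i (d n) α β = 0

end ResolvingDatum

end Quad

end

/-!
The differentials of the resolutions of all modules `M i` are constructed simultaneously, by
recursion on the homological degree. Splitting off the first arrow of a path shows that `D.term i n`
is the sum of the term `K_n (M i)` of the Koszul complex and of one copy of `D.term a.tgt q` for
every arrow `a` with source `M i` and `a.bideg₁ + q = n` (`term_ext`, `exists_grHom`). So the
resolution of `M i` should arise from the Koszul complex of `M i`, which already resolves `M i` in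
degree zero (`exact_koszulMap_koszulAug`), by attaching for every arrow `a : M i → M t` of bidegree
`(m + 1, ℓ)` a shifted copy of the resolution of `M t`, which starts in degree `m + 1` and kills a
summand `M t (-ℓ)` of the submodule (for `Ar'`) or of the quotient (for `Ar''`) in the short exact
sequence for the homology `H_m` of the Koszul complex. The arrows are ordered by `Arrow.level`, and
`filt D i s` is the part of the resolution of `M i` formed by the Koszul complex and the arrows of
level at least `s`.

The differential is required (`IsGoodAt`) to be the Koszul differential on the Koszul complex; to
map the zeroth term of the copy for `a` to cycles of the Koszul complex, in the homology class
prescribed by the augmentation and by the maps of the resolving datum; and to agree on the higher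
terms of this copy with the differential of the resolution of `M t`, up to terms of level greater
than that of `a`.

* Exactness (`exact_filt`, `exact_of_isGoodAt`) is proved by descending induction on the level `s`.
  The components at the arrows of level `s` of a cycle in `filt D i s` are cycles of the resolutions
  of the targets; if they are in degree zero, then their augmentations vanish because the homology
  class of the image does. They are boundaries by induction on the degree, and subtracting a
  boundary moves the cycle to `filt D i (s + 1)`. At the end of the induction the cycle lies in the
  Koszul complex, and the arrows attached to its homology in this degree make it a boundary
  (`exists_of_cycle`).
* Existence (`exists_isGoodOn`) follows from exactness in smaller degrees: extending the
  differential over one more term of the copy for `a` requires a certain cycle of level greater than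
  that of `a` to be a boundary of such terms (`exists_correction`). The choices can be made linearly
  and homogeneously because the terms are sums of shifted free modules (`hasSelection_free`).

The triangular shape of the differential is a consequence of the conditions above, by induction on
the length of paths. A component between free modules generated in different degrees has its image
in the radical (`mem_radical_of_free`), which gives minimality under the condition on the difference
degrees.
-/

noncomputable section

namespace Quad

/-! ### Direct sums, lifting and the radical of graded modules -/

section GradedModules

variable {k : Type u} [Field k] {A : Type u} [Ring A] [Algebra k A] {𝒜 : ℕ → Submodule k A}

namespace GrMod

variable {ι κ : Type} {X : ι → GrMod 𝒜} {Y : κ → GrMod 𝒜}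

theorem directSum_ext {x y : directSum X} (h : ∀ i, comp X i x = comp X i y) : x = y :=
  DFinsupp.ext h

theorem comp_incl_self (i : ι) (x : X i) : comp X i (incl X i x) = x := by
  classical
  unfold comp incl
  rw [Subsingleton.elim (Classical.decEq ι)]
  exact DirectSum.component.lof_self Aᵐᵒᵖ (ι := ι) (M := fun i => X i) i x

theorem comp_incl_ne {i j : ι} (h : i ≠ j) (x : X i) : comp X j (incl X i x) = 0 := by
  classical
  unfold comp incl
  exact (DirectSum.component.of Aᵐᵒᵖ (ι := ι) (M := fun i => X i) j i x).trans (dif_neg h)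

/-- The morphism out of a direct sum given by its restrictions to the summands. -/
def desc {Z : Type u} [AddCommGroup Z] [Module Aᵐᵒᵖ Z] (f : ∀ i, X i →ₗ[Aᵐᵒᵖ] Z) :
    directSum X →ₗ[Aᵐᵒᵖ] Z :=
  letI := Classical.decEq ι
  DirectSum.toModule Aᵐᵒᵖ ι Z f

theorem desc_incl {Z : Type u} [AddCommGroup Z] [Module Aᵐᵒᵖ Z] (f : ∀ i, X i →ₗ[Aᵐᵒᵖ] Z)
    (i : ι) (x : X i) : desc f (incl X i x) = f i x := by
  classical
  unfold desc incl
  exact DirectSum.toModule_lof (φ := f) Aᵐᵒᵖ i x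

theorem directSum_induction {p : directSum X → Prop} (x : directSum X) (zero : p 0)
    (add : ∀ x y, p x → p y → p (x + y)) (incl : ∀ i, comp X i x ≠ 0 → p (incl X i (comp X i x))) :
    p x := by
  classical
  have hs : (∑ i ∈ DFinsupp.support (β := fun i => X i) x, GrMod.incl X i (comp X i x)) = x := by
    unfold GrMod.incl
    rw [Subsingleton.elim (Classical.decEq ι)]
    exact DirectSum.sum_support_of (β := fun i => X i) x
  rw [← hs]
  refine Finset.sum_induction _ p add zero fun i hi => ?_
  exact incl i (DFinsupp.mem_support_iff.1 hi)

theorem mem_deg_directSum {d : ℤ} {x : directSum X} :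
    x ∈ (directSum X).deg d ↔ ∀ i, comp X i x ∈ (X i).deg d := by
  have h : ∀ y : ⨁ i, X i,
      y ∈ (⨅ i, ((X i).deg d).comap (DirectSum.component k ι (fun i => X i) i)) ↔
        ∀ i, DirectSum.component k ι (fun i => X i) i y ∈ (X i).deg d := fun y => by
    rw [Submodule.mem_iInf]
    rfl
  exact h x

theorem incl_mem_deg {d : ℤ} {i : ι} {x : X i} (hx : x ∈ (X i).deg d) :
    incl X i x ∈ (directSum X).deg d := by
  rw [mem_deg_directSum]
  intro j
  by_cases h : i = j
  · subst h; rwa [comp_incl_self]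
  · rw [comp_incl_ne h]; exact Submodule.zero_mem _

theorem desc_mem_deg {Z : GrMod 𝒜} (f : ∀ i, GrHom (X i) Z) {d : ℤ} {x : directSum X}
    (hx : x ∈ (directSum X).deg d) : desc (fun i => (f i).toLin) x ∈ Z.deg d := by
  refine directSum_induction (p := fun x => desc (fun i => (f i).toLin) x ∈ Z.deg d) x ?_ ?_ ?_
  · rw [map_zero]; exact Submodule.zero_mem _
  · intro x y hx hy; rw [map_add]; exact Submodule.add_mem _ hx hy
  · intro i _
    rw [desc_incl]
    exact (f i).map_deg _ _ (mem_deg_directSum.1 hx i)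

/-- The morphism of graded modules out of a direct sum given by its restrictions. -/
def grDesc {Z : GrMod 𝒜} (f : ∀ i, GrHom (X i) Z) : GrHom (directSum X) Z :=
  ⟨desc fun i => (f i).toLin, fun _ _ hx => desc_mem_deg f hx⟩

theorem grDesc_incl {Z : GrMod 𝒜} (f : ∀ i, GrHom (X i) Z) (i : ι) (x : X i) :
    grDesc f (incl X i x) = f i x := desc_incl _ i x

/-- The projection of a direct sum to the summands with index in the image of an injective map
`e`, followed by morphisms of these summands. -/
def restrict (e : κ → ι) (he : Function.Injective e) (c : ∀ p, X (e p) →ₗ[Aᵐᵒᵖ] Y p) :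
    directSum X →ₗ[Aᵐᵒᵖ] directSum Y where
  toFun x := DFinsupp.mapRange (fun p => c p) (fun _ => map_zero _)
    (DFinsupp.comapDomain (β := fun i => X i) e he x)
  map_add' x y := by
    refine directSum_ext fun p => ?_
    change c p (comp X (e p) (x + y)) = c p (comp X (e p) x) + c p (comp X (e p) y)
    rw [map_add, map_add]
  map_smul' a x := by
    refine directSum_ext fun p => ?_
    change c p (comp X (e p) (a • x)) = a • c p (comp X (e p) x)
    rw [map_smul, map_smul]

theorem isBoundedBelow_directSum (b : ℤ) (h : ∀ i, ∀ d < b, (X i).deg d = ⊥) :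
    (directSum X).IsBoundedBelow := by
  refine ⟨b, fun d hd => eq_bot_iff.2 fun x hx => ?_⟩
  rw [mem_deg_directSum] at hx
  refine (Submodule.mem_bot k).2 (directSum_ext fun i => ?_)
  have := hx i
  rw [h i d hd] at this
  rw [map_zero]
  exact this

/-- A strong lifting property of a graded module `P`: every homogeneous submodule of `P × X` which
projects onto `P`, degree by degree, contains the graph of a morphism `P → X`. -/
def HasSelection (P : GrMod 𝒜) : Prop :=
  ∀ (X : GrMod 𝒜) (R : Submodule Aᵐᵒᵖ (P × X)),
    (∀ (e : ℤ) (p : P), p ∈ P.deg e → ∃ x ∈ X.deg e, (p, x) ∈ R) →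
      ∃ f : GrHom P X, ∀ p, (p, f p) ∈ R

theorem HasSelection.isProjective {P : GrMod 𝒜} (hP : P.HasSelection) (hb : P.IsBoundedBelow) :
    P.IsProjective := by
  refine ⟨hb, fun X Y _ _ g f hg => ?_⟩
  let R : Submodule Aᵐᵒᵖ (P × X) :=
    LinearMap.eqLocus (g.toLin ∘ₗ LinearMap.snd _ P X) (f.toLin ∘ₗ LinearMap.fst _ P X)
  obtain ⟨f', hf'⟩ := hP X R fun e p hp => by
    obtain ⟨x, hx⟩ := hg (f p)
    -- a preimage of a homogeneous element need not be homogeneous, but its component is a preimage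
    refine ⟨X.proj e x, X.proj_mem e x, ?_⟩
    change g (X.proj e x) = f p
    rw [proj_map, hx, Y.proj_of_mem _ _ (f.map_deg _ _ hp)]
  exact ⟨f', hf'⟩

/-- The lifting property for morphisms to a shift of `X`. -/
theorem HasSelection.exists_linearMap {P X : GrMod 𝒜} (hP : P.HasSelection) (j : ℤ)
    (R : Submodule Aᵐᵒᵖ (P × X))
    (hR : ∀ (e : ℤ) (p : P), p ∈ P.deg (j + e) → ∃ x ∈ X.deg e, (p, x) ∈ R) :
    ∃ f : P →ₗ[Aᵐᵒᵖ] X, (∀ (d : ℤ) (p : P), p ∈ P.deg (j + d) → f p ∈ X.deg d) ∧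
      ∀ p, (p, f p) ∈ R := by
  obtain ⟨f, hf⟩ := hP (X.shift (-j)) R fun e p hp => by
    obtain ⟨x, hx, hR⟩ := hR (-j + e) p (by rwa [add_neg_cancel_left])
    exact ⟨x, hx, hR⟩
  refine ⟨f.toLin, fun d x hx => ?_, hf⟩
  have : f.toLin x ∈ X.deg (-j + (j + d)) := f.map_deg _ _ hx
  rwa [neg_add_cancel_left] at this

theorem HasSelection.shift {P : GrMod 𝒜} (hP : P.HasSelection) (j : ℤ) :
    (P.shift j).HasSelection := by
  intro X R h
  obtain ⟨f, hf, hR⟩ := hP.exists_linearMap j R h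
  exact ⟨⟨f, hf⟩, hR⟩

theorem HasSelection.directSum (h : ∀ i, (X i).HasSelection) : (directSum X).HasSelection := by
  intro Z R hR
  have key : ∀ i, ∃ f : GrHom (X i) Z, ∀ p, (incl X i p, f p) ∈ R := fun i => by
    refine h i Z (R.comap ((incl X i).prodMap LinearMap.id)) fun e p hp => ?_
    exact hR e _ (incl_mem_deg hp)
  choose f hf using key
  refine ⟨grDesc f, fun p => ?_⟩
  refine directSum_induction (p := fun p => (p, grDesc f p) ∈ R) p ?_ ?_ ?_
  · rw [map_zero]; exact R.zero_mem
  · intro x y hx hy; rw [map_add]; exact R.add_mem hx hy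
  · intro i _; rw [grDesc_incl]; exact hf i _

theorem one_tmul_mem_free [GradedAlgebra 𝒜] {W : Type u} [AddCommGroup W] [Module k W] (s : ℤ)
    (w : W) : ((1 : A) ⊗ₜ[k] w) ∈ (free 𝒜 W s).deg s := by
  refine ⟨(⟨1, ?_⟩ : intDeg 𝒜 (s - s)) ⊗ₜ w, rfl⟩
  rw [sub_self]
  exact SetLike.one_mem_graded 𝒜

theorem smul_mem_intDeg (X : GrMod 𝒜) {s e : ℤ} {x : X} {a : A} (hx : x ∈ X.deg s)
    (ha : a ∈ intDeg 𝒜 e) : op a • x ∈ X.deg (s + e) := by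
  cases e with
  | ofNat n => exact X.smul_mem _ _ _ _ hx ha
  | negSucc n =>
    have : a = 0 := ha
    simp [this]

/-- Free modules have the selection property, since one may choose the values on a basis of the
space of generators. -/
theorem hasSelection_free [GradedAlgebra 𝒜] {W : Type u} [AddCommGroup W] [Module k W] (s : ℤ) :
    (free 𝒜 W s).HasSelection := by
  intro X R hR
  let b := Module.Basis.ofVectorSpace k W
  choose y hy hyR using fun w : W => hR s (1 ⊗ₜ w) (one_tmul_mem_free s w)
  let φ : W →ₗ[k] X.deg s := b.constr k fun i => ⟨y (b i), hy (b i)⟩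
  let ψ : A ⊗[k] W →ₗ[Aᵐᵒᵖ] X := TensorProduct.AlgebraTensorModule.lift
    { toFun := fun a =>
        { toFun := fun w => op a • (φ w : X)
          map_add' := by intro x y; simp
          map_smul' := by intro c x; simpa using smul_comm (op a) c (φ x : X) }
      map_add' := by intro a b; ext m; simp [add_smul]
      map_smul' := by intro c a; ext m; simp [mul_smul] }
  have hψ : ∀ a w, ψ (a ⊗ₜ w) = op a • (φ w : X) := fun a w => rfl
  have hφ : ∀ w, ((1 : A) ⊗ₜ[k] w, (φ w : X)) ∈ R := fun w => by
    let R' : Submodule k W := (R.restrictScalars k).comap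
      ((TensorProduct.mk k A W 1).prod ((X.deg s).subtype ∘ₗ φ))
    have : ⊤ ≤ R' := by
      rw [← b.span_eq, Submodule.span_le]
      rintro _ ⟨i, rfl⟩
      change ((1 : A) ⊗ₜ[k] b i, (φ (b i) : X)) ∈ R
      rw [Module.Basis.constr_basis]
      exact hyR _
    exact this (Submodule.mem_top (x := w))
  refine ⟨⟨ψ, fun d x hx => ?_⟩, fun p => ?_⟩
  · obtain ⟨t, rfl⟩ := hx
    change ψ _ ∈ _
    induction t using TensorProduct.induction_on with
    | zero => rw [map_zero, map_zero]; exact Submodule.zero_mem _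
    | add x y hx hy => rw [map_add, map_add]; exact Submodule.add_mem _ hx hy
    | tmul a w =>
      rw [TensorProduct.map_tmul, hψ]
      have := X.smul_mem_intDeg (φ w).2 a.2
      rwa [add_sub_cancel] at this
  · change (p, ψ p) ∈ R
    induction p using TensorProduct.induction_on with
    | zero => rw [map_zero]; exact R.zero_mem
    | add x y hx hy => rw [map_add]; exact R.add_mem hx hy
    | tmul a w =>
      have := R.smul_mem (op a) (hφ w)
      rw [hψ]
      convert this using 1
      refine Prod.ext ?_ rfl
      change a ⊗ₜ[k] w = op a • ((1 : A) ⊗ₜ[k] w)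
      simp [TensorProduct.smul_tmul']

theorem free_deg_eq_bot [GradedAlgebra 𝒜] {W : Type u} [AddCommGroup W] [Module k W] {s d : ℤ}
    (h : d < s) : (free 𝒜 W s).deg d = ⊥ := by
  refine eq_bot_iff.2 ?_
  rintro _ ⟨t, rfl⟩
  obtain ⟨n, hn⟩ := Int.exists_eq_neg_ofNat (a := d - s + 1) (by omega)
  have hz : ∀ a ∈ intDeg 𝒜 (d - s), a = 0 := fun a ha => by
    rw [show d - s = Int.negSucc n by rw [Int.negSucc_eq]; omega] at ha
    exact ha
  induction t using TensorProduct.induction_on with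
  | zero => rw [map_zero]; exact Submodule.zero_mem _
  | add x y hx hy => rw [map_add]; exact Submodule.add_mem _ hx hy
  | tmul a w => rw [TensorProduct.map_tmul, Submodule.subtype_apply, hz a a.2,
      TensorProduct.zero_tmul]; exact Submodule.zero_mem _

theorem smul_mem_radical (X : GrMod 𝒜) (x : X) {j : ℕ} {a : A} (hj : 0 < j) (ha : a ∈ 𝒜 j) :
    op a • x ∈ X.radical :=
  Submodule.subset_span ⟨x, j, a, hj, ha, rfl⟩

/-- The radical of a direct sum contains every element whose components lie in the radicals of the
summands. -/
theorem mem_radical_directSum {x : directSum X} (h : ∀ i, comp X i x ∈ (X i).radical) :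
    x ∈ (directSum X).radical := by
  refine directSum_induction (p := fun x => x ∈ (directSum X).radical) x
    (directSum X).radical.zero_mem (fun x y => (directSum X).radical.add_mem) fun i _ => ?_
  have : (X i).radical ≤ (directSum X).radical.comap (incl X i) := by
    refine Submodule.span_le.2 ?_
    rintro _ ⟨x, j, a, hj, ha, rfl⟩
    change incl X i (op a • x) ∈ (directSum X).radical
    rw [map_smul]
    exact smul_mem_radical _ _ hj ha
  exact this (h i)

/-- The components of a free module outside the degree of its generators lie in the radical. -/
theorem free_deg_le_radical [GradedAlgebra 𝒜] {W : Type u} [AddCommGroup W] [Module k W]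
    {s d : ℤ} (h : d ≠ s) {x : free 𝒜 W s} (hx : x ∈ (free 𝒜 W s).deg d) :
    x ∈ (free 𝒜 W s).radical := by
  obtain ⟨t, rfl⟩ := hx
  induction t using TensorProduct.induction_on with
  | zero => rw [map_zero]; exact Submodule.zero_mem _
  | add x y hx hy => rw [map_add]; exact Submodule.add_mem _ hx hy
  | tmul a w =>
    obtain ⟨a, ha⟩ := a
    have : op a • ((1 : A) ⊗ₜ[k] w) = a ⊗ₜ[k] w := by simp [TensorProduct.smul_tmul']
    change a ⊗ₜ[k] w ∈ _
    rw [← this]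
    obtain ⟨e, he⟩ : ∃ e, e = d - s := ⟨_, rfl⟩
    rw [← he] at ha
    cases e with
    | ofNat n =>
      refine smul_mem_radical (free 𝒜 W s) _ (j := n) ?_ ha
      have : (n : ℤ) = d - s := he
      omega
    | negSucc n =>
      have : a = 0 := ha
      rw [this, op_zero, zero_smul]
      exact Submodule.zero_mem _

/-- A morphism of free graded modules whose generators live in different degrees has its image in
the radical. -/
theorem mem_radical_of_free [GradedAlgebra 𝒜] {W W' : Type u} [AddCommGroup W] [Module k W]
    [AddCommGroup W'] [Module k W'] {s s' r r' : ℤ}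
    (φ : (free 𝒜 W s).shift r →ₗ[Aᵐᵒᵖ] (free 𝒜 W' s').shift r')
    (hφ : ∀ d x, x ∈ ((free 𝒜 W s).shift r).deg d → φ x ∈ ((free 𝒜 W' s').shift r').deg d)
    (h : s - r ≠ s' - r') (x : (free 𝒜 W s).shift r) :
    φ x ∈ ((free 𝒜 W' s').shift r').radical := by
  let φ' : A ⊗[k] W →ₗ[Aᵐᵒᵖ] free 𝒜 W' s' := φ
  let J : Submodule Aᵐᵒᵖ (free 𝒜 W' s') := (free 𝒜 W' s').radical
  have h1 : ∀ w, φ' (1 ⊗ₜ w) ∈ J := fun w => by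
    refine free_deg_le_radical (d := r' + (s - r)) (by omega) (hφ (s - r) (1 ⊗ₜ w) ?_)
    change (1 ⊗ₜ w : A ⊗[k] W) ∈ (free 𝒜 W s).deg (r + (s - r))
    rw [add_sub_cancel]
    exact one_tmul_mem_free s w
  have key : ∀ x : A ⊗[k] W, φ' x ∈ J := fun x => by
    induction x using TensorProduct.induction_on with
    | zero => rw [map_zero]; exact Submodule.zero_mem _
    | add x y hx hy => rw [map_add]; exact Submodule.add_mem _ hx hy
    | tmul a w =>
      have : op a • ((1 : A) ⊗ₜ[k] w) = a ⊗ₜ[k] w := by simp [TensorProduct.smul_tmul']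
      rw [← this, map_smul]
      exact J.smul_mem _ (h1 w)
  exact key x

end GrMod

end GradedModules

/-! ### The Koszul complex of a quadratic module and its zeroth homology -/

/-- If `μ` vanishes on `R ⊆ U` and `Ψ` vanishes on `R^⊥ ⊆ U^*`, then the image under `μ ⊗ Ψ` of the
canonical element of `U ⊗ U^*` vanishes. -/
theorem sum_tmul_coord_eq_zero {k : Type u} [Field k] {U X Y : Type u} {ι : Type*} [Fintype ι]
    [AddCommMonoid U] [Module k U] [AddCommMonoid X] [Module k X] [AddCommMonoid Y] [Module k Y]
    (b : Module.Basis ι k U) (R : Submodule k U) (μ : U →ₗ[k] X) (Ψ : Module.Dual k U →ₗ[k] Y)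
    (hμ : ∀ x ∈ R, μ x = 0) (hΨ : ∀ l ∈ R.dualAnnihilator, Ψ l = 0) :
    ∑ i, μ (b i) ⊗ₜ[k] Ψ (b.coord i) = 0 := by
  classical
  let _ : AddCommGroup U := Module.addCommMonoidToAddCommGroup k
  obtain ⟨π, hπ⟩ := R.subtype.exists_leftInverse_of_injective R.ker_subtype
  -- `S` is a projector along `R`: `μ ∘ S = μ`, while `l ∘ S` vanishes on `R` for every functional
  -- `l`
  let S : U →ₗ[k] U := LinearMap.id - R.subtype ∘ₗ π
  have hS : ∀ x ∈ R, S x = 0 := fun x hx => by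
    have : π x = ⟨x, hx⟩ := LinearMap.congr_fun hπ ⟨x, hx⟩
    simp [S, this]
  have hμS : ∀ x, μ x = μ (S x) := fun x => by
    have hx : S x + π x = x := by simp [S]
    conv_lhs => rw [← hx, map_add, hμ _ (π x).2, add_zero]
  have h1 : ∀ i, μ (b i) = ∑ j, b.coord j (S (b i)) • μ (b j) := fun i => by
    rw [hμS]
    conv_lhs => rw [← b.sum_repr (S (b i)), map_sum]
    simp only [map_smul, Module.Basis.coord_apply]
  have h2 : ∀ j, b.coord j ∘ₗ S = ∑ i, b.coord j (S (b i)) • b.coord i := fun j => by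
    refine b.ext fun i => ?_
    simp [Finsupp.single_apply]
  calc ∑ i, μ (b i) ⊗ₜ[k] Ψ (b.coord i)
      = ∑ i, ∑ j, μ (b j) ⊗ₜ[k] (b.coord j (S (b i)) • Ψ (b.coord i)) := by
        refine Finset.sum_congr rfl fun i _ => ?_
        rw [h1, TensorProduct.sum_tmul]
        simp only [TensorProduct.smul_tmul]
    _ = ∑ j, μ (b j) ⊗ₜ[k] Ψ (b.coord j ∘ₗ S) := by
        rw [Finset.sum_comm]
        refine Finset.sum_congr rfl fun j _ => ?_
        rw [h2, map_sum, TensorProduct.tmul_sum]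
        simp only [map_smul]
    _ = 0 := by
        refine Finset.sum_eq_zero fun j _ => ?_
        rw [hΨ _ ?_, TensorProduct.tmul_zero]
        rw [Submodule.mem_dualAnnihilator]
        intro x hx
        simp [hS x hx]

/-- A functional which vanishes on the kernel of `e` factors through `e`. -/
theorem exists_dual_comp_eq {k : Type u} [Field k] {U W : Type u} [AddCommMonoid U]
    [Module k U] [AddCommMonoid W] [Module k W] (e : U →ₗ[k] W) (l : Module.Dual k U)
    (h : ∀ x, e x = 0 → l x = 0) : ∃ φ : Module.Dual k W, ∀ x, φ (e x) = l x := by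
  let _ : AddCommGroup U := Module.addCommMonoidToAddCommGroup k
  let _ : AddCommGroup W := Module.addCommMonoidToAddCommGroup k
  have : l ∈ LinearMap.range e.dualMap := by
    rw [LinearMap.range_dualMap_eq_dualAnnihilator_ker, Submodule.mem_dualAnnihilator]
    exact fun ξ hξ => h ξ hξ
  obtain ⟨φ, hφ⟩ := this
  exact ⟨φ, fun x => LinearMap.congr_fun hφ x⟩

section Quadratic

variable {k : Type u} [Field k] {A : Type u} [Ring A] [Algebra k A] {𝒜 : ℕ → Submodule k A}

theorem dualMk_tensorSquare_eq_zero {ξ : Module.Dual k (𝒜 1) ⊗[k] Module.Dual k (𝒜 1)}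
    (h : ξ ∈ orthogonal (relations 𝒜)) : dualMk 𝒜 (tensorSquare k _ ξ) = 0 := by
  have : tensorSquare k _ ξ ∈ TwoSidedIdeal.span
    (tensorSquare k (Module.Dual k (𝒜 1)) '' (orthogonal (relations 𝒜) : Set _)) :=
    TwoSidedIdeal.subset_span ⟨ξ, h, rfl⟩
  exact (RingCon.eq _).2 this

theorem dualMk_tensorSquare_tmul (f g : Module.Dual k (𝒜 1)) :
    dualMk 𝒜 (tensorSquare k _ (f ⊗ₜ g)) = dualι 𝒜 f * dualι 𝒜 g :=
  map_mul (dualMk 𝒜) _ _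

/-- The quotient `A^! / (A^!_{-2}) = k ⊕ V^*`. -/
def dualTrunc (𝒜 : ℕ → Submodule k A) :
    DualAlg 𝒜 →ₐ[k] TrivSqZeroExt k (Module.Dual k (𝒜 1)) :=
  RingCon.liftₐ _ TensorAlgebra.toTrivSqZeroExt (by
    change _ ≤ (TwoSidedIdeal.ker (TensorAlgebra.toTrivSqZeroExt.toRingHom)).ringCon
    rw [← TwoSidedIdeal.ringCon_le_iff, TwoSidedIdeal.span_le]
    rintro _ ⟨ξ, -, rfl⟩
    rw [SetLike.mem_coe, TwoSidedIdeal.mem_ker]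
    induction ξ using TensorProduct.induction_on with
    | zero => rw [map_zero, map_zero]
    | add x y hx hy => rw [map_add, map_add, hx, hy, add_zero]
    | tmul f g =>
      change TensorAlgebra.toTrivSqZeroExt (TensorAlgebra.ι k f * TensorAlgebra.ι k g) = 0
      rw [map_mul, TensorAlgebra.toTrivSqZeroExt_ι, TensorAlgebra.toTrivSqZeroExt_ι,
        TrivSqZeroExt.inr_mul_inr])

theorem dualTrunc_dualι (f : Module.Dual k (𝒜 1)) :
    dualTrunc 𝒜 (dualι 𝒜 f) = TrivSqZeroExt.inr f :=
  TensorAlgebra.toTrivSqZeroExt_ι f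

theorem dualGenInclusion_tmul (M : GrMod 𝒜) (g : Module.Dual k (gens M))
    (f : Module.Dual k (𝒜 1)) : dualGenInclusion M (g ⊗ₜ f) = dualι 𝒜 f ⊗ₜ g := rfl

theorem genInclusion_tmul (M : GrMod 𝒜) (m : gens M) (v : 𝒜 1) :
    genInclusion M (m ⊗ₜ v) = (v : A) ⊗ₜ m := rfl

theorem koszulMap_tmul [FiniteDimensional k (𝒜 1)] (M : GrMod 𝒜) (n : ℕ) (a : A)
    (φ : Module.Dual k (dualModDeg M (n + 1))) :
    koszulMap M n (a ⊗ₜ φ) = ∑ i, ((Module.finBasis k (𝒜 1) i : A) * a) ⊗ₜ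
      leftAct M n ((Module.finBasis k (𝒜 1)).coord i) φ := by
  rw [koszulMap, LinearMap.sum_apply]
  rfl

theorem leftAct_apply (M : GrMod 𝒜) (n : ℕ) (f : Module.Dual k (𝒜 1))
    (φ : Module.Dual k (dualModDeg M (n + 1))) (c : dualModDeg M n) :
    leftAct M n f φ c = φ (rightMul M n f c) := rfl

/-- The bilinear action `(f, f') ↦ f · (f' · φ)` on the graded dual of `M^!`. -/
def leftAct₂ (M : GrMod 𝒜) (n : ℕ) (φ : Module.Dual k (dualModDeg M (n + 2))) :
    Module.Dual k (𝒜 1) ⊗[k] Module.Dual k (𝒜 1) →ₗ[k] Module.Dual k (dualModDeg M n) :=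
  TensorProduct.lift (LinearMap.mk₂ k (fun f f' => leftAct M n f (leftAct M (n + 1) f' φ))
    (fun f f' g => by
      ext c
      simp only [leftAct_apply, LinearMap.add_apply, ← map_add]
      congr 1
      refine Subtype.ext ?_
      simp [rightMul, add_smul])
    (fun r f g => by
      ext c
      simp only [leftAct_apply, LinearMap.smul_apply, ← map_smul]
      congr 1
      refine Subtype.ext ?_
      simp [rightMul])
    (fun f g g' => by
      ext c
      simp only [leftAct_apply, LinearMap.add_apply, ← map_add]
      congr 1
      refine Subtype.ext ?_
      simp [rightMul, add_smul])
    (fun r f g => by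
      ext c
      simp only [leftAct_apply, LinearMap.smul_apply, ← map_smul]
      congr 1
      refine Subtype.ext ?_
      simpa [rightMul] using (smul_comm _ _ _).symm))

/-- The relations of `A^!` act by zero on the graded dual of `M^!`. -/
theorem leftAct₂_eq_zero (M : GrMod 𝒜) (n : ℕ) (φ : Module.Dual k (dualModDeg M (n + 2)))
    {ξ : Module.Dual k (𝒜 1) ⊗[k] Module.Dual k (𝒜 1)} (h : ξ ∈ orthogonal (relations 𝒜)) :
    leftAct₂ M n φ ξ = 0 := by
  obtain ⟨φ', hφ'⟩ := LinearMap.exists_extend φ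
  have key : ∀ ξ (c : dualModDeg M n),
      leftAct₂ M n φ ξ c = φ' (op (dualMk 𝒜 (tensorSquare k _ ξ)) • (c : DualMod M)) := by
    intro ξ c
    induction ξ using TensorProduct.induction_on with
    | zero => simp
    | add x y hx hy => rw [map_add, map_add, map_add, LinearMap.add_apply, hx, hy, op_add,
        add_smul, map_add]
    | tmul f g =>
      rw [dualMk_tensorSquare_tmul, op_mul, mul_smul]
      change φ _ = _
      rw [← hφ']
      rfl
  ext c
  rw [key, dualMk_tensorSquare_eq_zero h, op_zero, zero_smul, map_zero, LinearMap.zero_apply]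

/-- The Koszul complex is a complex: the square of its differential is the canonical element of
`V^{⊗ 2} ⊗ (V^*)^{⊗ 2}`, acting through multiplication in `A`, which vanishes on the relations of
`A`, and through `A^!`, where their annihilator vanishes. -/
theorem koszulMap_comp [FiniteDimensional k (𝒜 1)] (M : GrMod 𝒜) (n : ℕ) (x) :
    koszulMap M n (koszulMap M (n + 1) x) = 0 := by
  induction x using TensorProduct.induction_on with
  | zero => rw [map_zero, map_zero]
  | add x y hx hy => rw [map_add, map_add, hx, hy, add_zero]
  | tmul a φ =>
    let B := Module.finBasis k (𝒜 1)
    let Ψ : Module.Dual k (𝒜 1 ⊗[k] 𝒜 1) →ₗ[k] Module.Dual k (dualModDeg M n) :=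
      leftAct₂ M n φ ∘ₗ (TensorProduct.dualDistribEquiv k (𝒜 1) (𝒜 1)).symm.toLinearMap
    let μ : 𝒜 1 ⊗[k] 𝒜 1 →ₗ[k] A := LinearMap.mulRight k a ∘ₗ
      LinearMap.mul' k A ∘ₗ TensorProduct.map (𝒜 1).subtype (𝒜 1).subtype
    have hμ : ∀ x ∈ relations 𝒜, μ x = 0 := fun x hx => by
      have hx : (LinearMap.mul' k A ∘ₗ TensorProduct.map (𝒜 1).subtype (𝒜 1).subtype) x = 0 := hx
      change ((LinearMap.mul' k A ∘ₗ TensorProduct.map (𝒜 1).subtype (𝒜 1).subtype) x) * a = 0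
      rw [hx, zero_mul]
    have hΨ : ∀ l ∈ (relations 𝒜).dualAnnihilator, Ψ l = 0 := fun l hl =>
      leftAct₂_eq_zero M n φ (by
        have h : TensorProduct.dualDistrib k _ _
          ((TensorProduct.dualDistribEquiv k (𝒜 1) (𝒜 1)).symm l) = l :=
          (TensorProduct.dualDistribEquiv k (𝒜 1) (𝒜 1)).apply_symm_apply l
        rw [orthogonal, Submodule.mem_comap, LinearEquiv.coe_coe, h]
        exact hl)
    have := sum_tmul_coord_eq_zero (B.tensorProduct B) (relations 𝒜) μ Ψ hμ hΨ
    rw [koszulMap_tmul, map_sum]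
    simp only [koszulMap_tmul]
    rw [← this, Finset.sum_comm, Fintype.sum_prod_type]
    refine Finset.sum_congr rfl fun j _ => Finset.sum_congr rfl fun i _ => ?_
    -- the second application of the differential multiplies by `B j` on the left of `B i`, and acts
    -- by `B.coord j` after `B.coord i`
    have hc : (B.tensorProduct B).coord (j, i) = TensorProduct.dualDistribEquiv k (𝒜 1) (𝒜 1)
        (B.coord j ⊗ₜ B.coord i) := by
      refine (B.tensorProduct B).ext fun x => ?_
      change _ = TensorProduct.dualDistrib k _ _ _ _
      simp only [Module.Basis.tensorProduct_apply', Module.Basis.coord_apply,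
        Module.Basis.tensorProduct_repr_tmul_apply, TensorProduct.dualDistrib_apply, smul_eq_mul]
      exact mul_comm _ _
    congr 1
    · rw [Module.Basis.tensorProduct_apply]
      exact (mul_assoc _ _ _).symm
    · change _ = leftAct₂ M n φ ((TensorProduct.dualDistribEquiv k (𝒜 1) (𝒜 1)).symm _)
      rw [hc, LinearEquiv.symm_apply_apply]
      rfl

theorem one_mem_dualDeg (𝒜 : ℕ → Submodule k A) : (1 : DualAlg 𝒜) ∈ dualDeg 𝒜 0 := by
  rw [dualDeg, pow_zero]
  exact Submodule.one_le.1 le_rfl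

theorem dualModMk_tmul_mem (M : GrMod 𝒜) {n : ℕ} {a : DualAlg 𝒜} (ha : a ∈ dualDeg 𝒜 n)
    (g : Module.Dual k (gens M)) : dualModMk M (a ⊗ₜ g) ∈ dualModDeg M n :=
  ⟨a ⊗ₜ g, ⟨(⟨a, ha⟩ : dualDeg 𝒜 n) ⊗ₜ g, rfl⟩, rfl⟩

/-- The canonical map `V_M^* → M^!_0`. -/
def genDual (M : GrMod 𝒜) : Module.Dual k (gens M) →ₗ[k] dualModDeg M 0 where
  toFun g := ⟨dualModMk M (1 ⊗ₜ g), dualModMk_tmul_mem M (one_mem_dualDeg 𝒜) g⟩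
  map_add' x y := Subtype.ext (by
    change dualModMk M _ = dualModMk M _ + dualModMk M _
    rw [TensorProduct.tmul_add, map_add])
  map_smul' r x := Subtype.ext (by
    change dualModMk M _ = r • dualModMk M _
    rw [TensorProduct.tmul_smul]
    exact ((dualModMk M).restrictScalars k).map_smul r _)

theorem genDual_surjective (M : GrMod 𝒜) : Function.Surjective (genDual M) := by
  rintro ⟨_, _, ⟨t, rfl⟩, rfl⟩
  induction t using TensorProduct.induction_on with
  | zero => exact ⟨0, Subtype.ext (by simp)⟩
  | add x y hx hy =>
    obtain ⟨g, hg⟩ := hx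
    obtain ⟨g', hg'⟩ := hy
    refine ⟨g + g', Subtype.ext ?_⟩
    rw [map_add, hg, hg']
    simp
  | tmul a g =>
    obtain ⟨a, ha⟩ := a
    rw [dualDeg, pow_zero] at ha
    obtain ⟨r, rfl⟩ := Submodule.mem_one.1 ha
    refine ⟨r • g, Subtype.ext ?_⟩
    change dualModMk M _ = dualModMk M _
    congr 1
    change _ = algebraMap k (DualAlg 𝒜) r ⊗ₜ g
    rw [Algebra.algebraMap_eq_smul_one, TensorProduct.smul_tmul]

/-- A linear map which vanishes on the right multiples of the relations `R_M^⊥` vanishes on the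
kernel of the projection `V_M^* ⊗ A^! → M^!`. -/
theorem map_dualRelations_eq_zero (M : GrMod 𝒜) {Z : Type u} [AddCommGroup Z] [Module k Z]
    (l : DualAlg 𝒜 ⊗[k] Module.Dual k (gens M) →ₗ[k] Z)
    (hl : ∀ ξ ∈ orthogonal (modRelations M), ∀ b : DualAlg 𝒜, l (op b • dualGenInclusion M ξ) = 0)
    {x : DualAlg 𝒜 ⊗[k] Module.Dual k (gens M)} (hx : dualModMk M x = 0) : l x = 0 := by
  have hx : x ∈ dualRelations M := (Submodule.Quotient.mk_eq_zero _).1 hx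
  have key : ∀ b : (DualAlg 𝒜)ᵐᵒᵖ, l (b • x) = 0 := by
    refine Submodule.span_induction (p := fun x _ => ∀ b : (DualAlg 𝒜)ᵐᵒᵖ, l (b • x) = 0)
      ?_ ?_ ?_ ?_ hx
    · rintro _ ⟨ξ, hξ, rfl⟩ b
      exact hl ξ hξ b.unop
    · intro b; rw [smul_zero, map_zero]
    · intro x y _ _ hx hy b
      rw [smul_add, map_add, hx, hy, add_zero]
    · intro c x _ hx b
      rw [← mul_smul, hx]
  simpa using key 1

theorem genDual_injective (M : GrMod 𝒜) : Function.Injective (genDual M) := by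
  rw [injective_iff_map_eq_zero]
  intro g hg
  let l : DualAlg 𝒜 ⊗[k] Module.Dual k (gens M) →ₗ[k] Module.Dual k (gens M) :=
    TensorProduct.lift (LinearMap.lsmul k _ ∘ₗ
      (TrivSqZeroExt.fstHom k k (Module.Dual k (𝒜 1))).toLinearMap ∘ₗ (dualTrunc 𝒜).toLinearMap)
  have hl : ∀ a g, l (a ⊗ₜ g) = (dualTrunc 𝒜 a).fst • g := fun _ _ => rfl
  have hl' : ∀ ξ (b : DualAlg 𝒜), l (op b • dualGenInclusion M ξ) = 0 := fun ξ b => by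
    induction ξ using TensorProduct.induction_on with
    | zero => simp
    | add x y hx hy => rw [map_add, smul_add, map_add, hx, hy, add_zero]
    | tmul g f =>
      rw [dualGenInclusion_tmul, TensorProduct.smul_tmul', op_smul_eq_mul, hl, map_mul,
        dualTrunc_dualι]
      simp
  have := map_dualRelations_eq_zero M l (fun ξ _ => hl' ξ) (congrArg Subtype.val hg)
  rw [hl, map_one] at this
  simpa using this

/-- The identification `(M^!_0)^* = V_M`. -/
def dualZeroEquiv (M : GrMod 𝒜) [FiniteDimensional k (gens M)] :
    Module.Dual k (dualModDeg M 0) ≃ₗ[k] gens M :=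
  (LinearEquiv.ofBijective (genDual M) ⟨genDual_injective M, genDual_surjective M⟩).dualMap ≪≫ₗ
    (Module.evalEquiv k (gens M)).symm

theorem apply_dualZeroEquiv (M : GrMod 𝒜) [FiniteDimensional k (gens M)]
    (φ : Module.Dual k (dualModDeg M 0)) (g : Module.Dual k (gens M)) :
    g (dualZeroEquiv M φ) = φ (genDual M g) :=
  Module.apply_evalEquiv_symm_apply k (gens M) g _

/-- The canonical map `V_M^* ⊗ V^* → M^!_{-1}`. -/
def genDualOne (M : GrMod 𝒜) :
    Module.Dual k (gens M) ⊗[k] Module.Dual k (𝒜 1) →ₗ[k] dualModDeg M 1 :=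
  TensorProduct.lift (LinearMap.mk₂ k (fun g f => rightMul M 0 f (genDual M g))
    (fun g g' f => by rw [map_add, map_add])
    (fun r g f => by rw [map_smul, map_smul])
    (fun g f f' => Subtype.ext (by simp [rightMul, add_smul]))
    (fun r g f => Subtype.ext (by simp [rightMul])))

theorem coe_genDualOne (M : GrMod 𝒜) (ξ) :
    (genDualOne M ξ : DualMod M) = dualModMk M (dualGenInclusion M ξ) := by
  induction ξ using TensorProduct.induction_on with
  | zero => simp
  | add x y hx hy => rw [map_add, map_add, map_add, Submodule.coe_add, hx, hy]
  | tmul g f =>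
    change op (dualι 𝒜 f) • dualModMk M (1 ⊗ₜ g) = _
    rw [← map_smul, dualGenInclusion_tmul, TensorProduct.smul_tmul', op_smul_eq_mul, one_mul]

theorem genDualOne_eq_zero (M : GrMod 𝒜) {ξ} (h : ξ ∈ orthogonal (modRelations M)) :
    genDualOne M ξ = 0 := by
  refine Subtype.ext ?_
  rw [coe_genDualOne]
  exact (Submodule.Quotient.mk_eq_zero _).2 (Submodule.subset_span ⟨ξ, h, rfl⟩)

/-- The kernel of `V_M^* ⊗ V^* → M^!_{-1}` annihilates the relations of `M`. -/
theorem dualDistrib_eq_zero_of_genDualOne (M : GrMod 𝒜) {t : gens M ⊗[k] 𝒜 1}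
    (ht : t ∈ modRelations M) {ξ} (h : genDualOne M ξ = 0) :
    TensorProduct.dualDistrib k _ _ ξ t = 0 := by
  let l : DualAlg 𝒜 ⊗[k] Module.Dual k (gens M) →ₗ[k] k :=
    LinearMap.applyₗ t ∘ₗ TensorProduct.dualDistrib k (gens M) (𝒜 1) ∘ₗ
      (TensorProduct.comm k _ _).toLinearMap ∘ₗ TensorProduct.map
        (TrivSqZeroExt.sndHom k (Module.Dual k (𝒜 1)) ∘ₗ (dualTrunc 𝒜).toLinearMap) LinearMap.id
  have hl : ∀ a g, l (a ⊗ₜ g) =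
    TensorProduct.dualDistrib k _ _ (g ⊗ₜ (dualTrunc 𝒜 a).snd) t := fun _ _ => rfl
  have hl' : ∀ ξ (b : DualAlg 𝒜), l (op b • dualGenInclusion M ξ) =
      (dualTrunc 𝒜 b).fst * TensorProduct.dualDistrib k _ _ ξ t := fun ξ b => by
    induction ξ using TensorProduct.induction_on with
    | zero => simp
    | add x y hx hy => rw [map_add, smul_add, map_add, hx, hy, map_add, LinearMap.add_apply,
        mul_add]
    | tmul g f =>
      rw [dualGenInclusion_tmul, TensorProduct.smul_tmul', op_smul_eq_mul, hl, map_mul,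
        dualTrunc_dualι]
      simp [TensorProduct.tmul_smul]
  have := map_dualRelations_eq_zero M l (fun ξ hξ b => by
    rw [hl']
    have : TensorProduct.dualDistrib k _ _ ξ t = 0 :=
      (Submodule.mem_dualAnnihilator _).1 hξ t ht
    rw [this, mul_zero]) (x := dualGenInclusion M ξ)
    (by rw [← coe_genDualOne, h, Submodule.coe_zero])
  have h1 := hl' ξ 1
  rw [op_one, one_smul, this, map_one, TrivSqZeroExt.fst_one, one_mul] at h1
  exact h1.symm

/-- The identification of `K_0(M)` with `V_M ⊗ A`. -/
def koszulZeroMap (M : GrMod 𝒜) [FiniteDimensional k (gens M)] :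
    A ⊗[k] Module.Dual k (dualModDeg M 0) →ₗ[Aᵐᵒᵖ] A ⊗[k] gens M :=
  TensorProduct.AlgebraTensorModule.map LinearMap.id (dualZeroEquiv M).toLinearMap

theorem koszulZeroMap_tmul (M : GrMod 𝒜) [FiniteDimensional k (gens M)] (a : A)
    (φ : Module.Dual k (dualModDeg M 0)) :
    koszulZeroMap M (a ⊗ₜ φ) = a ⊗ₜ dualZeroEquiv M φ := rfl

theorem koszulZeroMap_bijective (M : GrMod 𝒜) [FiniteDimensional k (gens M)] :
    Function.Bijective (koszulZeroMap M) :=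
  (TensorProduct.congr (LinearEquiv.refl k A) (dualZeroEquiv M)).bijective

variable [FiniteDimensional k (𝒜 1)]

theorem ext_dualDistrib {V W : Type u} [AddCommGroup V] [Module k V] [AddCommGroup W] [Module k W]
    [FiniteDimensional k V] [FiniteDimensional k W] {s t : V ⊗[k] W}
    (h : ∀ ξ, TensorProduct.dualDistrib k _ _ ξ s = TensorProduct.dualDistrib k _ _ ξ t) :
    s = t := by
  rw [← sub_eq_zero, ← Module.forall_dual_apply_eq_zero_iff k]
  intro l
  obtain ⟨ξ, rfl⟩ := (TensorProduct.dualDistribEquiv k V W).surjective l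
  rw [map_sub, sub_eq_zero]
  exact h ξ

/-- The map `(M^!_{-1})^* → V_M ⊗ V`, with image the space of relations of `M`. -/
def dualOne (M : GrMod 𝒜) [FiniteDimensional k (gens M)]
    (φ : Module.Dual k (dualModDeg M 1)) : gens M ⊗[k] 𝒜 1 :=
  ∑ i, dualZeroEquiv M (leftAct M 0 ((Module.finBasis k (𝒜 1)).coord i) φ) ⊗ₜ
    Module.finBasis k (𝒜 1) i

theorem dualDistrib_dualOne (M : GrMod 𝒜) [FiniteDimensional k (gens M)]
    (φ : Module.Dual k (dualModDeg M 1)) (ξ) :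
    TensorProduct.dualDistrib k _ _ ξ (dualOne M φ) = φ (genDualOne M ξ) := by
  induction ξ using TensorProduct.induction_on with
  | zero => simp
  | add x y hx hy => rw [map_add, LinearMap.add_apply, hx, hy, map_add, map_add]
  | tmul g f =>
    have hf : f = ∑ i, f (Module.finBasis k (𝒜 1) i) • (Module.finBasis k (𝒜 1)).coord i :=
      ((Module.finBasis k (𝒜 1)).sum_dual_apply_smul_coord f).symm
    rw [dualOne, map_sum]
    conv_rhs => rw [hf, TensorProduct.tmul_sum, map_sum, map_sum]
    refine Finset.sum_congr rfl fun i _ => ?_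
    rw [TensorProduct.dualDistrib_apply, apply_dualZeroEquiv, TensorProduct.tmul_smul, map_smul,
      map_smul, smul_eq_mul, mul_comm]
    rfl

theorem dualOne_mem (M : GrMod 𝒜) [FiniteDimensional k (gens M)]
    (φ : Module.Dual k (dualModDeg M 1)) : dualOne M φ ∈ modRelations M := by
  by_contra hn
  obtain ⟨l, hl, hR⟩ := Submodule.exists_dual_map_eq_bot_of_notMem hn inferInstance
  obtain ⟨ξ, rfl⟩ := (TensorProduct.dualDistribEquiv k (gens M) (𝒜 1)).surjective l
  refine hl ((dualDistrib_dualOne M φ ξ).trans ?_)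
  rw [genDualOne_eq_zero, map_zero]
  change _ ∈ Submodule.dualAnnihilator _
  rw [Submodule.mem_dualAnnihilator]
  intro w hw
  exact (Submodule.mem_bot k).1 (hR ▸ Submodule.mem_map_of_mem hw)

theorem exists_dualOne_eq (M : GrMod 𝒜) [FiniteDimensional k (gens M)] {t : gens M ⊗[k] 𝒜 1}
    (ht : t ∈ modRelations M) : ∃ φ, dualOne M φ = t := by
  let l : Module.Dual k (Module.Dual k (gens M) ⊗[k] Module.Dual k (𝒜 1)) :=
    LinearMap.applyₗ t ∘ₗ TensorProduct.dualDistrib k (gens M) (𝒜 1)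
  obtain ⟨φ, hφ⟩ := exists_dual_comp_eq (genDualOne M) l fun ξ hξ =>
    dualDistrib_eq_zero_of_genDualOne M ht hξ
  refine ⟨φ, ext_dualDistrib fun ξ => ?_⟩
  rw [dualDistrib_dualOne]
  exact hφ ξ

/-- The augmentation `K_0(M) = V_M ⊗ A → M`. -/
def koszulAug (M : GrMod 𝒜) [FiniteDimensional k (gens M)] :
    A ⊗[k] Module.Dual k (dualModDeg M 0) →ₗ[Aᵐᵒᵖ] M :=
  action M ∘ₗ koszulZeroMap M

theorem map_koszulMap_zero (M : GrMod 𝒜) [FiniteDimensional k (gens M)] (a : A)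
    (φ : Module.Dual k (dualModDeg M 1)) :
    koszulZeroMap M (koszulMap M 0 (a ⊗ₜ φ)) = op a • genInclusion M (dualOne M φ) := by
  rw [koszulMap_tmul, dualOne, map_sum, map_sum, Finset.smul_sum]
  refine Finset.sum_congr rfl fun i _ => ?_
  rw [genInclusion_tmul, TensorProduct.smul_tmul', op_smul_eq_mul, koszulZeroMap_tmul]

omit [FiniteDimensional k (𝒜 1)] in
theorem koszulAug_surjective {M : GrMod 𝒜} (hM : IsQuadraticModule M)
    [FiniteDimensional k (gens M)] : Function.Surjective (koszulAug M) :=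
  hM.surjective.comp (koszulZeroMap_bijective M).surjective

/-- A quadratic module is the zeroth homology of its Koszul complex. -/
theorem exact_koszulMap_koszulAug {M : GrMod 𝒜} (hM : IsQuadraticModule M)
    [FiniteDimensional k (gens M)] : Function.Exact (koszulMap M 0) (koszulAug M) := by
  intro x
  constructor
  · intro hx
    have hx : koszulZeroMap M x ∈ LinearMap.ker (action M) := hx
    have hle : LinearMap.ker (action M) ≤ LinearMap.range (koszulZeroMap M ∘ₗ koszulMap M 0) := by
      rw [hM.ker_eq, Submodule.span_le]
      rintro _ ⟨t, ht, rfl⟩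
      obtain ⟨φ, rfl⟩ := exists_dualOne_eq M ht
      refine ⟨1 ⊗ₜ φ, (map_koszulMap_zero M 1 φ).trans ?_⟩
      rw [op_one, one_smul]
    obtain ⟨y, hy⟩ := hle hx
    exact ⟨y, (koszulZeroMap_bijective M).injective hy⟩
  · rintro ⟨y, rfl⟩
    change action M (koszulZeroMap M (koszulMap M 0 y)) = 0
    induction y using TensorProduct.induction_on with
    | zero => simp
    | add x y hx hy => rw [map_add, map_add, map_add, hx, hy, add_zero]
    | tmul a φ =>
      have h : action M (genInclusion M (dualOne M φ)) = 0 := dualOne_mem M φ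
      refine (congrArg (action M) (map_koszulMap_zero M a φ)).trans ?_
      rw [map_smul, h, smul_zero]

omit [FiniteDimensional k (𝒜 1)] in
theorem koszulAug_mem_deg [GradedAlgebra 𝒜] (M : GrMod 𝒜) [FiniteDimensional k (gens M)] (d : ℤ)
    (x : koszul M 0) (hx : x ∈ (koszul M 0).deg d) : koszulAug M x ∈ M.deg d := by
  obtain ⟨t, rfl⟩ := hx
  induction t using TensorProduct.induction_on with
  | zero => rw [map_zero]; exact (koszulAug M).map_zero ▸ Submodule.zero_mem _
  | add x y hx hy =>
    rw [map_add]
    exact (koszulAug M).map_add _ _ ▸ Submodule.add_mem _ hx hy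
  | tmul a w =>
    have := M.smul_mem_intDeg (dualZeroEquiv M w).2 a.2
    have e : (0 : ℤ) + (d - ((0 : ℕ) : ℤ)) = d := by simp
    rw [e] at this
    exact this

end Quadratic

/-! ### Paths, arrows and the level filtration -/

section KoszulCast

variable {k : Type u} [Field k] {A : Type u} [Ring A] [Algebra k A] {𝒜 : ℕ → Submodule k A}
  [GradedAlgebra 𝒜]

/-- The identification of `K_m(M)` with `K_n(M)` for `m = n`. -/
def koszulCast (M : GrMod 𝒜) {m n : ℕ} (h : m = n) : koszul M m →ₗ[Aᵐᵒᵖ] koszul M n :=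
  h ▸ LinearMap.id

@[simp]
theorem koszulCast_koszulCast (M : GrMod 𝒜) {m n l : ℕ} (h : m = n) (h' : n = l) (x : koszul M m) :
    koszulCast M h' (koszulCast M h x) = koszulCast M (h.trans h') x := by
  subst h h'; rfl

theorem koszulCast_mem_deg (M : GrMod 𝒜) {m n : ℕ} (h : m = n) {d : ℤ} {x : koszul M m}
    (hx : x ∈ (koszul M m).deg d) : koszulCast M h x ∈ (koszul M n).deg d := by
  subst h; exact hx

theorem koszulD_succ [FiniteDimensional k (𝒜 1)] (M : GrMod 𝒜) (n : ℕ) :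
    koszulD M (n + 1) n = koszulSucc M n := by
  simp [koszulD]

theorem koszulD_koszulCast [FiniteDimensional k (𝒜 1)] (M : GrMod 𝒜) {m m' n n' : ℕ} (h : m = m')
    (h' : n = n') (x : koszul M m) :
    koszulD M m' n' (koszulCast M h x) = koszulCast M h' (koszulD M m n x) := by
  subst h h'; rfl

end KoszulCast

section Shifted

variable {k : Type u} [Field k] {A : Type u} [Ring A] [Algebra k A] {𝒜 : ℕ → Submodule k A}

theorem GrMod.map_proj_of_shift {X Y : GrMod 𝒜} (f : X →ₗ[Aᵐᵒᵖ] Y) (j : ℤ)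
    (hf : ∀ d x, x ∈ X.deg d → f x ∈ Y.deg (j + d)) (d : ℤ) (x : X) :
    f (X.proj d x) = Y.proj (j + d) (f x) := by
  induction X.mem_iSup x using Submodule.iSup_induction' with
  | mem e x hx =>
    by_cases h : d = e
    · subst h
      rw [X.proj_of_mem d x hx, Y.proj_of_mem _ _ (hf d x hx)]
    · rw [X.proj_of_ne d e x h hx, Y.proj_of_ne _ (j + e) _ (by omega) (hf e x hx), map_zero]
  | zero => simp
  | add x y _ _ hx hy => simp only [map_add, hx, hy]

end Shifted

namespace ResolvingDatum

variable {k : Type u} [Field k] {A : Type u} [Ring A] [Algebra k A]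
  {𝒜 : ℕ → Submodule k A} [GradedAlgebra 𝒜] [FiniteDimensional k (𝒜 1)] {D : ResolvingDatum 𝒜}

open GrMod

variable {i : Fin (D.N + 1)}

/-- The inclusion of the Koszul complex of `M i`, the summand of the path of length zero. -/
def inclVertex (D : ResolvingDatum 𝒜) (i : Fin (D.N + 1)) (n : ℕ) :
    koszul (D.M i) n →ₗ[Aᵐᵒᵖ] D.term i n :=
  incl (D.summand i n) ⟨.vertex i, Nat.zero_le n⟩

/-- The projection to the summand of the path of length zero. -/
def compVertex (D : ResolvingDatum 𝒜) (i : Fin (D.N + 1)) (n : ℕ) :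
    D.term i n →ₗ[Aᵐᵒᵖ] koszul (D.M i) n :=
  comp (D.summand i n) ⟨.vertex i, Nat.zero_le n⟩

/-- The path `p` preceded by the arrow `a`. -/
def consPath (a : D.Arrow i) {q n : ℕ} (h : a.bideg₁ + q = n)
    (p : {p : D.Path a.tgt // p.bideg₁ ≤ q}) : {p : D.Path i // p.bideg₁ ≤ n} :=
  ⟨.cons a p.1, by have := p.2; change a.bideg₁ + p.1.bideg₁ ≤ n; omega⟩

theorem consPath_injective (a : D.Arrow i) {q n : ℕ} (h : a.bideg₁ + q = n) :
    Function.Injective (consPath a h) := by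
  rintro ⟨p, hp⟩ ⟨p', hp'⟩ e
  have e : Path.cons a p = Path.cons a p' := congrArg Subtype.val e
  cases e
  rfl

/-- The summands of `p` in `D.term a.tgt q` and of `cons a p` in `D.term i n` are terms of the
Koszul complex with the same index; the equality is not definitional, whence the use of
`koszulCast`. -/
theorem sub_bideg_eq (a : D.Arrow i) {q n : ℕ} (h : a.bideg₁ + q = n)
    (p : D.Path a.tgt) : q - p.bideg₁ = n - (Path.cons a p).bideg₁ := by
  change _ = n - (a.bideg₁ + p.bideg₁)
  omega

/-- The inclusion of the summand of the path `p` preceded by the arrow `a`. -/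
def inclCons (a : D.Arrow i) {q n : ℕ} (h : a.bideg₁ + q = n)
    (p : {p : D.Path a.tgt // p.bideg₁ ≤ q}) :
    koszul (D.M p.1.tgt) (q - p.1.bideg₁) →ₗ[Aᵐᵒᵖ] D.term i n :=
  incl (D.summand i n) (consPath a h p) ∘ₗ koszulCast (D.M p.1.tgt) (sub_bideg_eq a h p.1)

/-- The projection to the summand of the path `p` preceded by the arrow `a`. -/
def compCons (a : D.Arrow i) {q n : ℕ} (h : a.bideg₁ + q = n)
    (p : {p : D.Path a.tgt // p.bideg₁ ≤ q}) :
    D.term i n →ₗ[Aᵐᵒᵖ] koszul (D.M p.1.tgt) (q - p.1.bideg₁) :=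
  koszulCast (D.M p.1.tgt) (sub_bideg_eq a h p.1).symm ∘ₗ comp (D.summand i n) (consPath a h p)

/-- The inclusion of the summand of a path. -/
def inclPath {q : ℕ} (p : {p : D.Path i // p.bideg₁ ≤ q}) :
    koszul (D.M p.1.tgt) (q - p.1.bideg₁) →ₗ[Aᵐᵒᵖ] D.term i q :=
  incl (D.summand i q) p

/-- The projection to the summand of a path. -/
def compPath {q : ℕ} (p : {p : D.Path i // p.bideg₁ ≤ q}) :
    D.term i q →ₗ[Aᵐᵒᵖ] koszul (D.M p.1.tgt) (q - p.1.bideg₁) :=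
  comp (D.summand i q) p

theorem compPath_inclPath {q : ℕ} (p : {p : D.Path i // p.bideg₁ ≤ q}) (x) :
    compPath p (inclPath p x) = x :=
  comp_incl_self (X := D.summand i q) p x

theorem compPath_inclPath_of_ne {q : ℕ} {p p' : {p : D.Path i // p.bideg₁ ≤ q}} (h : p ≠ p') (x) :
    compPath p' (inclPath p x) = 0 :=
  comp_incl_ne (X := D.summand i q) h x

theorem path_cases {n : ℕ} {p : {p : D.Path i // p.bideg₁ ≤ n} → Prop}
    (vertex : p ⟨.vertex i, Nat.zero_le n⟩)
    (arrow : ∀ (a : D.Arrow i) (q : ℕ) (h : a.bideg₁ + q = n) (r), p (consPath a h r))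
    (α : {p : D.Path i // p.bideg₁ ≤ n}) : p α := by
  obtain ⟨α, hα⟩ := α
  cases α with
  | vertex => exact vertex
  | cons a r =>
    have hα' : a.bideg₁ + r.bideg₁ ≤ n := hα
    exact arrow a (n - a.bideg₁) (by omega) ⟨r, by omega⟩

theorem term_ext_path {n : ℕ} {x y : D.term i n} (h : ∀ p, compPath p x = compPath p y) :
    x = y := directSum_ext (X := D.summand i n) h

theorem term_induction_path {n : ℕ} {p : D.term i n → Prop} (x : D.term i n) (zero : p 0)
    (add : ∀ x y, p x → p y → p (x + y)) (path : ∀ r z, p (inclPath r z)) : p x :=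
  directSum_induction (X := D.summand i n) x zero add fun r _ => path r _

theorem compPath_consPath (a : D.Arrow i) {q n : ℕ} (h : a.bideg₁ + q = n) (p) (x : D.term i n) :
    compPath (consPath a h p) x =
      koszulCast (D.M p.1.tgt) (sub_bideg_eq a h p.1) (compCons a h p x) :=
  (koszulCast_koszulCast (D.M p.1.tgt) (sub_bideg_eq a h p.1).symm (sub_bideg_eq a h p.1) _).symm

theorem inclCons_compCons (a : D.Arrow i) {q n : ℕ} (h : a.bideg₁ + q = n) (p) (x : D.term i n) :
    inclCons a h p (compCons a h p x) =
      inclPath (consPath a h p) (compPath (consPath a h p) x) :=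
  congrArg (inclPath (consPath a h p)) (compPath_consPath a h p x).symm

theorem compVertex_inclVertex (n : ℕ) (x : koszul (D.M i) n) :
    compVertex D i n (inclVertex D i n x) = x :=
  comp_incl_self (X := D.summand i n) ⟨.vertex i, Nat.zero_le n⟩ x

theorem inclVertex_injective (n : ℕ) : Function.Injective (inclVertex D i n) :=
  Function.LeftInverse.injective (compVertex_inclVertex n)

theorem compVertex_inclCons (a : D.Arrow i) {q n : ℕ} (h : a.bideg₁ + q = n) (p) (x) :
    compVertex D i n (inclCons a h p x) = 0 := by
  have hne : consPath a h p ≠ ⟨.vertex i, Nat.zero_le n⟩ := fun e => by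
    have : Path.cons a p.1 = Path.vertex i := congrArg Subtype.val e
    cases this
  exact compPath_inclPath_of_ne hne (koszulCast (D.M p.1.tgt) (sub_bideg_eq a h p.1) x)

theorem compCons_inclVertex (a : D.Arrow i) {q n : ℕ} (h : a.bideg₁ + q = n) (p)
    (x : koszul (D.M i) n) : compCons a h p (inclVertex D i n x) = 0 := by
  have : compPath (consPath a h p) (inclVertex D i n x) = 0 :=
    comp_incl_ne (X := D.summand i n) (i := ⟨.vertex i, Nat.zero_le n⟩) (fun e => by
      have : Path.vertex i = Path.cons a p.1 := congrArg Subtype.val e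
      cases this) x
  exact (congrArg (koszulCast _ _) this).trans (map_zero _)

theorem compCons_inclCons (a : D.Arrow i) {q n : ℕ} (h : a.bideg₁ + q = n) (p) (x) :
    compCons a h p (inclCons a h p x) = x :=
  (congrArg (koszulCast _ _) (compPath_inclPath (consPath a h p) _)).trans
    (koszulCast_koszulCast (D.M p.1.tgt) (sub_bideg_eq a h p.1) (sub_bideg_eq a h p.1).symm x)

theorem compCons_inclCons_of_ne {a b : D.Arrow i} {q q' n : ℕ} (h : a.bideg₁ + q = n)
    (h' : b.bideg₁ + q' = n) {p p'} (hp : consPath a h p ≠ consPath b h' p') (x) :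
    compCons b h' p' (inclCons a h p x) = 0 :=
  (congrArg (koszulCast _ _) (compPath_inclPath_of_ne hp _)).trans (map_zero _)

/-- The inclusion of the terms for the target of an arrow `a` as the summands of the paths which
begin with `a`. -/
def inclArrow (a : D.Arrow i) {q n : ℕ} (h : a.bideg₁ + q = n) :
    D.term a.tgt q →ₗ[Aᵐᵒᵖ] D.term i n :=
  desc (X := D.summand a.tgt q) fun p => inclCons a h p

/-- The projection to the summands of the paths which begin with the arrow `a`. -/
def compArrow (a : D.Arrow i) {q n : ℕ} (h : a.bideg₁ + q = n) :
    D.term i n →ₗ[Aᵐᵒᵖ] D.term a.tgt q :=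
  restrict (X := D.summand i n) (Y := D.summand a.tgt q) (consPath a h) (consPath_injective a h)
    fun p => koszulCast (D.M p.1.tgt) (sub_bideg_eq a h p.1).symm

theorem inclArrow_inclPath (a : D.Arrow i) {q n : ℕ} (h : a.bideg₁ + q = n) (p) (x) :
    inclArrow a h (inclPath p x) = inclCons a h p x :=
  desc_incl (X := D.summand a.tgt q) (fun p => inclCons a h p) p x

theorem compPath_compArrow (a : D.Arrow i) {q n : ℕ} (h : a.bideg₁ + q = n) (p) (x : D.term i n) :
    compPath p (compArrow a h x) = compCons a h p x := rfl

theorem compArrow_inclVertex (a : D.Arrow i) {q n : ℕ} (h : a.bideg₁ + q = n)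
    (x : koszul (D.M i) n) : compArrow a h (inclVertex D i n x) = 0 := by
  refine term_ext_path fun p => ?_
  rw [compPath_compArrow, compCons_inclVertex, map_zero]

theorem compVertex_inclArrow (a : D.Arrow i) {q n : ℕ} (h : a.bideg₁ + q = n)
    (x : D.term a.tgt q) : compVertex D i n (inclArrow a h x) = 0 := by
  refine term_induction_path (p := fun x => compVertex D i n (inclArrow a h x) = 0) x ?_ ?_ ?_
  · rw [map_zero, map_zero]
  · intro x y hx hy; rw [map_add, map_add, hx, hy, add_zero]
  · intro p z
    rw [inclArrow_inclPath, compVertex_inclCons]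

theorem compArrow_inclArrow (a : D.Arrow i) {q n : ℕ} (h : a.bideg₁ + q = n)
    (x : D.term a.tgt q) : compArrow a h (inclArrow a h x) = x := by
  refine term_induction_path (p := fun x => compArrow a h (inclArrow a h x) = x) x ?_ ?_ ?_
  · rw [map_zero, map_zero]
  · intro x y hx hy; rw [map_add, map_add, hx, hy]
  · intro p z
    rw [inclArrow_inclPath]
    refine term_ext_path fun p' => ?_
    rw [compPath_compArrow]
    by_cases hp : p = p'
    · subst hp
      rw [compCons_inclCons, compPath_inclPath]
    · rw [compPath_inclPath_of_ne hp,
        compCons_inclCons_of_ne _ _ fun e => hp (consPath_injective a h e)]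

theorem compArrow_inclArrow_of_ne {a b : D.Arrow i} (hab : a ≠ b) {q q' n : ℕ}
    (h : a.bideg₁ + q = n) (h' : b.bideg₁ + q' = n) (x : D.term a.tgt q) :
    compArrow b h' (inclArrow a h x) = 0 := by
  refine term_induction_path (p := fun x => compArrow b h' (inclArrow a h x) = 0) x ?_ ?_ ?_
  · rw [map_zero, map_zero]
  · intro x y hx hy; rw [map_add, map_add, hx, hy, add_zero]
  · intro p z
    rw [inclArrow_inclPath]
    refine term_ext_path fun p' => ?_
    rw [compPath_compArrow, map_zero, compCons_inclCons_of_ne]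
    intro e
    have : Path.cons a p.1 = Path.cons b p'.1 := congrArg Subtype.val e
    injection this with _ hab'
    exact hab hab'

/-- An element of `D.term i n` is determined by its components in the Koszul complex of `M i` and in
the terms for the targets of the arrows. -/
theorem term_ext {n : ℕ} {x y : D.term i n} (hv : compVertex D i n x = compVertex D i n y)
    (ha : ∀ (a : D.Arrow i) (q : ℕ) (h : a.bideg₁ + q = n), compArrow a h x = compArrow a h y) :
    x = y := by
  refine term_ext_path fun α => ?_
  refine path_cases (p := fun α => compPath α x = compPath α y) hv (fun a q h r => ?_) α
  rw [compPath_consPath, compPath_consPath, ← compPath_compArrow, ha a q h, compPath_compArrow]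

/-- The position of an arrow `a` in the filtration of the resolution of `M i`: `a.Lt b` or
`a.bideg₁ < b.bideg₁` if and only if `a.level < b.level`. -/
def Arrow.level (a : D.Arrow i) : ℕ := 2 * (a.m : ℕ) + if a.idx.isLeft then 1 else 0

/-- The span of the Koszul complex of `M i` and of the summands of all paths whose first arrow has
level at least `s`. -/
def filt (D : ResolvingDatum 𝒜) (i : Fin (D.N + 1)) (s n : ℕ) : Submodule Aᵐᵒᵖ (D.term i n) where
  carrier := {x | ∀ (a : D.Arrow i) (q : ℕ) (h : a.bideg₁ + q = n), a.level < s →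
    compArrow a h x = 0}
  zero_mem' a q h _ := map_zero _
  add_mem' hx hy a q h hs := by rw [map_add, hx a q h hs, hy a q h hs, add_zero]
  smul_mem' c x hx a q h hs := by rw [map_smul, hx a q h hs, smul_zero]

theorem filt_zero (n : ℕ) (x : D.term i n) : x ∈ filt D i 0 n := by
  intro a q h hs
  omega

theorem filt_antitone {s t n : ℕ} (hst : s ≤ t) {x : D.term i n} (hx : x ∈ filt D i t n) :
    x ∈ filt D i s n := fun a q h hs => hx a q h (hs.trans_le hst)

theorem inclVertex_mem_filt (s n : ℕ) (x : koszul (D.M i) n) : inclVertex D i n x ∈ filt D i s n :=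
  fun a _ h _ => compArrow_inclVertex a h x

theorem inclArrow_mem_filt {s : ℕ} (a : D.Arrow i) (hs : s ≤ a.level) {q n : ℕ}
    (h : a.bideg₁ + q = n) (x : D.term a.tgt q) : inclArrow a h x ∈ filt D i s n := by
  intro b q' h' hb
  refine compArrow_inclArrow_of_ne ?_ h h' x
  rintro rfl
  omega

/-- Induction on the step `s` of the filtration: it is spanned by the images of `inclVertex` and of
`inclArrow a` for the arrows `a` of level at least `s`. -/
theorem filt_induction {s n : ℕ} {p : D.term i n → Prop} (zero : p 0)
    (add : ∀ x y, p x → p y → p (x + y)) (vertex : ∀ x, p (inclVertex D i n x))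
    (arrow : ∀ (a : D.Arrow i), s ≤ a.level → ∀ (q : ℕ) (h : a.bideg₁ + q = n) (x),
      p (inclArrow a h x)) {x : D.term i n} (hx : x ∈ filt D i s n) : p x := by
  refine directSum_induction (X := D.summand i n) x zero add fun α hα => ?_
  change compPath α x ≠ 0 at hα
  change p (inclPath α (compPath α x))
  revert hα
  refine path_cases (p := fun α => compPath α x ≠ 0 → p (inclPath α (compPath α x)))
    (fun _ => vertex _) (fun a q h r hr => ?_) α
  have hs : s ≤ a.level := by
    by_contra hs
    rw [compPath_consPath, ← compPath_compArrow, hx a q h (not_le.1 hs), map_zero, map_zero] at hr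
    exact hr rfl
  rw [← inclCons_compCons, ← inclArrow_inclPath]
  exact arrow a hs q h _

/-- In degree `n` the filtration reaches the Koszul complex of `M i` at level `2 * n`, because an
arrow `a` only contributes in degrees `n ≥ a.m + 1`. -/
theorem exists_inclVertex_eq {s n : ℕ} (hs : 2 * n ≤ s) {x : D.term i n} (hx : x ∈ filt D i s n) :
    ∃ c, inclVertex D i n c = x := by
  refine ⟨compVertex D i n x, term_ext (compVertex_inclVertex _ _) fun a q h => ?_⟩
  rw [compArrow_inclVertex, hx a q h]
  have : (a.m : ℕ) + 1 + q = n := h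
  unfold Arrow.level
  split_ifs <;> omega

instance (i : Fin (D.N + 1)) : Finite (D.Arrow i) := by
  have := D.finite_support.to_subtype
  let S := {x : Fin (D.N + 1) × Fin (D.N + 1) × ℕ+ × ℕ+ |
    D.h x.1 x.2.1 x.2.2.1 x.2.2.2 ≠ (0, 0)}
  let f : D.Arrow i → Σ x : S, Fin (D.h x.1.1 x.1.2.1 x.1.2.2.1 x.1.2.2.2).1 ⊕
      Fin (D.h x.1.1 x.1.2.1 x.1.2.2.1 x.1.2.2.2).2 := fun a =>
    ⟨⟨(i, a.tgt, a.m, a.ℓ), fun h => by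
      have h : D.h i a.tgt a.m a.ℓ = (0, 0) := h
      obtain ⟨t, m, l, x | x⟩ := a
      · have := x.2
        simp [h] at this
      · have := x.2
        simp [h] at this⟩, a.idx⟩
  refine Finite.of_injective f fun a b hab => ?_
  obtain ⟨t, m, l, x⟩ := a
  obtain ⟨t', m', l', x'⟩ := b
  simp only [f, Sigma.mk.injEq, Subtype.mk.injEq, Prod.mk.injEq, true_and] at hab
  obtain ⟨⟨rfl, rfl, rfl⟩, h⟩ := hab
  rw [eq_of_heq h]

/-- Elements of `D.term i n` with prescribed components. -/
theorem exists_compArrow_eq {n : ℕ}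
    (y : ∀ (a : D.Arrow i) (q : ℕ), a.bideg₁ + q = n → D.term a.tgt q) :
    ∃ x : D.term i n, ∀ a q h, compArrow a h x = y a q h := by
  classical
  have := Fintype.ofFinite (D.Arrow i)
  refine ⟨∑ a, if h : a.bideg₁ ≤ n then
    inclArrow a (Nat.add_sub_cancel' h) (y a _ (Nat.add_sub_cancel' h)) else 0, fun a q h => ?_⟩
  obtain rfl : q = n - a.bideg₁ := by omega
  rw [map_sum, Finset.sum_eq_single a, dif_pos (by omega), compArrow_inclArrow]
  · intro b _ hb
    split_ifs with hb'
    · exact compArrow_inclArrow_of_ne hb _ _ _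
    · exact map_zero _
  · simp

theorem inclVertex_mem_deg {n : ℕ} {d : ℤ} {x : koszul (D.M i) n}
    (hx : x ∈ (koszul (D.M i) n).deg d) : inclVertex D i n x ∈ (D.term i n).deg d := by
  refine incl_mem_deg (X := D.summand i n) ?_
  change x ∈ (koszul (D.M i) n).deg (-((0 : ℕ) : ℤ) + d)
  rwa [Nat.cast_zero, neg_zero, zero_add]

theorem compVertex_mem_deg {n : ℕ} {d : ℤ} {x : D.term i n} (hx : x ∈ (D.term i n).deg d) :
    compVertex D i n x ∈ (koszul (D.M i) n).deg d := by
  have : compVertex D i n x ∈ (koszul (D.M i) n).deg (-((0 : ℕ) : ℤ) + d) :=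
    mem_deg_directSum.1 hx ⟨.vertex i, Nat.zero_le n⟩
  rwa [Nat.cast_zero, neg_zero, zero_add] at this

theorem summand_consPath_deg (a : D.Arrow i) (p : D.Path a.tgt) (d : ℤ) :
    -((Path.cons a p).bideg₂ : ℤ) + d = -(p.bideg₂ : ℤ) + (-(a.bideg₂ : ℤ) + d) := by
  change -((a.bideg₂ + p.bideg₂ : ℕ) : ℤ) + d = _
  push_cast
  ring

theorem inclPath_mem_deg {n : ℕ} {d : ℤ} {p} {x : koszul (D.M p.1.tgt) (n - p.1.bideg₁)}
    (hx : x ∈ (koszul (D.M p.1.tgt) (n - p.1.bideg₁)).deg (-(p.1.bideg₂ : ℤ) + d)) :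
    inclPath (i := i) p x ∈ (D.term i n).deg d :=
  incl_mem_deg (X := D.summand i n) hx

theorem compPath_mem_deg {n : ℕ} {d : ℤ} {x : D.term i n} (hx : x ∈ (D.term i n).deg d) (p) :
    compPath p x ∈ (koszul (D.M p.1.tgt) (n - p.1.bideg₁)).deg (-(p.1.bideg₂ : ℤ) + d) :=
  mem_deg_directSum.1 hx p

theorem mem_deg_of_compPath {n : ℕ} {d : ℤ} {x : D.term i n} (h : ∀ p, compPath p x ∈
    (koszul (D.M p.1.tgt) (n - p.1.bideg₁)).deg (-(p.1.bideg₂ : ℤ) + d)) :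
    x ∈ (D.term i n).deg d :=
  mem_deg_directSum.2 h

theorem inclCons_mem_deg (a : D.Arrow i) {q n : ℕ} (h : a.bideg₁ + q = n) {d : ℤ} {p}
    {x : koszul (D.M p.1.tgt) (q - p.1.bideg₁)}
    (hx : x ∈ (koszul (D.M p.1.tgt) (q - p.1.bideg₁)).deg
      (-(p.1.bideg₂ : ℤ) + (-(a.bideg₂ : ℤ) + d))) :
    inclCons a h p x ∈ (D.term i n).deg d := by
  refine inclPath_mem_deg (p := consPath a h p) ?_
  change _ ∈ GrMod.deg _ (-((Path.cons a p.1).bideg₂ : ℤ) + d)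
  rw [summand_consPath_deg]
  exact koszulCast_mem_deg (D.M p.1.tgt) (sub_bideg_eq a h p.1) hx

theorem inclArrow_mem_deg (a : D.Arrow i) {q n : ℕ} (h : a.bideg₁ + q = n) {d : ℤ}
    {x : D.term a.tgt q} (hx : x ∈ (D.term a.tgt q).deg (-(a.bideg₂ : ℤ) + d)) :
    inclArrow a h x ∈ (D.term i n).deg d := by
  have H : ∀ p : {p : D.Path a.tgt // p.bideg₁ ≤ q}, compPath p x ∈ GrMod.deg
      (koszul (D.M p.1.tgt) (q - p.1.bideg₁)) (-(p.1.bideg₂ : ℤ) + (-(a.bideg₂ : ℤ) + d)) :=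
    compPath_mem_deg hx
  refine directSum_induction (X := D.summand a.tgt q)
    (p := fun x => inclArrow a h x ∈ (D.term i n).deg d) x ?_ ?_ fun p _ => ?_
  · exact (inclArrow a h).map_zero ▸ Submodule.zero_mem _
  · intro x y hx hy
    exact (inclArrow a h).map_add x y ▸ Submodule.add_mem _ hx hy
  · exact inclArrow_inclPath a h p _ ▸ inclCons_mem_deg a h (H p)

theorem compArrow_mem_deg (a : D.Arrow i) {q n : ℕ} (h : a.bideg₁ + q = n) (d : ℤ)
    (x : D.term i n) (hx : x ∈ (D.term i n).deg d) :
    compArrow a h x ∈ (D.term a.tgt q).deg (-(a.bideg₂ : ℤ) + d) := by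
  refine mem_deg_of_compPath fun p => ?_
  rw [compPath_compArrow, ← summand_consPath_deg]
  exact koszulCast_mem_deg (D.M p.1.tgt) (sub_bideg_eq a h p.1).symm
    (compPath_mem_deg hx (consPath a h p))

theorem proj_mem_filt {s n : ℕ} {x : D.term i n} (hx : x ∈ filt D i s n) (e : ℤ) :
    (D.term i n).proj e x ∈ filt D i s n := by
  intro a q h hs
  rw [map_proj_of_shift _ _ (compArrow_mem_deg a h), hx a q h hs, map_zero]

/-- Morphisms out of `D.term i n` are given by their restrictions to the Koszul complex of `M i`
and to the terms for the targets of the arrows with source `M i`. -/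
theorem exists_grHom {n : ℕ} {X : GrMod 𝒜} (φ : GrHom (koszul (D.M i) n) X)
    (ψ : ∀ (a : D.Arrow i) (q : ℕ), a.bideg₁ + q = n → D.term a.tgt q →ₗ[Aᵐᵒᵖ] X)
    (hψ : ∀ (a : D.Arrow i) (q : ℕ) (h : a.bideg₁ + q = n) (d : ℤ) (x : D.term a.tgt q),
      x ∈ (D.term a.tgt q).deg (-(a.bideg₂ : ℤ) + d) → ψ a q h x ∈ X.deg d) :
    ∃ f : GrHom (D.term i n) X, (∀ x, f (inclVertex D i n x) = φ x) ∧
      ∀ a q h x, f (inclArrow a h x) = ψ a q h x := by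
  classical
  have := Fintype.ofFinite (D.Arrow i)
  let g : ∀ a : D.Arrow i, D.term i n →ₗ[Aᵐᵒᵖ] X := fun a => if h : a.bideg₁ ≤ n then
    ψ a _ (Nat.add_sub_cancel' h) ∘ₗ compArrow a (Nat.add_sub_cancel' h) else 0
  have hg : ∀ a d x, x ∈ (D.term i n).deg d → g a x ∈ X.deg d := fun a d x hx => by
    by_cases h : a.bideg₁ ≤ n
    · simp only [g, dif_pos h]
      exact hψ _ _ _ _ _ (compArrow_mem_deg a _ d x hx)
    · simp only [g, dif_neg h]
      exact Submodule.zero_mem _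
  refine ⟨⟨φ.toLin ∘ₗ compVertex D i n + ∑ a, g a, fun d x hx => ?_⟩, fun x => ?_,
    fun a q h x => ?_⟩
  · rw [LinearMap.add_apply, LinearMap.sum_apply]
    exact Submodule.add_mem _ (φ.map_deg _ _ (compVertex_mem_deg hx))
      (Submodule.sum_mem _ fun a _ => hg a d x hx)
  · change φ (compVertex D i n (inclVertex D i n x)) + (∑ a, g a) (inclVertex D i n x) = φ x
    rw [compVertex_inclVertex, LinearMap.sum_apply, Finset.sum_eq_zero, add_zero]
    intro a _
    by_cases h : a.bideg₁ ≤ n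
    · simp only [g, dif_pos h, LinearMap.comp_apply, compArrow_inclVertex, map_zero]
    · simp only [g, dif_neg h, LinearMap.zero_apply]
  · change φ (compVertex D i n (inclArrow a h x)) + (∑ a, g a) (inclArrow a h x) = _
    obtain rfl : q = n - a.bideg₁ := by omega
    have ha : a.bideg₁ ≤ n := by omega
    rw [compVertex_inclArrow, map_zero, zero_add, LinearMap.sum_apply, Finset.sum_eq_single a]
    · simp only [g, dif_pos ha, LinearMap.comp_apply, compArrow_inclArrow]
    · intro b _ hb
      by_cases hb' : b.bideg₁ ≤ n
      · simp only [g, dif_pos hb', LinearMap.comp_apply, compArrow_inclArrow_of_ne hb.symm,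
          map_zero]
      · simp only [g, dif_neg hb', LinearMap.zero_apply]
    · simp

end ResolvingDatum

/-! ### The homology of the Koszul complex and the conditions on the differentials -/

/-- Dependent choice for a condition on the `n`-th entry of a sequence which only involves the
preceding entries. -/
theorem exists_sequence {X : ℕ → Type*} [∀ n, Nonempty (X n)]
    (P : ∀ n, (∀ m, X m) → X n → Prop)
    (hP : ∀ n d d' x, (∀ m < n, d m = d' m) → P n d x → P n d' x)
    (step : ∀ n d, (∀ m < n, P m d (d m)) → ∃ x, P n d x) : ∃ d, ∀ n, P n d (d n) := by
  classical
  let d₀ : ∀ n, X n := fun n => Classical.arbitrary _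
  let e : ℕ → ∀ m, X m := fun n => Nat.rec d₀ (fun n e => Function.update e n
    (if h : ∃ x, P n e x then h.choose else d₀ n)) n
  have he : ∀ n, e (n + 1) = Function.update (e n) n
    (if h : ∃ x, P n (e n) x then h.choose else d₀ n) := fun n => rfl
  have hlt : ∀ n m, m < n → e n m = e (m + 1) m := fun n => by
    induction n with
    | zero => intro m hm; omega
    | succ n ih =>
      intro m hm
      rcases Nat.lt_succ_iff_lt_or_eq.1 hm with h | rfl
      · rw [he, Function.update_of_ne h.ne, ih m h]
      · rfl
  refine ⟨fun n => e (n + 1) n, fun n => ?_⟩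
  induction n using Nat.strong_induction_on with
  | _ n ih =>
    have hex : ∃ x, P n (e n) x := step n (e n) fun m hm => by
      rw [hlt n m hm]
      exact hP m _ _ _ (fun l hl => (hlt n l (hl.trans hm)).symm) (ih m hm)
    refine hP n (e n) _ _ (fun m hm => hlt n m hm) ?_
    change P n (e n) (e (n + 1) n)
    rw [he, Function.update_self, dif_pos hex]
    exact hex.choose_spec

section Homology

variable {k : Type u} [Field k] {A : Type u} [Ring A] [Algebra k A] {𝒜 : ℕ → Submodule k A}
  [GradedAlgebra 𝒜] [FiniteDimensional k (𝒜 1)] (M : GrMod 𝒜) (m : ℕ)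

/-- The relation between cycles of the Koszul complex and their homology classes. -/
def homologyRel : Submodule Aᵐᵒᵖ (koszul M m × koszulHomology M m) :=
  LinearMap.range ((LinearMap.ker (koszulD M m (m - 1)).toLin).subtype.prod
    (((LinearMap.range (koszulD M (m + 1) m).toLin).comap
      (LinearMap.ker (koszulD M m (m - 1)).toLin).subtype).mkQ))

variable {M m}

theorem koszulD_eq_zero_of_homologyRel {c : koszul M m} {z : koszulHomology M m}
    (h : (c, z) ∈ homologyRel M m) : koszulD M m (m - 1) c = 0 := by
  obtain ⟨y, hy⟩ := h
  obtain rfl : (y : koszul M m) = c := congrArg Prod.fst hy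
  exact y.2

theorem exists_homologyRel_of_cycle {c : koszul M m} (h : koszulD M m (m - 1) c = 0) :
    ∃ z, (c, z) ∈ homologyRel M m :=
  ⟨_, ⟨c, h⟩, rfl⟩

theorem exists_homologyRel_of_mem_deg {z : koszulHomology M m} {d : ℤ}
    (hz : z ∈ (koszulHomology M m).deg d) :
    ∃ c ∈ (koszul M m).deg d, (c, z) ∈ homologyRel M m := by
  obtain ⟨y, hy, rfl⟩ := hz
  exact ⟨y, hy, y, rfl⟩

theorem exists_koszulD_eq {c : koszul M m} (h : (c, 0) ∈ homologyRel M m) :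
    ∃ c', koszulD M (m + 1) m c' = c := by
  obtain ⟨y, hy⟩ := h
  obtain rfl : (y : koszul M m) = c := congrArg Prod.fst hy
  have := congrArg Prod.snd hy
  exact (Submodule.Quotient.mk_eq_zero _).1 this

theorem eq_zero_of_homologyRel {z : koszulHomology M m} (h : (0, z) ∈ homologyRel M m) :
    z = 0 := by
  obtain ⟨y, hy⟩ := h
  obtain rfl : y = 0 := Subtype.ext (congrArg Prod.fst hy)
  have := congrArg Prod.snd hy
  exact this.symm.trans (map_zero _)

theorem koszulD_comp_koszulD (n : ℕ) (x : koszul M (n + 2)) :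
    koszulD M (n + 1) n (koszulD M (n + 2) (n + 1) x) = 0 := by
  rw [koszulD_succ, koszulD_succ]
  exact koszulMap_comp M n x

theorem koszulD_mem_homologyRel (c : koszul M (m + 1)) :
    (koszulD M (m + 1) m c, 0) ∈ homologyRel M m := by
  have h : koszulD M m (m - 1) (koszulD M (m + 1) m c) = 0 := by
    cases m with
    | zero =>
      have : koszulD M 0 (0 - 1) = GrHom.zero _ _ := dif_neg (by omega)
      rw [this]
      rfl
    | succ n => exact koszulD_comp_koszulD n c
  refine ⟨⟨_, h⟩, Prod.ext rfl ?_⟩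
  exact (Submodule.Quotient.mk_eq_zero _).2 ⟨c, rfl⟩

/-- Lifting a map into a quotient of the homology to a map into the cycles. -/
theorem GrMod.HasSelection.exists_lift_homology {P X Z : GrMod 𝒜} (hP : P.HasSelection) (j : ℤ)
    (γ : GrHom (koszulHomology M m) Z) (hγ : Function.Surjective γ)
    (F : P →ₗ[Aᵐᵒᵖ] Z) (hF : ∀ (d : ℤ) (p : P), p ∈ P.deg (j + d) → F p ∈ Z.deg d)
    (ι : koszul M m →ₗ[Aᵐᵒᵖ] X) (hι : ∀ (d : ℤ) (c), c ∈ (koszul M m).deg d → ι c ∈ X.deg d) :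
    ∃ ψ : P →ₗ[Aᵐᵒᵖ] X, (∀ (d : ℤ) (p : P), p ∈ P.deg (j + d) → ψ p ∈ X.deg d) ∧
      ∀ p, ∃ c z, ψ p = ι c ∧ (c, z) ∈ homologyRel M m ∧ γ z = F p := by
  -- the pairs `(p, ι c)` for which `c` is a cycle with `γ [c] = F p`
  let R : Submodule Aᵐᵒᵖ (P × X) := ((homologyRel M m).map (ι.prodMap γ.toLin)).comap
    ((LinearMap.snd Aᵐᵒᵖ P X).prod (F ∘ₗ LinearMap.fst Aᵐᵒᵖ P X))
  obtain ⟨ψ, hψ, hR⟩ := hP.exists_linearMap (X := X) j R fun e p hp => by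
    obtain ⟨z, hz⟩ := hγ (F p)
    obtain ⟨c, hc, hcz⟩ := exists_homologyRel_of_mem_deg ((koszulHomology M m).proj_mem e z)
    refine ⟨ι c, hι e c hc, ⟨_, hcz, Prod.ext rfl ?_⟩⟩
    change γ ((koszulHomology M m).proj e z) = F p
    rw [proj_map, hz, proj_of_mem _ _ _ (hF e p hp)]
  refine ⟨ψ, hψ, fun p => ?_⟩
  obtain ⟨⟨c, z⟩, hcz, h⟩ := hR p
  exact ⟨c, z, (congrArg Prod.fst h).symm, hcz, congrArg Prod.snd h⟩

end Homology

namespace ResolvingDatum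

variable {k : Type u} [Field k] {A : Type u} [Ring A] [Algebra k A]
  {𝒜 : ℕ → Submodule k A} [GradedAlgebra 𝒜] [FiniteDimensional k (𝒜 1)] {D : ResolvingDatum 𝒜}
  {i : Fin (D.N + 1)}

open GrMod

instance (i : Fin (D.N + 1)) : FiniteDimensional k (gens (D.M i)) := (D.quadratic i).finite

theorem hasSelection_term (i : Fin (D.N + 1)) (n : ℕ) : (D.term i n).HasSelection :=
  HasSelection.directSum fun _ => (hasSelection_free _).shift _

/-- The inclusion of a summand of `⨁_{j, ℓ} (M j (-ℓ))^{c j ℓ}`. -/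
def sumIncl (D : ResolvingDatum 𝒜) (c : Fin (D.N + 1) → ℕ+ → ℕ)
    (x : Σ (j : _) (ℓ : _), Fin (c j ℓ)) :
    D.M x.1 →ₗ[Aᵐᵒᵖ] shiftedSum D.M c :=
  incl (fun x : (Σ (j : Fin (D.N + 1)) (ℓ : ℕ+), Fin (c j ℓ)) =>
    (D.M x.1).shift (-((x.2.1 : ℕ) : ℤ))) x

/-- The projection to a summand of `⨁_{j, ℓ} (M j (-ℓ))^{c j ℓ}`. -/
def sumComp (D : ResolvingDatum 𝒜) (c : Fin (D.N + 1) → ℕ+ → ℕ)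
    (x : Σ (j : _) (ℓ : _), Fin (c j ℓ)) :
    shiftedSum D.M c →ₗ[Aᵐᵒᵖ] D.M x.1 :=
  comp (fun x : (Σ (j : Fin (D.N + 1)) (ℓ : ℕ+), Fin (c j ℓ)) =>
    (D.M x.1).shift (-((x.2.1 : ℕ) : ℤ))) x

theorem sumComp_sumIncl {c : Fin (D.N + 1) → ℕ+ → ℕ} (x) (y : D.M x.1) :
    sumComp D c x (sumIncl D c x y) = y :=
  comp_incl_self (X := fun x : (Σ (j : Fin (D.N + 1)) (ℓ : ℕ+), Fin (c j ℓ)) =>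
    (D.M x.1).shift (-((x.2.1 : ℕ) : ℤ))) x y

theorem sumComp_sumIncl_of_ne {c : Fin (D.N + 1) → ℕ+ → ℕ} {x x'} (h : x ≠ x') (y : D.M x.1) :
    sumComp D c x' (sumIncl D c x y) = 0 :=
  comp_incl_ne (X := fun x : (Σ (j : Fin (D.N + 1)) (ℓ : ℕ+), Fin (c j ℓ)) =>
    (D.M x.1).shift (-((x.2.1 : ℕ) : ℤ))) h y

theorem shiftedSum_ext {c : Fin (D.N + 1) → ℕ+ → ℕ} {y z : shiftedSum D.M c}
    (h : ∀ x, sumComp D c x y = sumComp D c x z) : y = z :=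
  directSum_ext (X := fun x : (Σ (j : Fin (D.N + 1)) (ℓ : ℕ+), Fin (c j ℓ)) =>
    (D.M x.1).shift (-((x.2.1 : ℕ) : ℤ))) h

theorem sumIncl_mem_deg {c : Fin (D.N + 1) → ℕ+ → ℕ} (x) {d : ℤ} {y : D.M x.1}
    (hy : y ∈ (D.M x.1).deg (-((x.2.1 : ℕ) : ℤ) + d)) :
    sumIncl D c x y ∈ (shiftedSum D.M c).deg d :=
  incl_mem_deg (X := fun x : (Σ (j : Fin (D.N + 1)) (ℓ : ℕ+), Fin (c j ℓ)) =>
    (D.M x.1).shift (-((x.2.1 : ℕ) : ℤ))) hy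

/-- The augmentation `D.term i 0 → M i`. -/
def aug (D : ResolvingDatum 𝒜) (i : Fin (D.N + 1)) : D.term i 0 →ₗ[Aᵐᵒᵖ] D.M i :=
  (koszulAug (D.M i) : koszul (D.M i) 0 →ₗ[Aᵐᵒᵖ] D.M i) ∘ₗ compVertex D i 0

theorem aug_inclVertex (c : koszul (D.M i) 0) : aug D i (inclVertex D i 0 c) =
    koszulAug (D.M i) c :=
  congrArg (koszulAug (D.M i)) (compVertex_inclVertex 0 c)

theorem aug_surjective (i : Fin (D.N + 1)) : Function.Surjective (aug D i) := fun x => by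
  obtain ⟨c, rfl⟩ := koszulAug_surjective (D.quadratic i) x
  exact ⟨inclVertex D i 0 c, aug_inclVertex c⟩

theorem aug_mem_deg {d : ℤ} {x : D.term i 0} (hx : x ∈ (D.term i 0).deg d) :
    aug D i x ∈ (D.M i).deg d :=
  koszulAug_mem_deg _ _ _ (compVertex_mem_deg hx)

variable (D) in
/-- The condition that an element of `D.term i n` is a cycle for the maps `d`; empty for `n = 0`. -/
def IsCycle (d : ∀ n i, GrHom (D.term i (n + 1)) (D.term i n)) (i : Fin (D.N + 1)) :
    (n : ℕ) → D.term i n → Prop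
  | 0, _ => True
  | n + 1, x => d n i x = 0

variable (D) in
/-- The condition on the restriction `ψ` of the differential `D.term i (n + 1) → D.term i n` to the
summand `D.term a.tgt q` given by an arrow `a`. For `q = 0` it prescribes the class of the image of
`ψ` in the homology of the Koszul complex of `M i`. For positive `q` it says that `ψ` agrees with
the differential `D.term a.tgt q → D.term a.tgt (q - 1)` up to terms which are higher in the
filtration, and that its values are cycles. -/
def IsGoodOn (d : ∀ n i, GrHom (D.term i (n + 1)) (D.term i n)) (i : Fin (D.N + 1)) (n : ℕ) :
    (q : ℕ) → (a : D.Arrow i) → (D.term a.tgt q →ₗ[Aᵐᵒᵖ] D.term i n) → Prop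
  | 0, ⟨t, m, ℓ, .inl x⟩, ψ => ∀ hm : (m : ℕ) = n, ∀ y : D.term t 0, ∃ c z,
      ψ y = inclVertex D i n (koszulCast (D.M i) hm c) ∧ (c, z) ∈ homologyRel (D.M i) m ∧
        z = D.f i m (sumIncl D _ ⟨t, ℓ, x⟩ (aug D t y))
  | 0, ⟨t, m, ℓ, .inr x⟩, ψ => ∀ hm : (m : ℕ) = n, ∀ y : D.term t 0, ∃ c z,
      ψ y = inclVertex D i n (koszulCast (D.M i) hm c) ∧ (c, z) ∈ homologyRel (D.M i) m ∧
        D.g i m z = sumIncl D _ ⟨t, ℓ, x⟩ (aug D t y)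
  | q + 1, a, ψ => ∀ h : a.bideg₁ + q = n, ∀ y : D.term a.tgt (q + 1),
      ψ y - inclArrow a h (d q a.tgt y) ∈ filt D i (a.level + 1) n ∧ IsCycle D d i n (ψ y)

variable (D) in
/-- The conditions on the `n`-th differentials `e` of the resolutions of all modules `M i`, in terms
of the preceding differentials. -/
structure IsGoodAt (n : ℕ) (d : ∀ n i, GrHom (D.term i (n + 1)) (D.term i n))
    (e : ∀ i, GrHom (D.term i (n + 1)) (D.term i n)) : Prop where
  vertex : ∀ i c, e i (inclVertex D i (n + 1) c) =
    inclVertex D i n (koszulD (D.M i) (n + 1) n c)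
  arrow : ∀ i (a : D.Arrow i) q (h : a.bideg₁ + q = n + 1),
    IsGoodOn D d i n q a ((e i).toLin ∘ₗ inclArrow a h)

theorem IsGoodAt.congr {n : ℕ} {d d' : ∀ n i, GrHom (D.term i (n + 1)) (D.term i n)}
    {e : ∀ i, GrHom (D.term i (n + 1)) (D.term i n)} (h : ∀ m < n, d m = d' m)
    (he : IsGoodAt D n d e) : IsGoodAt D n d' e := by
  refine ⟨he.vertex, fun i a q hq => ?_⟩
  have := he.arrow i a q hq
  cases q with
  | zero =>
    obtain ⟨t, m, l, x | x⟩ := a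
    · exact this
    · exact this
  | succ q =>
    intro ha y
    obtain ⟨h1, h2⟩ := this ha y
    rw [h q (by unfold Arrow.bideg₁ at ha; omega)] at h1
    refine ⟨h1, ?_⟩
    cases n with
    | zero => trivial
    | succ n =>
      have h2 : d n i _ = 0 := h2
      rw [h n n.lt_succ_self] at h2
      exact h2

section Exactness

variable {d : ∀ n i, GrHom (D.term i (n + 1)) (D.term i n)}

/-- The first term attached along an arrow is mapped to cycles of the Koszul complex of `M i`. -/
theorem IsGoodAt.exists_inclVertex {n : ℕ} (hd : IsGoodAt D n d (d n)) (a : D.Arrow i)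
    (h : a.bideg₁ + 0 = n + 1) (y : D.term a.tgt 0) :
    ∃ c, d n i (inclArrow a h y) = inclVertex D i n c ∧ koszulD (D.M i) n (n - 1) c = 0 := by
  have hm : (a.m : ℕ) = n := by unfold Arrow.bideg₁ at h; omega
  have H := hd.arrow i a 0 h
  obtain ⟨t, m, l, x | x⟩ := a
  · obtain ⟨c, z, h1, h2, -⟩ := H hm y
    refine ⟨_, h1, ?_⟩
    rw [koszulD_koszulCast _ hm (congrArg (· - 1) hm), koszulD_eq_zero_of_homologyRel h2, map_zero]
  · obtain ⟨c, z, h1, h2, -⟩ := H hm y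
    refine ⟨_, h1, ?_⟩
    rw [koszulD_koszulCast _ hm (congrArg (· - 1) hm), koszulD_eq_zero_of_homologyRel h2, map_zero]

theorem IsGoodAt.sub_mem {n : ℕ} (hd : IsGoodAt D n d (d n)) (a : D.Arrow i) {q : ℕ}
    (h : a.bideg₁ + q = n) (h' : a.bideg₁ + (q + 1) = n + 1) (y : D.term a.tgt (q + 1)) :
    d n i (inclArrow a h' y) - inclArrow a h (d q a.tgt y) ∈ filt D i (a.level + 1) n :=
  (hd.arrow i a (q + 1) h' h y).1

theorem IsGoodAt.map_filt {n : ℕ} (hd : IsGoodAt D n d (d n)) {s : ℕ} {y : D.term i (n + 1)}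
    (hy : y ∈ filt D i s (n + 1)) : d n i y ∈ filt D i s n := by
  refine filt_induction (p := fun y => d n i y ∈ filt D i s n) ?_ ?_ ?_ ?_ hy
  · rw [map_zero]; exact Submodule.zero_mem _
  · intro x y hx hy; rw [map_add]; exact Submodule.add_mem _ hx hy
  · intro c; rw [hd.vertex]; exact inclVertex_mem_filt _ _ _
  · intro a ha q h y
    cases q with
    | zero =>
      obtain ⟨c, hc, -⟩ := hd.exists_inclVertex a h y
      rw [hc]; exact inclVertex_mem_filt _ _ _
    | succ q =>
      have h1 := hd.sub_mem a (q := q) (by omega) h y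
      have h2 := inclArrow_mem_filt a ha (q := q) (n := n) (by omega) (d q a.tgt y)
      have := Submodule.add_mem _ (filt_antitone (by omega) h1) h2
      rwa [sub_add_cancel] at this

/-- On the filtration step `a.level`, the projection to the copy of the resolution of `M a.tgt`
given by `a` commutes with the differentials. -/
theorem IsGoodAt.compArrow_map {n : ℕ} (hd : IsGoodAt D n d (d n)) (a : D.Arrow i) {q : ℕ}
    (h : a.bideg₁ + q = n) (h' : a.bideg₁ + (q + 1) = n + 1) {y : D.term i (n + 1)}
    (hy : y ∈ filt D i a.level (n + 1)) :
    compArrow a h (d n i y) = d q a.tgt (compArrow a h' y) := by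
  refine filt_induction
    (p := fun y => compArrow a h (d n i y) = d q a.tgt (compArrow a h' y)) ?_ ?_ ?_ ?_ hy
  · simp only [map_zero]
  · intro x y hx hy; simp only [map_add, hx, hy]
  · intro c; rw [hd.vertex, compArrow_inclVertex, compArrow_inclVertex, map_zero]
  · intro b hb r hr y
    cases r with
    | zero =>
      obtain ⟨c, hc, -⟩ := hd.exists_inclVertex b hr y
      rw [hc, compArrow_inclVertex, compArrow_inclArrow_of_ne, map_zero]
      rintro rfl
      omega
    | succ r =>
      have h1 := hd.sub_mem b (q := r) (by omega) hr y
      have h2 := h1 a q h (by omega)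
      rw [map_sub, sub_eq_zero] at h2
      rw [h2]
      by_cases hab : b = a
      · subst hab
        obtain rfl : r = q := by omega
        rw [compArrow_inclArrow, compArrow_inclArrow]
      · rw [compArrow_inclArrow_of_ne hab, compArrow_inclArrow_of_ne hab, map_zero]

theorem IsGoodAt.map_map {n : ℕ} (hn : IsGoodAt D n d (d n)) (hd : IsGoodAt D (n + 1) d (d (n + 1)))
    (y : D.term i (n + 2)) : d n i (d (n + 1) i y) = 0 := by
  refine filt_induction (p := fun y => d n i (d (n + 1) i y) = 0) ?_ ?_ ?_ ?_ (filt_zero _ y)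
  · simp only [map_zero]
  · intro x y hx hy; simp only [map_add, hx, hy, add_zero]
  · intro c; rw [hd.vertex, hn.vertex, koszulD_comp_koszulD, map_zero]
  · intro a _ q h y
    cases q with
    | zero =>
      obtain ⟨c, hc, hc'⟩ := hd.exists_inclVertex a h y
      rw [hc, hn.vertex]
      exact (congrArg _ hc').trans (map_zero _)
    | succ q => exact (hd.arrow i a (q + 1) h (by omega) y).2

end Exactness

end ResolvingDatum

/-! ### Exactness -/

namespace ResolvingDatum

variable {k : Type u} [Field k] {A : Type u} [Ring A] [Algebra k A]
  {𝒜 : ℕ → Submodule k A} [GradedAlgebra 𝒜] [FiniteDimensional k (𝒜 1)] {D : ResolvingDatum 𝒜}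
  {i : Fin (D.N + 1)}

open GrMod

/-- The arrow of `Ar'` with a given index. -/
abbrev arrowL (m : ℕ+) (x : Σ (j : Fin (D.N + 1)) (ℓ : ℕ+), Fin (D.h i j m ℓ).1) : D.Arrow i :=
  ⟨x.1, m, x.2.1, .inl x.2.2⟩

/-- The arrow of `Ar''` with a given index. -/
abbrev arrowR (m : ℕ+) (x : Σ (j : Fin (D.N + 1)) (ℓ : ℕ+), Fin (D.h i j m ℓ).2) : D.Arrow i :=
  ⟨x.1, m, x.2.1, .inr x.2.2⟩

theorem bideg_arrowL (m : ℕ+) (x : Σ (j : Fin (D.N + 1)) (ℓ : ℕ+), Fin (D.h i j m ℓ).1) :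
    (arrowL m x).bideg₁ + 0 = m + 1 := rfl

theorem bideg_arrowR (m : ℕ+) (x : Σ (j : Fin (D.N + 1)) (ℓ : ℕ+), Fin (D.h i j m ℓ).2) :
    (arrowR m x).bideg₁ + 0 = m + 1 := rfl

theorem level_arrowL (m : ℕ+) (x : Σ (j : Fin (D.N + 1)) (ℓ : ℕ+), Fin (D.h i j m ℓ).1) :
    (arrowL m x).level = 2 * m + 1 := rfl

theorem level_arrowR (m : ℕ+) (x : Σ (j : Fin (D.N + 1)) (ℓ : ℕ+), Fin (D.h i j m ℓ).2) :
    (arrowR m x).level = 2 * m := rfl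

theorem arrow_cases (a : D.Arrow i) {m : ℕ+} (hm : a.m = m) :
    (∃ x, a = arrowL m x) ∨ ∃ x, a = arrowR m x := by
  subst hm
  obtain ⟨t, m, l, x | x⟩ := a
  · exact Or.inl ⟨⟨t, l, x⟩, rfl⟩
  · exact Or.inr ⟨⟨t, l, x⟩, rfl⟩

theorem level_le (a : D.Arrow i) : a.level ≤ 2 * (a.m : ℕ) + 1 := by
  unfold Arrow.level
  split_ifs <;> omega

theorem arrowL_injective (m : ℕ+) : Function.Injective (arrowL (D := D) (i := i) m) := by
  rintro ⟨t, l, x⟩ ⟨t', l', x'⟩ h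
  injection h with h1 _ h2 h3
  subst h1 h2
  cases h3
  rfl

theorem arrowR_injective (m : ℕ+) : Function.Injective (arrowR (D := D) (i := i) m) := by
  rintro ⟨t, l, x⟩ ⟨t', l', x'⟩ h
  injection h with h1 _ h2 h3
  subst h1 h2
  cases h3
  rfl

variable {d : ∀ n i, GrHom (D.term i (n + 1)) (D.term i n)}

/-- On the part of the filtration with the arrows of `Ar'` the connecting map to the homology of
the Koszul complex is given by the map `f` of the resolving datum. -/
theorem IsGoodAt.exists_class_left (m : ℕ+) (hd : IsGoodAt D m d (d m)) {y : D.term i (m + 1)}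
    (hy : y ∈ filt D i (2 * m + 1) (m + 1)) : ∃ c e, d m i y = inclVertex D i m c ∧
      (c, D.f i m e) ∈ homologyRel (D.M i) m ∧
      ∀ x, sumComp D _ x e = aug D x.1 (compArrow (arrowL m x) (bideg_arrowL m x) y) := by
  refine filt_induction (p := fun y => ∃ c e, d m i y = inclVertex D i m c ∧
      (c, D.f i m e) ∈ homologyRel (D.M i) m ∧
      ∀ x, sumComp D _ x e = aug D x.1 (compArrow (arrowL m x) (bideg_arrowL m x) y)) ?_ ?_ ?_ ?_ hy
  · refine ⟨0, 0, ?_, ?_, fun x => ?_⟩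
    · simp only [map_zero]
    · rw [map_zero]; exact Submodule.zero_mem _
    · simp only [map_zero]
  · rintro y y' ⟨c, e, h1, h2, h3⟩ ⟨c', e', h1', h2', h3'⟩
    refine ⟨c + c', e + e', ?_, ?_, fun x => ?_⟩
    · simp only [map_add, h1, h1']
    · rw [map_add]; exact Submodule.add_mem _ h2 h2'
    · simp only [map_add, h3, h3']
  · intro c
    refine ⟨_, 0, hd.vertex i c, ?_, fun x => ?_⟩
    · rw [map_zero]; exact koszulD_mem_homologyRel c
    · rw [map_zero, compArrow_inclVertex, map_zero]
  · intro a ha q h y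
    have hb : (a.m : ℕ) + 1 + q = m + 1 := h
    have hle := level_le a
    have hm : a.m = m := PNat.eq (by omega)
    obtain rfl : q = 0 := by rw [hm] at hb; omega
    obtain ⟨x, rfl⟩ | ⟨x, rfl⟩ := arrow_cases a hm
    · obtain ⟨c, z, h1, h2, rfl⟩ := hd.arrow i (arrowL m x) 0 h rfl y
      refine ⟨c, _, h1, h2, fun x' => ?_⟩
      by_cases hx : x = x'
      · subst hx
        rw [compArrow_inclArrow]
        exact sumComp_sumIncl _ _
      · rw [compArrow_inclArrow_of_ne fun e => hx (arrowL_injective m e), map_zero]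
        exact sumComp_sumIncl_of_ne hx _
    · rw [level_arrowR] at ha
      omega

/-- On the part of the filtration with the arrows of `Ar'` and `Ar''` the connecting map to the
homology of the Koszul complex is described after composition with the map `g` of the resolving
datum: the arrows of `Ar'` do not contribute, as `g ∘ f = 0`. -/
theorem IsGoodAt.exists_class_right (m : ℕ+) (hd : IsGoodAt D m d (d m)) {y : D.term i (m + 1)}
    (hy : y ∈ filt D i (2 * m) (m + 1)) : ∃ c z, d m i y = inclVertex D i m c ∧
      (c, z) ∈ homologyRel (D.M i) m ∧
      ∀ x, sumComp D _ x (D.g i m z) = aug D x.1 (compArrow (arrowR m x) (bideg_arrowR m x) y) := by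
  refine filt_induction (p := fun y => ∃ c z, d m i y = inclVertex D i m c ∧
      (c, z) ∈ homologyRel (D.M i) m ∧
      ∀ x, sumComp D _ x (D.g i m z) = aug D x.1 (compArrow (arrowR m x) (bideg_arrowR m x) y))
      ?_ ?_ ?_ ?_ hy
  · refine ⟨0, 0, ?_, Submodule.zero_mem _, fun x => ?_⟩ <;> simp only [map_zero]
  · rintro y y' ⟨c, e, h1, h2, h3⟩ ⟨c', e', h1', h2', h3'⟩
    refine ⟨c + c', e + e', ?_, Submodule.add_mem _ h2 h2', fun x => ?_⟩
    · simp only [map_add, h1, h1']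
    · simp only [map_add, h3, h3']
  · intro c
    refine ⟨_, 0, hd.vertex i c, koszulD_mem_homologyRel c, fun x => ?_⟩
    rw [map_zero, map_zero, compArrow_inclVertex, map_zero]
  · intro a ha q h y
    have hb : (a.m : ℕ) + 1 + q = m + 1 := h
    have hle := level_le a
    have hm : a.m = m := PNat.eq (by omega)
    obtain rfl : q = 0 := by rw [hm] at hb; omega
    obtain ⟨x, rfl⟩ | ⟨x, rfl⟩ := arrow_cases a hm
    · obtain ⟨c, z, h1, h2, rfl⟩ := hd.arrow i (arrowL m x) 0 h rfl y
      refine ⟨c, _, h1, h2, fun x' => ?_⟩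
      rw [compArrow_inclArrow_of_ne (fun e => by
        have := congrArg Arrow.level e
        rw [level_arrowL, level_arrowR] at this
        omega), map_zero,
        (D.exact i m).apply_apply_eq_zero, map_zero]
    · obtain ⟨c, z, h1, h2, h3⟩ := hd.arrow i (arrowR m x) 0 h rfl y
      refine ⟨c, _, h1, h2, fun x' => ?_⟩
      rw [h3]
      by_cases hx : x = x'
      · subst hx
        rw [compArrow_inclArrow]
        exact sumComp_sumIncl _ _
      · rw [compArrow_inclArrow_of_ne fun e => hx (arrowR_injective m e), map_zero]
        exact sumComp_sumIncl_of_ne hx _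

/-- Elements of a term with prescribed components for the arrows of level `s`. -/
theorem exists_mem_filt {n s : ℕ} (Y : ∀ (a : D.Arrow i) (q : ℕ), a.bideg₁ + q = n →
    D.term a.tgt q) : ∃ y ∈ filt D i s n, ∀ a q h, a.level = s → compArrow a h y = Y a q h := by
  classical
  obtain ⟨y, hy⟩ := exists_compArrow_eq fun a q h => if a.level = s then Y a q h else 0
  refine ⟨y, fun a q h hs => ?_, fun a q h hs => ?_⟩
  · rw [hy, if_neg hs.ne]
  · rw [hy, if_pos hs]

/-- Elements of a term for which the components at the arrows of level `s` have prescribed images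
under the augmentations. -/
theorem exists_mem_filt_aug {n s : ℕ} (e : ∀ a : D.Arrow i, D.M a.tgt) :
    ∃ y ∈ filt D i s n, ∀ (a : D.Arrow i) (h : a.bideg₁ + 0 = n), a.level = s →
      aug D a.tgt (compArrow a h y) = e a := by
  choose lift hlift using fun j => aug_surjective (D := D) j
  obtain ⟨y, hy, hy'⟩ := exists_mem_filt (i := i) (n := n) (s := s) fun a q _ =>
    match q with
    | 0 => lift a.tgt (e a)
    | _ + 1 => 0
  exact ⟨y, hy, fun a h hs => by rw [hy' a 0 h hs, hlift]⟩

theorem IsGoodAt.exists_of_class_zero (m : ℕ+) (hd : IsGoodAt D m d (d m)) {c : koszul (D.M i) m}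
    (hc : (c, 0) ∈ homologyRel (D.M i) m) (s : ℕ) :
    ∃ v ∈ filt D i s (m + 1), d m i v = inclVertex D i m c := by
  obtain ⟨c', rfl⟩ := exists_koszulD_eq hc
  exact ⟨inclVertex D i _ c', inclVertex_mem_filt _ _ _, hd.vertex i c'⟩

/-- A cycle of the Koszul complex whose class is in the image of `f` is a boundary of the part of
the filtration with the arrows of `Ar'`. -/
theorem IsGoodAt.exists_of_class_left (m : ℕ+) (hd : IsGoodAt D m d (d m))
    {c : koszul (D.M i) m} {z : koszulHomology (D.M i) m}
    (hc : (c, z) ∈ homologyRel (D.M i) m) (hz : D.g i m z = 0) :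
    ∃ v ∈ filt D i (2 * m + 1) (m + 1), d m i v = inclVertex D i m c := by
  obtain ⟨e, rfl⟩ := (D.exact i m z).1 hz
  obtain ⟨y, hy, hy'⟩ : ∃ y ∈ filt D i (2 * m + 1) (m + 1), ∀ x,
      aug D x.1 (compArrow (arrowL m x) (bideg_arrowL m x) y) = sumComp D _ x e := by
    -- the components of `e` as a family indexed by all arrows; heterogeneous equality bridges the
    -- two types `D.M a.tgt` and `D.M x.1`
    have he : ∀ a : D.Arrow i, ∃ w : D.M a.tgt, ∀ x, a = arrowL m x →
        HEq w (sumComp D _ x e) := fun a => by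
      by_cases ha : ∃ x, a = arrowL m x
      · obtain ⟨x, rfl⟩ := ha
        refine ⟨sumComp D _ x e, fun x' hx => ?_⟩
        rw [arrowL_injective m hx]
      · exact ⟨0, fun x hx => absurd ⟨x, hx⟩ ha⟩
    choose w hw using he
    obtain ⟨y, hy, hy'⟩ := exists_mem_filt_aug w
    exact ⟨y, hy, fun x => (hy' _ _ (level_arrowL m x)).trans (eq_of_heq (hw _ x rfl))⟩
  obtain ⟨c', e', h1, h2, h3⟩ := hd.exists_class_left m hy
  obtain rfl : e' = e := shiftedSum_ext fun x => (h3 x).trans (hy' x)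
  have := Submodule.sub_mem _ hc h2
  rw [Prod.mk_sub_mk, sub_self] at this
  obtain ⟨v, hv, hv'⟩ := hd.exists_of_class_zero m this (2 * m + 1)
  refine ⟨v + y, Submodule.add_mem _ hv hy, ?_⟩
  rw [map_add, hv', h1, ← map_add, sub_add_cancel]

/-- Every cycle of positive degree of the Koszul complex is a boundary of the part of the filtration
with the arrows of `Ar'` and `Ar''`. -/
theorem IsGoodAt.exists_of_cycle (m : ℕ+) (hd : IsGoodAt D m d (d m)) {c : koszul (D.M i) m}
    (hc : koszulD (D.M i) m (m - 1) c = 0) :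
    ∃ v ∈ filt D i (2 * m) (m + 1), d m i v = inclVertex D i m c := by
  obtain ⟨z, hz⟩ := exists_homologyRel_of_cycle hc
  obtain ⟨y, hy, hy'⟩ : ∃ y ∈ filt D i (2 * m) (m + 1), ∀ x,
      aug D x.1 (compArrow (arrowR m x) (bideg_arrowR m x) y) = sumComp D _ x (D.g i m z) := by
    have he : ∀ a : D.Arrow i, ∃ w : D.M a.tgt, ∀ x, a = arrowR m x →
        HEq w (sumComp D _ x (D.g i m z)) := fun a => by
      by_cases ha : ∃ x, a = arrowR m x
      · obtain ⟨x, rfl⟩ := ha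
        refine ⟨sumComp D _ x (D.g i m z), fun x' hx => ?_⟩
        rw [arrowR_injective m hx]
      · exact ⟨0, fun x hx => absurd ⟨x, hx⟩ ha⟩
    choose w hw using he
    obtain ⟨y, hy, hy'⟩ := exists_mem_filt_aug w
    exact ⟨y, hy, fun x => (hy' _ _ (level_arrowR m x)).trans (eq_of_heq (hw _ x rfl))⟩
  obtain ⟨c', z', h1, h2, h3⟩ := hd.exists_class_right m hy
  have hg : D.g i m z' = D.g i m z := shiftedSum_ext fun x => (h3 x).trans (hy' x)
  have := Submodule.sub_mem _ hz h2
  rw [Prod.mk_sub_mk] at this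
  obtain ⟨v, hv, hv'⟩ := hd.exists_of_class_left m this (by rw [map_sub, hg, sub_self])
  refine ⟨v + y, Submodule.add_mem _ (filt_antitone (by omega) hv) hy, ?_⟩
  rw [map_add, hv', h1, ← map_add, sub_add_cancel]

theorem IsGoodAt.exact_zero (hd : IsGoodAt D 0 d (d 0)) {x : D.term i 0} (hx : aug D i x = 0) :
    ∃ y, d 0 i y = x := by
  obtain ⟨c, rfl⟩ := exists_inclVertex_eq (s := 0) le_rfl (filt_zero 0 x)
  rw [aug_inclVertex] at hx
  obtain ⟨c', hc'⟩ := (exact_koszulMap_koszulAug (D.quadratic i) c).1 hx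
  refine ⟨inclVertex D i 1 c', (hd.vertex i c').trans ?_⟩
  rw [koszulD_succ]
  exact congrArg _ hc'

/-- The filtration steps `filt D i s` have no homology in degrees `n + 1 ≥ s / 2`, provided that the
resolutions of all `M j` are exact in smaller degrees. -/
theorem exact_filt {n : ℕ} (hd : ∀ m ≤ n + 1, IsGoodAt D m d (d m))
    (ih : ∀ m < n, ∀ j (x : D.term j (m + 1)), d m j x = 0 → ∃ y, d (m + 1) j y = x)
    {s : ℕ} (hs : s ≤ 2 * (n + 1)) {u : D.term i (n + 1)} (hu : u ∈ filt D i s (n + 1))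
    (hu' : d n i u = 0) : ∃ v ∈ filt D i s (n + 2), d (n + 1) i v = u := by
  obtain ⟨t, ht⟩ : ∃ t, s + t = 2 * (n + 1) := ⟨_, Nat.add_sub_cancel' hs⟩
  induction t generalizing s u with
  | zero =>
    obtain rfl : s = 2 * (n + 1) := by omega
    obtain ⟨c, rfl⟩ := exists_inclVertex_eq le_rfl hu
    rw [(hd n n.le_succ).vertex] at hu'
    have hc : koszulD (D.M i) (n + 1) n c = 0 :=
      inclVertex_injective n (hu'.trans (map_zero _).symm)
    exact (hd (n + 1) le_rfl).exists_of_cycle n.succPNat hc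
  | succ t iht =>
    -- the components of `u` at the arrows of level `s` are boundaries
    have hY : ∀ (a : D.Arrow i) (q : ℕ) (h : a.bideg₁ + q = n + 1), ∃ y : D.term a.tgt (q + 1),
        a.level = s → d q a.tgt y = compArrow a h u := by
      intro a q h
      have hab : (a.m : ℕ) + 1 + q = n + 1 := h
      have hpos := a.m.pos
      by_cases has : a.level = s
      swap
      · exact ⟨0, fun h => absurd h has⟩
      subst has
      suffices ∃ y, d q a.tgt y = compArrow a h u from this.imp fun _ h _ => h
      cases q with
      | zero =>
        -- the image of `u` has zero homology class, hence so has the augmentation of the component: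
        -- for `Ar'` because `f` is injective, for `Ar''` by definition of `g`
        refine (hd 0 (Nat.zero_le _)).exact_zero ?_
        obtain ⟨t', m, l, x | x⟩ := a
        · obtain rfl : n = m := by change (m : ℕ) + 1 + 0 = n + 1 at hab; omega
          obtain ⟨c, e, h1, h2, h3⟩ := (hd m m.1.le_succ).exists_class_left m hu
          rw [hu'] at h1
          obtain rfl : c = 0 := inclVertex_injective _ (h1.symm.trans (map_zero _).symm)
          have he : e = 0 := D.injective i m ((eq_zero_of_homologyRel h2).trans (map_zero _).symm)
          rw [he] at h3
          exact (h3 ⟨t', l, x⟩).symm.trans (map_zero _)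
        · obtain rfl : n = m := by change (m : ℕ) + 1 + 0 = n + 1 at hab; omega
          obtain ⟨c, z, h1, h2, h3⟩ := (hd m m.1.le_succ).exists_class_right m hu
          rw [hu'] at h1
          obtain rfl : c = 0 := inclVertex_injective _ (h1.symm.trans (map_zero _).symm)
          rw [eq_zero_of_homologyRel h2, map_zero] at h3
          exact (h3 ⟨t', l, x⟩).symm.trans (map_zero _)
      | succ q =>
        refine ih q (by omega) a.tgt _ ?_
        rw [← (hd n n.le_succ).compArrow_map a (by omega) h hu, hu', map_zero]
    choose Y hY using hY
    obtain ⟨v, hv, hv'⟩ := exists_mem_filt (i := i) (n := n + 2) (s := s) fun a q h =>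
      match q, h with
      | 0, _ => 0
      | q + 1, h => Y a q (by omega)
    -- subtracting the boundary of `v` raises the filtration of `u` by one
    have hdv : u - d (n + 1) i v ∈ filt D i (s + 1) (n + 1) := by
      intro a q h hs
      rw [map_sub, sub_eq_zero]
      rcases Nat.lt_succ_iff_lt_or_eq.1 hs with has | has
      · rw [hu a q h has, (hd _ le_rfl).map_filt hv a q h has]
      · rw [(hd _ le_rfl).compArrow_map a h (by omega) (has ▸ hv), hv' a _ _ has, hY a q h has]
    obtain ⟨w, hw, hw'⟩ := iht (s := s + 1) (by omega) hdv (by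
      rw [map_sub, hu', (hd n n.le_succ).map_map (hd _ le_rfl), sub_zero]) (by omega)
    refine ⟨w + v, Submodule.add_mem _ (filt_antitone s.le_succ hw) hv, ?_⟩
    rw [map_add, hw', sub_add_cancel]

/-- The complexes given by the differentials `d` are exact in positive degrees, by induction on the
degree. An arrow has `bideg₁` at least two, so that `exact_filt` only refers to smaller degrees. -/
theorem exact_of_isGoodAt {n : ℕ} (hd : ∀ m ≤ n + 1, IsGoodAt D m d (d m)) (j)
    {x : D.term j (n + 1)} (hx : d n j x = 0) : ∃ y, d (n + 1) j y = x := by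
  induction n using Nat.strong_induction_on generalizing j with
  | _ n ih =>
    obtain ⟨y, -, hy⟩ := exact_filt hd (fun m hm j x hx =>
      ih m hm (fun l hl => hd l (by omega)) j hx) (Nat.zero_le _) (filt_zero _ x) hx
    exact ⟨y, hy⟩

end ResolvingDatum

/-! ### Existence of the differentials -/

namespace ResolvingDatum

variable {k : Type u} [Field k] {A : Type u} [Ring A] [Algebra k A]
  {𝒜 : ℕ → Submodule k A} [GradedAlgebra 𝒜] [FiniteDimensional k (𝒜 1)] {D : ResolvingDatum 𝒜}
  {i : Fin (D.N + 1)}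

open GrMod

variable {d : ∀ n i, GrHom (D.term i (n + 1)) (D.term i n)}

theorem IsGoodAt.aug_map (hd : IsGoodAt D 0 d (d 0)) (y : D.term i 1) : aug D i (d 0 i y) = 0 := by
  refine filt_induction (p := fun y => aug D i (d 0 i y) = 0) ?_ ?_ ?_ ?_ (filt_zero 1 y)
  · simp only [map_zero]
  · intro x y hx hy; simp only [map_add, hx, hy, add_zero]
  · intro c
    refine (congrArg (aug D i) (hd.vertex i c)).trans ?_
    rw [aug_inclVertex, koszulD_succ]
    exact (exact_koszulMap_koszulAug (D.quadratic i)).apply_apply_eq_zero c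
  · intro a _ q h
    have := a.m.pos
    change (a.m : ℕ) + 1 + q = 1 at h
    omega

/-- The obstruction to extending the differentials along the summand given by an arrow `a` vanishes:
the cycle `d (inclArrow a _ (d p))` is a boundary of the part of the filtration above `a`. -/
theorem exists_correction {n : ℕ} (hd : ∀ m < n + 1, IsGoodAt D m d (d m)) (a : D.Arrow i) {q : ℕ}
    (h : a.bideg₁ + q = n + 1) (p : D.term a.tgt (q + 1)) :
    ∃ v ∈ filt D i (a.level + 1) (n + 1), d n i v = d n i (inclArrow a h (d q a.tgt p)) := by
  have hab : (a.m : ℕ) + 1 + q = n + 1 := h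
  cases q with
  | zero =>
    -- `d p` augments to zero, so the image of `inclArrow a h (d p)` has class zero for `Ar'`, and
    -- class in the image of `f` for `Ar''`
    have haug := (hd 0 n.succ_pos).aug_map p
    have hdn := hd n n.lt_succ_self
    obtain ⟨t, m, l, x | x⟩ := a
    · obtain rfl : n = m := by change (m : ℕ) + 1 + 0 = n + 1 at hab; omega
      obtain ⟨c, z, h1, h2, h3⟩ := hdn.arrow i _ 0 h rfl (d 0 t p)
      rw [haug, map_zero, map_zero] at h3
      subst h3
      obtain ⟨v, hv, hv'⟩ := hdn.exists_of_class_zero m h2 _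
      exact ⟨v, hv, hv'.trans h1.symm⟩
    · obtain rfl : n = m := by change (m : ℕ) + 1 + 0 = n + 1 at hab; omega
      obtain ⟨c, z, h1, h2, h3⟩ := hdn.arrow i _ 0 h rfl (d 0 t p)
      rw [haug, map_zero] at h3
      obtain ⟨v, hv, hv'⟩ := hdn.exists_of_class_left m h2 h3
      exact ⟨v, hv, hv'.trans h1.symm⟩
  | succ q =>
    -- `d (inclArrow a h (d p))` agrees with `inclArrow a _ (d (d p)) = 0` up to higher filtration
    have hpos := a.m.pos
    have hle := level_le a
    obtain ⟨n, rfl⟩ : ∃ n', n = n' + 1 := ⟨n - 1, by omega⟩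
    have h1 := (hd (n + 1) (by omega)).sub_mem a (q := q) (by omega) h (d (q + 1) a.tgt p)
    rw [(hd q (by omega)).map_map (hd (q + 1) (by omega)), map_zero, sub_zero] at h1
    exact exact_filt (fun m hm => hd m (by omega))
      (fun m hm j x hx => exact_of_isGoodAt (fun l hl => hd l (by omega)) j hx) (by omega) h1
      ((hd n (by omega)).map_map (hd (n + 1) (by omega)) _)

/-- The restriction of the next differential to the summand given by an arrow exists. -/
theorem exists_isGoodOn {n : ℕ} (hd : ∀ m < n, IsGoodAt D m d (d m)) (a : D.Arrow i) {q : ℕ}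
    (h : a.bideg₁ + q = n + 1) : ∃ ψ : D.term a.tgt q →ₗ[Aᵐᵒᵖ] D.term i n,
      (∀ (e : ℤ) (x : D.term a.tgt q), x ∈ (D.term a.tgt q).deg (-(a.bideg₂ : ℤ) + e) →
        ψ x ∈ (D.term i n).deg e) ∧ IsGoodOn D d i n q a ψ := by
  have hab : (a.m : ℕ) + 1 + q = n + 1 := h
  have hpos := a.m.pos
  cases q with
  | zero =>
    obtain ⟨t, m, l, x | x⟩ := a
    · obtain rfl : n = m := by change (m : ℕ) + 1 + 0 = n + 1 at hab; omega
      obtain ⟨ψ, h1, h2⟩ := (hasSelection_term t 0).exists_lift_homology (X := D.term i m)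
        (-((l : ℕ) : ℤ)) (⟨LinearMap.id, fun _ _ h => h⟩ : GrHom (koszulHomology (D.M i) m) _)
        Function.surjective_id ((D.f i m).toLin ∘ₗ sumIncl D _ ⟨t, l, x⟩ ∘ₗ aug D t)
        (fun e p hp => (D.f i m).map_deg _ _ (sumIncl_mem_deg _ (aug_mem_deg hp)))
        (inclVertex D i m) (fun e c hc => inclVertex_mem_deg hc)
      exact ⟨ψ, h1, fun _ y => h2 y⟩
    · obtain rfl : n = m := by change (m : ℕ) + 1 + 0 = n + 1 at hab; omega
      obtain ⟨ψ, h1, h2⟩ := (hasSelection_term t 0).exists_lift_homology (X := D.term i m)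
        (-((l : ℕ) : ℤ)) (D.g i m) (D.surjective i m) (sumIncl D _ ⟨t, l, x⟩ ∘ₗ aug D t)
        (fun e p hp => sumIncl_mem_deg _ (aug_mem_deg hp))
        (inclVertex D i m) (fun e c hc => inclVertex_mem_deg hc)
      exact ⟨ψ, h1, fun _ y => h2 y⟩
  | succ q =>
    obtain ⟨n, rfl⟩ : ∃ n', n = n' + 1 := ⟨n - 1, by omega⟩
    have h' : a.bideg₁ + q = n + 1 := by omega
    let θ := inclArrow a h' ∘ₗ (d q a.tgt).toLin
    -- the pairs `(p, x)` for which `x` is a cycle and agrees with `θ p` up to higher filtration;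
    -- for homogeneous `p`, correct `θ p` by the homogeneous component of a solution `v` of `d v = d
    -- (θ p)`
    obtain ⟨ψ, h1, h2⟩ := (hasSelection_term a.tgt (q + 1)).exists_linearMap (X := D.term i (n + 1))
      (-(a.bideg₂ : ℤ)) ((filt D i (a.level + 1) (n + 1)).comap
        (LinearMap.snd Aᵐᵒᵖ _ _ - θ ∘ₗ LinearMap.fst Aᵐᵒᵖ _ _) ⊓
        LinearMap.ker ((d n i).toLin ∘ₗ LinearMap.snd Aᵐᵒᵖ _ _)) (fun e p hp => by
          obtain ⟨v, hv, hv'⟩ := exists_correction hd a h' p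
          have hθ : θ p ∈ (D.term i (n + 1)).deg e :=
            inclArrow_mem_deg a h' ((d q a.tgt).map_deg _ _ hp)
          refine ⟨θ p - (D.term i (n + 1)).proj e v,
            Submodule.sub_mem _ hθ (proj_mem _ _ _), ?_, ?_⟩
          · change (θ p - (D.term i (n + 1)).proj e v) - θ p ∈ filt D i (a.level + 1) (n + 1)
            rw [sub_sub_cancel_left]
            exact Submodule.neg_mem _ (proj_mem_filt hv e)
          · change d n i (θ p - (D.term i (n + 1)).proj e v) = 0
            have hv'' : d n i v = d n i (θ p) := hv'
            rw [map_sub, proj_map, hv'', ← proj_map, proj_of_mem _ _ _ hθ, sub_self])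
    exact ⟨ψ, h1, fun _ y => h2 y⟩

theorem IsGoodOn.congr {n q : ℕ} {a : D.Arrow i} {ψ ψ' : D.term a.tgt q →ₗ[Aᵐᵒᵖ] D.term i n}
    (h : ∀ x : D.term a.tgt q, ψ x = ψ' x) (H : IsGoodOn D d i n q a ψ) : IsGoodOn D d i n q a ψ' :=
  (LinearMap.ext h : ψ = ψ') ▸ H

theorem exists_isGoodAt_of_vertex {n : ℕ} (hd : ∀ m < n, IsGoodAt D m d (d m))
    (i : Fin (D.N + 1)) : ∃ e : GrHom (D.term i (n + 1)) (D.term i n),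
      (∀ c : koszul (D.M i) (n + 1), e (inclVertex D i (n + 1) c) =
        inclVertex D i n (koszulD (D.M i) (n + 1) n c)) ∧
      ∀ (a : D.Arrow i) (q : ℕ) (h : a.bideg₁ + q = n + 1),
        IsGoodOn D d i n q a (e.toLin ∘ₗ inclArrow a h) := by
  have H : ∀ (a : D.Arrow i) (q : ℕ) (h : a.bideg₁ + q = n + 1),
      ∃ ψ : D.term a.tgt q →ₗ[Aᵐᵒᵖ] D.term i n,
      (∀ (e : ℤ) (x : D.term a.tgt q), x ∈ (D.term a.tgt q).deg (-(a.bideg₂ : ℤ) + e) →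
        ψ x ∈ (D.term i n).deg e) ∧ IsGoodOn D d i n q a ψ := fun a q h => exists_isGoodOn hd a h
  choose ψ hψ hψ' using H
  let φ : GrHom (koszul (D.M i) (n + 1)) (D.term i n) :=
    ⟨inclVertex D i n ∘ₗ (koszulD (D.M i) (n + 1) n).toLin,
      fun d x hx => inclVertex_mem_deg ((koszulD (D.M i) (n + 1) n).map_deg d x hx)⟩
  obtain ⟨e, he, he'⟩ := exists_grHom (X := D.term i n) φ ψ hψ
  exact ⟨e, he, fun a q h => (hψ' a q h).congr fun x => (he' a q h x).symm⟩

theorem exists_isGoodAt {n : ℕ} (hd : ∀ m < n, IsGoodAt D m d (d m)) :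
    ∃ e : ∀ i, GrHom (D.term i (n + 1)) (D.term i n), IsGoodAt D n d e := by
  choose e he he' using exists_isGoodAt_of_vertex hd
  exact ⟨e, he, he'⟩

/-- Simultaneous construction of the differentials of the resolutions of all `M i`. -/
theorem exists_forall_isGoodAt (D : ResolvingDatum 𝒜) :
    ∃ d : ∀ n i, GrHom (D.term i (n + 1)) (D.term i n), ∀ n, IsGoodAt D n d (d n) := by
  have : ∀ n, Nonempty (∀ i, GrHom (D.term i (n + 1)) (D.term i n)) :=
    fun n => ⟨fun i => GrHom.zero _ _⟩
  exact exists_sequence (X := fun n => ∀ i, GrHom (D.term i (n + 1)) (D.term i n))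
    (fun n d e => IsGoodAt D n d e) (fun n d d' e h he => he.congr h)
    (fun n d hd => exists_isGoodAt hd)

theorem isBoundedBelow_term (i : Fin (D.N + 1)) (n : ℕ) : (D.term i n).IsBoundedBelow := by
  refine isBoundedBelow_directSum (X := D.summand i n) 0 fun α e he => ?_
  exact free_deg_eq_bot (s := ((n - α.1.bideg₁ : ℕ) : ℤ)) (d := -(α.1.bideg₂ : ℤ) + e) (by omega)

theorem isProjective_term (i : Fin (D.N + 1)) (n : ℕ) : (D.term i n).IsProjective := by
  exact (hasSelection_term i n).isProjective (isBoundedBelow_term i n)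

theorem isProjectiveResolution (hd : ∀ n, IsGoodAt D n d (d n)) (i : Fin (D.N + 1)) :
    IsProjectiveResolution (D.term i) (fun n => d n i) (D.M i)
      ⟨aug D i, fun _ _ hx => aug_mem_deg hx⟩ where
  projective := isProjective_term i
  surjective := aug_surjective i
  exact_zero _ := ⟨(hd 0).exact_zero, by rintro ⟨y, rfl⟩; exact (hd 0).aug_map y⟩
  exact_succ n _ := ⟨exact_of_isGoodAt (fun m _ => hd m) i,
    by rintro ⟨y, rfl⟩; exact (hd n).map_map (hd (n + 1)) y⟩

end ResolvingDatum

/-! ### The iterated cone structure and minimality -/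

namespace ResolvingDatum

variable {k : Type u} [Field k] {A : Type u} [Ring A] [Algebra k A]
  {𝒜 : ℕ → Submodule k A} [GradedAlgebra 𝒜] [FiniteDimensional k (𝒜 1)] {D : ResolvingDatum 𝒜}
  {i : Fin (D.N + 1)}

open GrMod

variable {d : ∀ n i, GrHom (D.term i (n + 1)) (D.term i n)}

theorem inclPath_consPath (a : D.Arrow i) {q n : ℕ} (h : a.bideg₁ + q = n) (p)
    (x : koszul (D.M (consPath a h p).1.tgt) (n - (consPath a h p).1.bideg₁)) :
    inclPath (consPath a h p) x =
      inclArrow a h (inclPath p (koszulCast (D.M p.1.tgt) (sub_bideg_eq a h p.1).symm x)) :=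
  (congrArg (inclPath (consPath a h p)) (koszulCast_koszulCast (D.M p.1.tgt)
    (sub_bideg_eq a h p.1).symm (sub_bideg_eq a h p.1) x).symm).trans
    (inclArrow_inclPath a h p _).symm

/-- An arrow which is not smaller than `b` has at least the level of `b`. -/
theorem level_le_level {a b : D.Arrow i} (h : ¬ (a.bideg₁ < b.bideg₁ ∨ a.Lt b)) :
    b.level ≤ a.level := by
  rw [not_or, not_lt] at h
  obtain ⟨h1, h2⟩ := h
  obtain ⟨t, m, l, x⟩ := a
  obtain ⟨t', m', l', x'⟩ := b
  replace h1 : (m' : ℕ) + 1 ≤ m + 1 := h1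
  have h2 : ¬ ((m : ℕ) + 1 = m' + 1 ∧ x.isRight = true ∧ x'.isLeft = true) := h2
  change 2 * (m' : ℕ) + (if x'.isLeft then 1 else 0) ≤ 2 * (m : ℕ) + (if x.isLeft then 1 else 0)
  cases x <;> cases x' <;>
    simp only [Sum.isLeft_inl, Sum.isLeft_inr, Sum.isRight_inl, Sum.isRight_inr, reduceIte,
      Bool.false_eq_true, and_true, and_false] at h2 ⊢ <;> omega

/-- The diagonal components of the differential are Koszul differentials: removing the common first
arrow reduces this to the path of length zero. -/
theorem compPath_map_inclPath_self (hd : ∀ n, IsGoodAt D n d (d n)) {n : ℕ} (α : D.Path i)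
    (hα : α.bideg₁ ≤ n) (x : koszul (D.M α.tgt) (n + 1 - α.bideg₁)) :
    compPath ⟨α, hα⟩ (d n i (inclPath ⟨α, hα.trans n.le_succ⟩ x)) =
      koszulD (D.M α.tgt) (n + 1 - α.bideg₁) (n - α.bideg₁) x := by
  induction α generalizing n with
  | vertex i =>
    have := congrArg (compVertex D i n) ((hd n).vertex i x)
    rw [compVertex_inclVertex] at this
    exact this
  | @cons i a p ih =>
    have hα' : a.bideg₁ + p.bideg₁ ≤ n := hα
    obtain ⟨q, h⟩ : ∃ q, a.bideg₁ + q = n := ⟨n - a.bideg₁, by omega⟩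
    have hq : p.bideg₁ ≤ q := by omega
    have h' : a.bideg₁ + (q + 1) = n + 1 := by omega
    have e := sub_bideg_eq a h' p
    have e' := sub_bideg_eq a h p
    have h1 := inclPath_consPath a h' ⟨p, hq.trans q.le_succ⟩ x
    have h2 := ih hq (koszulCast (D.M p.tgt) e.symm x)
    refine (congrArg (fun y => compPath (consPath a h ⟨p, hq⟩) (d n i y)) h1).trans ?_
    rw [compPath_consPath, ← compPath_compArrow, (hd n).compArrow_map a h h'
      (inclArrow_mem_filt a le_rfl h' _), compArrow_inclArrow]
    refine (congrArg (koszulCast (D.M p.tgt) e') h2).trans ?_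
    exact (koszulD_koszulCast (D.M p.tgt) e e' _).symm.trans
      (congrArg _ (koszulCast_koszulCast (D.M p.tgt) e.symm e x))

/-- The component of the differential from `α` to `β ≠ α` vanishes unless `α < β`: by
`compArrow_map`, it vanishes if the first arrows differ, and is a component of the differential for
the target of the first arrow if they agree. -/
theorem compPath_map_inclPath_eq_zero (hd : ∀ n, IsGoodAt D n d (d n)) {n : ℕ} (α : D.Path i)
    (hα : α.bideg₁ ≤ n + 1) (β : D.Path i) (hβ : β.bideg₁ ≤ n) (hne : α ≠ β)
    (hlt : ¬ Path.Lt α β) (x : koszul (D.M α.tgt) (n + 1 - α.bideg₁)) :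
    compPath ⟨β, hβ⟩ (d n i (inclPath ⟨α, hα⟩ x)) = 0 := by
  induction α generalizing n with
  | vertex i =>
    cases β with
    | vertex => exact absurd rfl hne
    | cons b r =>
      have hβ' : b.bideg₁ + r.bideg₁ ≤ n := hβ
      obtain ⟨q, h⟩ : ∃ q, b.bideg₁ + q = n := ⟨n - b.bideg₁, by omega⟩
      refine (congrArg (compPath (consPath b h ⟨r, by omega⟩)) ((hd n).vertex i x)).trans ?_
      rw [compPath_consPath, compCons_inclVertex]
      exact map_zero _
  | @cons i a p ih =>
    cases β with
    | vertex => exact absurd (.vertex a p) hlt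
    | cons b r =>
      have hα' : a.bideg₁ + p.bideg₁ ≤ n + 1 := hα
      have hβ' : b.bideg₁ + r.bideg₁ ≤ n := hβ
      obtain ⟨q, h⟩ : ∃ q, b.bideg₁ + q = n := ⟨n - b.bideg₁, by omega⟩
      obtain ⟨q', h'⟩ : ∃ q', a.bideg₁ + q' = n + 1 := ⟨n + 1 - a.bideg₁, by omega⟩
      have h1 := inclPath_consPath a h' ⟨p, by omega⟩ x
      refine (congrArg (fun y => compPath (consPath b h ⟨r, by omega⟩) (d n i y)) h1).trans ?_
      rw [compPath_consPath, ← compPath_compArrow, (hd n).compArrow_map b h (q := q) (by omega)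
        (inclArrow_mem_filt a (level_le_level fun hab =>
          hlt (hab.elim (.bideg a b p r) (.arrow a b p r))) h' _)]
      by_cases hab : a = b
      · subst hab
        obtain rfl : q' = q + 1 := by omega
        rw [compArrow_inclArrow]
        refine (congrArg _ (ih (n := q) _ r _ (fun e => hne (e ▸ rfl))
          (fun hpr => hlt (.cons a p r hpr)) _)).trans (map_zero _)
      · rw [compArrow_inclArrow_of_ne hab, map_zero, map_zero]
        exact map_zero _

theorem isIteratedCone (hd : ∀ n, IsGoodAt D n d (d n)) (i : Fin (D.N + 1)) :
    D.IsIteratedCone i (fun n => d n i) where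
  diag _ α hα := LinearMap.ext fun x => compPath_map_inclPath_self hd α hα x
  triangular _ α β hne hlt := LinearMap.ext fun x =>
    compPath_map_inclPath_eq_zero hd α.1 α.2 β.1 β.2 hne hlt x

theorem compPath_map_inclPath_mem_deg {n : ℕ} (e : GrHom (D.term i (n + 1)) (D.term i n))
    (α : D.Path i) (hα : α.bideg₁ ≤ n + 1) (β : D.Path i) (hβ : β.bideg₁ ≤ n) (t : ℤ)
    (x : koszul (D.M α.tgt) (n + 1 - α.bideg₁))
    (hx : x ∈ (koszul (D.M α.tgt) (n + 1 - α.bideg₁)).deg (-(α.bideg₂ : ℤ) + t)) :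
    compPath ⟨β, hβ⟩ (e (inclPath ⟨α, hα⟩ x)) ∈
      (koszul (D.M β.tgt) (n - β.bideg₁)).deg (-(β.bideg₂ : ℤ) + t) :=
  compPath_mem_deg (e.map_deg _ _ (inclPath_mem_deg (p := ⟨α, hα⟩) hx)) ⟨β, hβ⟩

/-- The summand of `α` in degree `n + 1` is generated in internal degree `n + 1 + α.ddeg`, and the
summand of `β` in degree `n` in internal degree `n + β.ddeg`. If these differ, then the component of
the differential maps to the radical. -/
theorem isMinimal (hd : ∀ n, IsGoodAt D n d (d n)) (i : Fin (D.N + 1))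
    (H : ∀ α β : D.Path i, Path.Lt α β → α.ddeg ≠ β.ddeg - 1) :
    IsMinimal (D.term i) (fun n => d n i) := by
  intro n x
  refine term_induction_path (p := fun x => d n i x ∈ (D.term i n).radical) x ?_ ?_ ?_
  · rw [map_zero]; exact Submodule.zero_mem _
  · intro x y hx hy; rw [map_add]; exact Submodule.add_mem _ hx hy
  · rintro ⟨α, hα⟩ z
    refine mem_radical_directSum (X := D.summand i n) fun β => ?_
    obtain ⟨β, hβ⟩ := β
    by_cases hαβ : α = β ∨ Path.Lt α β
    · have hne : α.ddeg ≠ β.ddeg - 1 := by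
        rcases hαβ with rfl | h
        · omega
        · exact H α β h
      have hne : (α.bideg₂ : ℤ) - α.bideg₁ ≠ (β.bideg₂ : ℤ) - β.bideg₁ - 1 := hne
      exact mem_radical_of_free (r := -(α.bideg₂ : ℤ)) (r' := -(β.bideg₂ : ℤ))
        (s := ((n + 1 - α.bideg₁ : ℕ) : ℤ)) (s' := ((n - β.bideg₁ : ℕ) : ℤ))
        (compPath ⟨β, hβ⟩ ∘ₗ (d n i).toLin ∘ₗ inclPath ⟨α, hα⟩)
        (fun t x hx => compPath_map_inclPath_mem_deg (d n i) α hα β hβ t x hx)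
        (by omega) z
    · rw [not_or] at hαβ
      have := compPath_map_inclPath_eq_zero hd α hα β hβ hαβ.1 hαβ.2 z
      have h0 := Submodule.zero_mem (D.summand i n ⟨β, hβ⟩).radical
      exact this ▸ h0

theorem even_ddeg (h : ∀ (i : Fin (D.N + 1)) (a : D.Arrow i), Even a.ddeg) (α : D.Path i) :
    Even α.ddeg := by
  induction α with
  | vertex i => exact ⟨0, rfl⟩
  | @cons i a p ih =>
    have : (Path.cons a p).ddeg = a.ddeg + p.ddeg := by
      change ((a.bideg₂ + p.bideg₂ : ℕ) : ℤ) - ((a.bideg₁ + p.bideg₁ : ℕ) : ℤ) =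
        ((a.bideg₂ : ℤ) - a.bideg₁) + ((p.bideg₂ : ℤ) - p.bideg₁)
      push_cast
      ring
    rw [this]
    exact (h i a).add ih

end ResolvingDatum

end Quad

end

open Quad Quad.ResolvingDatum in
theorem theorem2p6 {k : Type u} [Field k] {A : Type u} [Ring A] [Algebra k A]
    (𝒜 : ℕ → Submodule k A) [GradedAlgebra 𝒜] [FiniteDimensional k (𝒜 1)]
    (hA : IsQuadraticAlgebra 𝒜) (D : ResolvingDatum 𝒜) (hD : D.IsConnected) :
    (∃ (d : ∀ (i : Fin (D.N + 1)) (n : ℕ), GrHom (D.term i (n + 1)) (D.term i n))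
      (ε : ∀ i : Fin (D.N + 1), GrHom (D.term i 0) (D.M i)),
      ∀ i : Fin (D.N + 1),
        IsProjectiveResolution (D.term i) (d i) (D.M i) (ε i) ∧
        D.IsIteratedCone i (d i) ∧
        ((∀ α β : D.Path i, Path.Lt α β → α.ddeg ≠ β.ddeg - 1) →
          IsMinimal (D.term i) (d i))) ∧
    ((∀ (i : Fin (D.N + 1)) (a : D.Arrow i), Even a.ddeg) →
      ∀ (i : Fin (D.N + 1)) (α β : D.Path i), Path.Lt α β → α.ddeg ≠ β.ddeg - 1) := by
  refine ⟨?_, fun h i α β _ e => ?_⟩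
  · obtain ⟨d, hd⟩ := exists_forall_isGoodAt D
    exact ⟨fun i n => d n i, fun i => ⟨aug D i, fun _ _ hx => aug_mem_deg hx⟩, fun i =>
      ⟨isProjectiveResolution hd i, isIteratedCone hd i, isMinimal hd i⟩⟩
  · obtain ⟨x, hx⟩ := even_ddeg h α
    obtain ⟨y, hy⟩ := even_ddeg h β
    omega
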